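/- Let $n\ge 1$, $b_0>0$, $\beta\in\mathbb R$, and let $p>1$ be arbitrary if $n=1,2$ and $1<p\le \frac{n}{n-2}$ if $n\ge 3$. All functions are real valued. Consider the Cauchy problem $$u_{tt}-\Delta u-\frac{b_0}{(1+t)^{\beta}}\Delta u_t=|u|^p\quad (x\in\mathbb R^n,\ t>0),\qquad u(0)=u_0,\quad u_t(0)=u_1, \tag{1}$$ with $(u_0,u_1)\in H^1(\mathbb R^n)\times L^2(\mathbb R^n)$. For $t\ge s\ge 0$ let $R(t,s):H^1\times L^2\to H^1$ be the extension by continuity of the map which sends $(v_0,v_1)\in H^2\times H^2$ to $w(t)$, where $w\in C^1([s,\infty);H^2)\cap C^2([s,\infty);L^2)$ is the strong solution of $w_{tt}-\Delta w-\frac{b_0}{(1+t)^\beta}\Delta w_t=0$ (equality in $L^2$) with $w(s)=v_0$, $w_t(s)=v_1$. Put $S(t,s)g:=R(t,s)(0,g)$ for $g\in L^2$. For an interval $J=[0,T]$ or $J=[0,T)$ with $0<T<\infty$, or $J=[0,\infty)$, a mild solution of (1) on $J$ is a function $u\in C(J;H^1)\cap C^1(J;L^2)$ with $u(0)=u_0$,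 $u_t(0)=u_1$, with $|u(t)|^p\in L^2$ for all $t\in J$, and with $$u(t)=R(t,0)(u_0,u_1)+\int_0^tS(t,s)|u(s)|^p\,ds\quad\text{in }H^1\text{ for all }t\in J,$$ where the integral is a (convergent) Bochner integral in $H^1$. Then (1) has a unique maximal mild solution: there are $T_{\max}\in(0,\infty]$ and a mild solution $u\in C([0,T_{\max});H^1)\cap C^1([0,T_{\max});L^2)$ of (1) on $[0,T_{\max})$ such that, whenever $v$ is a mild solution of (1) on an interval $J$ as above, $J\subseteq[0,T_{\max})$ and $v=u$ on $J$. Moreover, if $T_{\max}<\infty$, then $$\|u(t)\|_{H^1}+\|u_t(t)\|_{2}\to\infty\qquad\text{as } t\to T_{\max}.$$ -/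

import Mathlib

open MeasureTheory Filter Topology Set
open scoped ContDiff

noncomputable section

namespace DampedWave

/-- The space `ℝⁿ` with its Euclidean structure. -/
abbrev Space (n : ℕ) : Type := EuclideanSpace ℝ (Fin n)

/-- The real Lebesgue space `L²(ℝⁿ)`. -/
abbrev L2 (n : ℕ) : Type := Lp ℝ 2 (volume : Measure (Space n))

/-- `g` is the weak partial derivative `∂ᵢ f` on `ℝⁿ`, tested against `C_c^∞(ℝⁿ)`. -/
def HasWeakPartial {n : ℕ} (i : Fin n) (f g : L2 n) : Prop :=
  ∀ φ : Space n → ℝ, ContDiff ℝ ∞ φ → HasCompactSupport φ →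
    ∫ x, f x * fderiv ℝ φ x (EuclideanSpace.single i 1) = -∫ x, g x * φ x

theorem integrable_mul_of_compact {n : ℕ} (f : L2 n) {φ : Space n → ℝ}
    (hφ : Continuous φ) (hc : HasCompactSupport φ) : Integrable (fun x => f x * φ x) :=
  MemLp.integrable_mul (p := 2) (q := 2) (Lp.memLp f) (hφ.memLp_of_hasCompactSupport hc)

theorem continuous_fderiv_single {n : ℕ} (i : Fin n) {φ : Space n → ℝ} (hφ : ContDiff ℝ ∞ φ) :
    Continuous (fun x => fderiv ℝ φ x (EuclideanSpace.single i 1)) :=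
  (hφ.continuous_fderiv (by simp)).clm_apply continuous_const

theorem compact_fderiv_single {n : ℕ} (i : Fin n) {φ : Space n → ℝ}
    (hc : HasCompactSupport φ) :
    HasCompactSupport (fun x => fderiv ℝ φ x (EuclideanSpace.single i 1)) :=
  hc.fderiv_apply ℝ _

theorem HasWeakPartial.zero {n : ℕ} (i : Fin n) : HasWeakPartial i (0 : L2 n) 0 := by
  intro φ _ _
  simp

theorem integral_add_mul {n : ℕ} (f g : L2 n) {φ : Space n → ℝ}
    (hφ : Continuous φ) (hc : HasCompactSupport φ) :
    ∫ x, (f + g : L2 n) x * φ x = (∫ x, f x * φ x) + ∫ x, g x * φ x := by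
  rw [← integral_add (integrable_mul_of_compact f hφ hc) (integrable_mul_of_compact g hφ hc)]
  apply integral_congr_ae
  filter_upwards [Lp.coeFn_add f g] with x hx
  rw [hx, Pi.add_apply, add_mul]

theorem integral_smul_mul {n : ℕ} (c : ℝ) (f : L2 n) (φ : Space n → ℝ) :
    ∫ x, (c • f : L2 n) x * φ x = c * ∫ x, f x * φ x := by
  rw [← integral_const_mul]
  apply integral_congr_ae
  filter_upwards [Lp.coeFn_smul c f] with x hx
  rw [hx, Pi.smul_apply, smul_eq_mul, mul_assoc]

theorem HasWeakPartial.add {n : ℕ} {i : Fin n} {f g f' g' : L2 n}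
    (h : HasWeakPartial i f g) (h' : HasWeakPartial i f' g') :
    HasWeakPartial i (f + f') (g + g') := by
  intro φ hφ hc
  rw [integral_add_mul f f' (continuous_fderiv_single i hφ) (compact_fderiv_single i hc),
    integral_add_mul g g' hφ.continuous hc, h φ hφ hc, h' φ hφ hc, neg_add]

theorem HasWeakPartial.smul {n : ℕ} {i : Fin n} {f g : L2 n} (c : ℝ)
    (h : HasWeakPartial i f g) : HasWeakPartial i (c • f) (c • g) := by
  intro φ hφ hc
  rw [integral_smul_mul, integral_smul_mul, h φ hφ hc, mul_neg]

theorem continuous_integral_mul {n : ℕ} {φ : Space n → ℝ}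
    (hφ : Continuous φ) (hc : HasCompactSupport φ) :
    Continuous (fun f : L2 n => ∫ x, f x * φ x) := by
  have hm : MemLp φ 2 (volume : Measure (Space n)) := hφ.memLp_of_hasCompactSupport hc
  have : (fun f : L2 n => ∫ x, f x * φ x) = fun f => inner ℝ (hm.toLp φ) f := by
    funext f
    rw [L2.inner_def]
    apply integral_congr_ae
    filter_upwards [hm.coeFn_toLp] with x hx
    simp [hx]
  rw [this]
  fun_prop

theorem isClosed_hasWeakPartial {n : ℕ} (i : Fin n) :
    IsClosed {q : L2 n × L2 n | HasWeakPartial i q.1 q.2} := by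
  simp only [HasWeakPartial, ofPred_forall]
  refine isClosed_iInter fun φ => isClosed_iInter fun hφ => isClosed_iInter fun hc => ?_
  exact isClosed_eq
    ((continuous_integral_mul (continuous_fderiv_single i hφ)
      (compact_fderiv_single i hc)).comp continuous_fst)
    ((continuous_integral_mul hφ.continuous hc).comp continuous_snd).neg

/-- `H¹(ℝⁿ)`, realized as the set of pairs `(u, ∇u)` with `u ∈ L²` and weak gradient
`∇u ∈ (L²)ⁿ`; the inherited norm is `‖u‖² = ‖u‖₂² + ∑ᵢ ‖∂ᵢu‖₂²`. -/
def H1Submodule (n : ℕ) : Submodule ℝ (WithLp 2 (L2 n × PiLp 2 fun _ : Fin n => L2 n)) where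
  carrier := {x | ∀ i, HasWeakPartial i x.fst (x.snd i)}
  zero_mem' := fun i => HasWeakPartial.zero i
  add_mem' := fun hx hy i => (hx i).add (hy i)
  smul_mem' := fun c _ hx i => (hx i).smul c

/-- The Sobolev space `H¹(ℝⁿ)` with its usual norm. -/
abbrev H1 (n : ℕ) : Type := H1Submodule n

instance (n : ℕ) : CompleteSpace (H1 n) := by
  have h : IsClosed (H1Submodule n :
      Set (WithLp 2 (L2 n × PiLp 2 fun _ : Fin n => L2 n))) := by
    have : (H1Submodule n : Set (WithLp 2 (L2 n × PiLp 2 fun _ : Fin n => L2 n))) =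
        ⋂ i, (fun x => (x.fst, x.snd i)) ⁻¹' {q : L2 n × L2 n | HasWeakPartial i q.1 q.2} := by
      ext x
      simp only [mem_iInter, mem_preimage]
      exact Iff.rfl
    rw [this]
    refine isClosed_iInter fun i => (isClosed_hasWeakPartial i).preimage ?_
    fun_prop
  exact h.completeSpace_coe

/-- The inclusion `H¹(ℝⁿ) → L²(ℝⁿ)`. -/
def H1.toL2 {n : ℕ} (u : H1 n) : L2 n := u.1.fst

/-- The weak partial derivative `∂ᵢ u ∈ L²(ℝⁿ)` of `u ∈ H¹(ℝⁿ)`. -/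
def H1.partialDeriv {n : ℕ} (u : H1 n) (i : Fin n) : L2 n := u.1.snd i

/-- `H²(ℝⁿ)`, realized as the set of pairs `(u, D²u)` with `u ∈ H¹` and all second weak
derivatives `∂ⱼ∂ᵢu` in `L²`; the inherited norm is
`‖u‖² = ‖u‖₂² + ∑ᵢ ‖∂ᵢu‖₂² + ∑ᵢⱼ ‖∂ⱼ∂ᵢu‖₂²`. -/
def H2Submodule (n : ℕ) :
    Submodule ℝ (WithLp 2 (H1 n × PiLp 2 fun _ : Fin n × Fin n => L2 n)) where
  carrier := {x | ∀ i j, HasWeakPartial j (H1.partialDeriv x.fst i) (x.snd (i, j))}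
  zero_mem' := fun _ j => HasWeakPartial.zero j
  add_mem' := fun hx hy i j => (hx i j).add (hy i j)
  smul_mem' := fun c _ hx i j => (hx i j).smul c

/-- The Sobolev space `H²(ℝⁿ)` with its usual norm. -/
abbrev H2 (n : ℕ) : Type := H2Submodule n

/-- The inclusion `H²(ℝⁿ) → H¹(ℝⁿ)`. -/
def H2.toH1 {n : ℕ} (u : H2 n) : H1 n := u.1.fst

/-- The Laplacian `Δ : H²(ℝⁿ) → L²(ℝⁿ)`. -/
def H2.laplacian {n : ℕ} (u : H2 n) : L2 n := ∑ i, u.1.snd (i, i)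

/-- `w` is a strong solution, on the time interval `[s, ∞)` and with data
`(w, w_t)(s) = (u₀, u₁) ∈ H² × H²`, of the linear equation
`w_tt - Δ w - b₀ (1+t)^(-β) Δ w_t = 0`:
`w ∈ C¹([s,∞); H²) ∩ C²([s,∞); L²)` and the equation holds in `L²`. -/
structure IsStrongSolution {n : ℕ} (b₀ β s : ℝ) (u₀ u₁ : H2 n) (w : ℝ → H2 n) : Prop where
  contDiffOn_H2 : ContDiffOn ℝ 1 w (Ici s)
  contDiffOn_L2 : ContDiffOn ℝ 2 (fun t => (w t).toH1.toL2) (Ici s)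
  init : w s = u₀
  init_deriv : derivWithin w (Ici s) s = u₁
  equation : ∀ t ∈ Ici s,
    iteratedDerivWithin 2 (fun τ => (w τ).toH1.toL2) (Ici s) t - (w t).laplacian
      - (b₀ / (1 + t) ^ β) • (derivWithin w (Ici s) t).laplacian = 0

/-- The strong solution of the linear problem started at time `s` from data in `H² × H²`
(for `s ≥ 0` and `b₀ > 0` it exists and is unique on `[s, ∞)`). -/
def strongSolution {n : ℕ} (b₀ β s : ℝ) (d : H2 n × H2 n) : ℝ → H2 n :=
  Classical.epsilon fun w => IsStrongSolution b₀ β s d.1 d.2 w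

/-- The propagator `R(t,s) : H¹ × L² → H¹` (`t ≥ s ≥ 0`): the extension by continuity, from
`H² × H²` to `H¹ × L²`, of the map sending the data at time `s` to the strong solution of the
linear homogeneous equation at time `t`. -/
def R {n : ℕ} (b₀ β t s : ℝ) (d : H1 n × L2 n) : H1 n :=
  limUnder (comap (fun e : H2 n × H2 n => (e.1.toH1, e.2.toH1.toL2)) (𝓝 d))
    (fun e => (strongSolution b₀ β s e t).toH1)

/-- `S(t,s) g = R(t,s)(0,g)`. -/
def S {n : ℕ} (b₀ β t s : ℝ) (g : L2 n) : H1 n := R b₀ β t s (0, g)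

open Classical in
/-- The nonlinearity `|v|^p` as an element of `L²(ℝⁿ)` (and `0` if `|v|^p ∉ L²`). -/
def absPow {n : ℕ} (p : ℝ) (v : L2 n) : L2 n :=
  if h : MemLp (fun x => |v x| ^ p) 2 (volume : Measure (Space n)) then h.toLp _ else 0

/-- `J` is a nondegenerate interval in `[0, ∞)` containing its left endpoint `0`, i.e. one of
`[0,T]`, `[0,T)` with `0 < T < ∞`, or `[0,∞)`. -/
structure IsTimeInterval (J : Set ℝ) : Prop where
  ordConnected : J.OrdConnected
  zero_mem : (0 : ℝ) ∈ J
  nonneg : J ⊆ Ici 0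
  nontrivial : J.Nontrivial

/-- The time derivative `u_t(t) ∈ L²` of a function `u : J → H¹`
(one-sided at the endpoints of the interval `J`). -/
def timeDeriv {n : ℕ} (J : Set ℝ) (u : ℝ → H1 n) (t : ℝ) : L2 n :=
  derivWithin (fun τ => (u τ).toL2) J t

/-- `u` is a mild solution on the time interval `J` of
`u_tt - Δ u - b₀ (1+t)^(-β) Δ u_t = |u|^p`, `(u, u_t)(0) = (u₀, u₁)`:
`u ∈ C(J; H¹) ∩ C¹(J; L²)` has these data and satisfies
`u(t) = R(t,0)(u₀,u₁) + ∫₀ᵗ S(t,s) |u(s)|^p ds` in `H¹` for all `t ∈ J`. -/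
structure IsMildSolution {n : ℕ} (b₀ β p : ℝ) (u₀ : H1 n) (u₁ : L2 n) (J : Set ℝ)
    (u : ℝ → H1 n) : Prop where
  continuousOn : ContinuousOn u J
  contDiffOn : ContDiffOn ℝ 1 (fun t => (u t).toL2) J
  init : u 0 = u₀
  init_deriv : timeDeriv J u 0 = u₁
  memLp : ∀ t ∈ J, MemLp (fun x => |(u t).toL2 x| ^ p) 2 (volume : Measure (Space n))
  integrable : ∀ t ∈ J,
    IntervalIntegrable (fun s => S b₀ β t s (absPow p (u s).toL2)) volume 0 t
  equation : ∀ t ∈ J,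
    u t = R b₀ β t 0 (u₀, u₁) + ∫ s in (0 : ℝ)..t, S b₀ β t s (absPow p (u s).toL2)

/-- The half-open time interval `[0, T)` with `T ∈ [-∞, ∞]`. -/
def lifeInterval (T : EReal) : Set ℝ := {t | 0 ≤ t ∧ (t : EReal) < T}

end DampedWave

end

open DampedWave

/-! Put `U = (u, u_t)`. The problem becomes the semilinear evolution equation `U(t) = P(t,0) U(0) +
∫₀ᵗ P(t,s) (0, |u(s)|^p) ds` on the energy space `H¹ × L²`, and everything rests on two facts. The
linear flow `P` is a strongly continuous evolution system with `‖P(t,s)‖ ≤ 2 e^{t-s}`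
(`isEvolution_waveProp`), and `u ↦ |u|^p` is Lipschitz from balls of `H¹` to `L²`
(`H1.exists_norm_absPow_sub_le`).

Linear part. With `a = b₀ (1+t)^(-β)`, `α = 1/a` and `g = w_t + α w`, the equation splits into `w_t
= g - α w` and `g_t = a Δg + α g + (α' - α²) w`: a heat equation in rescaled time coupled to an
ordinary differential equation by bounded terms. In Duhamel form this is a Volterra equation in `H²
× H²` without loss of derivatives, solved by a weighted contraction (`exists_volterra_solution`,
`HeatTriple.exists_isSolution`). The energy inequality (`HeatTriple.IsSolution.energy_le`) gives
uniqueness and a bound in `H¹ × L²`, so the solution map extends by density to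
`HeatTriple.propagator`, whose first component is `R` (`R_eq_waveProp`). The heat semigroup is
constructed by hand as a Gaussian average of translations.

Nonlinear part. The restriction on `p` says that `H¹` embeds in `L^{2p}` (`H1.exists_eLpNorm_le`),
and Hölder's inequality then gives the local Lipschitz bound. Truncating the nonlinearity at radius
`k` yields global solutions. They are glued for as long as they stay in their balls, and the time by
which a solution can be continued depends only on a bound for its norm, which gives the full limit
in the blow-up statement (`exists_maximal_mild`).

Back to the original formulation. The second component of `U` is the time derivative of the first
(`HeatTriple.fst_eq_of_isMildOn`). Uniqueness is Gronwall's inequality in `H¹`, and a competitor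
living up to or past the blow-up time would be bounded on a compact interval
(`IsMildSolution.subset_lifeInterval`). -/

noncomputable section

namespace DampedWave

/-! ### Volterra equations, Gronwall uniqueness and truncation of nonlinearities. -/

section Volterra

variable {X : Type*} [NormedAddCommGroup X] [NormedSpace ℝ X]

/-- A weight bound: `∫ₛᵗ m(r) e^{M(r) - M(t)} dr ≤ 1/2` for `M = ∫ₛ 2m`. -/
theorem integral_mul_exp_le_half {m : ℝ → ℝ} (hm : Continuous m) (s t : ℝ) :
    ∫ r in s..t, m r * Real.exp ((∫ q in s..r, 2 * m q) - ∫ q in s..t, 2 * m q) ≤ 1 / 2 := by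
  set M : ℝ → ℝ := fun r => ∫ q in s..r, 2 * m q
  have h2m : Continuous fun q => 2 * m q := by fun_prop
  have hM : ∀ r, HasDerivAt M (2 * m r) r := fun r =>
    intervalIntegral.integral_hasDerivAt_right (h2m.intervalIntegrable _ _)
      (h2m.stronglyMeasurableAtFilter _ _) h2m.continuousAt
  have hMc : Continuous M := continuous_iff_continuousAt.2 fun r => (hM r).continuousAt
  have hd : ∀ r ∈ uIcc s t, HasDerivAt (fun r => 1 / 2 * Real.exp (M r - M t))
      (m r * Real.exp (M r - M t)) r := fun r _ => by
    exact ((((hM r).sub_const (M t)).exp).const_mul (1 / 2)).congr_deriv (by ring)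
  change ∫ r in s..t, m r * Real.exp (M r - M t) ≤ 1 / 2
  rw [intervalIntegral.integral_eq_sub_of_hasDerivAt hd
    ((by fun_prop : Continuous fun r => m r * Real.exp (M r - M t)).intervalIntegrable _ _)]
  have : 0 < Real.exp (M s - M t) := Real.exp_pos _
  simp
  linarith

/-- Global solvability of the Volterra equation `x(t) = x₀(t) + ∫ₛᵗ F(t,r,x(r)) dr` when `F` is
globally Lipschitz in its last argument. -/
theorem exists_volterra_solution [CompleteSpace X] {F : ℝ → ℝ → X → X} {m : ℝ → ℝ} {x₀ : ℝ → X}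
    {s C : ℝ} (hF : Continuous fun q : ℝ × ℝ × X => F q.1 q.2.1 q.2.2) (hm : Continuous m)
    (hm0 : ∀ r, 0 ≤ m r)
    (hlip : ∀ t r x y, s ≤ r → r ≤ t → ‖F t r x - F t r y‖ ≤ Real.exp (t - r) * m r * ‖x - y‖)
    (hF0 : ∀ t r, F t r 0 = 0) (hx₀ : Continuous x₀)
    (hx₀C : ∀ t, s ≤ t → ‖x₀ t‖ ≤ C * Real.exp t) :
    ∃ x : ℝ → X, Continuous x ∧ ∀ t, s ≤ t → x t = x₀ t + ∫ r in s..t, F t r (x r) := by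
  set M : ℝ → ℝ := fun r => ∫ q in s..r, 2 * m q with hMdef
  have hMc : Continuous M :=
    intervalIntegral.continuous_primitive
      (fun a b => (by fun_prop : Continuous fun q => 2 * m q).intervalIntegrable a b) s
  -- The unknown is rescaled by `e^{-W}`. The summand `t` absorbs the factor `e^{t-r}` in the
  -- Lipschitz bound and the growth of `x₀`; the summand `M` makes the map a contraction of ratio
  -- `1/2`.
  set W : ℝ → ℝ := fun t => t + M t
  have hW : Continuous W := by fun_prop
  have hM0 : ∀ t, s ≤ t → 0 ≤ M t := fun t ht =>
    intervalIntegral.integral_nonneg ht fun r _ => by have := hm0 r; positivity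
  set Ψ : (ℝ → X) → ℝ → X := fun y t =>
    Real.exp (-W t) • (x₀ t + ∫ r in s..t, F t r (Real.exp (W r) • y r)) with hΨ
  have hcont : ∀ y : ℝ → X, Continuous y → Continuous (Ψ y) := fun y hy => by
    have : Continuous fun t => ∫ r in s..t, F t r (Real.exp (W r) • y r) :=
      intervalIntegral.continuous_parametric_intervalIntegral_of_continuous
        (f := fun t r => F t r (Real.exp (W r) • y r)) (by
          have : Continuous fun q : ℝ × ℝ => (q.1, q.2, Real.exp (W q.2) • y q.2) := by fun_prop
          exact hF.comp this) continuous_id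
    fun_prop
  have hdiff : ∀ (y z : ℝ → X) (D : ℝ), Continuous y → Continuous z → (∀ r, ‖y r - z r‖ ≤ D) →
      ∀ t, s ≤ t → ‖Ψ y t - Ψ z t‖ ≤ 1 / 2 * D := fun y z D hy hz hD t ht => by
    have hD0 : 0 ≤ D := (norm_nonneg _).trans (hD 0)
    have hc : ∀ y : ℝ → X, Continuous y →
        Continuous fun r => F t r (Real.exp (W r) • y r) := fun y hy => by
      have : Continuous fun r : ℝ => (t, r, Real.exp (W r) • y r) := by fun_prop
      exact hF.comp this
    have h1 : Ψ y t - Ψ z t = Real.exp (-W t) • ∫ r in s..t,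
        (F t r (Real.exp (W r) • y r) - F t r (Real.exp (W r) • z r)) := by
      rw [intervalIntegral.integral_sub ((hc y hy).intervalIntegrable _ _)
        ((hc z hz).intervalIntegrable _ _), hΨ, ← smul_sub]
      congr 1
      abel
    rw [h1, norm_smul, Real.norm_of_nonneg (Real.exp_pos _).le]
    have h2 : ‖∫ r in s..t, (F t r (Real.exp (W r) • y r) - F t r (Real.exp (W r) • z r))‖ ≤
        ∫ r in s..t, Real.exp (W t) * D * (m r * Real.exp (M r - M t)) := by
      refine intervalIntegral.norm_integral_le_of_norm_le ht ?_
        ((by fun_prop : Continuous fun r => Real.exp (W t) * D * (m r * Real.exp (M r - M t)))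
          |>.intervalIntegrable _ _)
      filter_upwards with r hr
      refine (hlip t r _ _ hr.1.le hr.2).trans ?_
      rw [← smul_sub, norm_smul, Real.norm_of_nonneg (Real.exp_pos _).le]
      calc Real.exp (t - r) * m r * (Real.exp (W r) * ‖y r - z r‖)
          ≤ Real.exp (t - r) * m r * (Real.exp (W r) * D) := by
            have := hm0 r
            have := hD r
            gcongr
        _ = (Real.exp (t - r) * Real.exp (W r)) * (D * m r) := by ring
        _ = (Real.exp (W t) * Real.exp (M r - M t)) * (D * m r) := by
            rw [← Real.exp_add, ← Real.exp_add]
            congr 2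
            simp only [W]
            ring
        _ = _ := by ring
    calc Real.exp (-W t) * _ ≤ Real.exp (-W t) * (Real.exp (W t) * D * (1 / 2)) := by
          gcongr
          refine h2.trans ?_
          rw [intervalIntegral.integral_const_mul]
          gcongr
          exact integral_mul_exp_le_half hm s t
      _ = (Real.exp (-W t) * Real.exp (W t)) * (1 / 2 * D) := by ring
      _ = 1 / 2 * D := by rw [← Real.exp_add]; simp
  have hΨ0 : ∀ t, s ≤ t → ‖Ψ 0 t‖ ≤ |C| := fun t ht => by
    simp only [hΨ, Pi.zero_apply, smul_zero, hF0, intervalIntegral.integral_zero, add_zero,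
      norm_smul, Real.norm_of_nonneg (Real.exp_pos _).le]
    calc Real.exp (-W t) * ‖x₀ t‖ ≤ Real.exp (-t) * (|C| * Real.exp t) := by
          gcongr
          · have := hM0 t ht
            simp only [W]
            linarith
          · refine (hx₀C t ht).trans ?_
            gcongr
            exact le_abs_self C
      _ = (Real.exp (-t) * Real.exp t) * |C| := by ring
      _ = |C| := by rw [← Real.exp_add]; simp
  have hbound : ∀ (y : BoundedContinuousFunction ℝ X) t,
      ‖Ψ y (max t s)‖ ≤ 1 / 2 * ‖y‖ + |C| := fun y t => by
    have := hdiff y 0 ‖y‖ y.continuous continuous_const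
      (fun r => by simpa using y.norm_coe_le_norm r) (max t s) (le_max_right _ _)
    calc ‖Ψ y (max t s)‖ ≤ ‖Ψ y (max t s) - Ψ 0 (max t s)‖ + ‖Ψ 0 (max t s)‖ := by
          simpa using norm_add_le (Ψ y (max t s) - Ψ 0 (max t s)) (Ψ 0 (max t s))
      _ ≤ _ := add_le_add this (hΨ0 _ (le_max_right _ _))
  -- Freezing the value to the left of `s` by `max t s` puts the problem in the complete space of
  -- bounded continuous functions on the whole line.
  let Φ : BoundedContinuousFunction ℝ X → BoundedContinuousFunction ℝ X := fun y =>
    BoundedContinuousFunction.ofNormedAddCommGroup (fun t => Ψ y (max t s))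
      ((hcont y y.continuous).comp (by fun_prop)) _ (hbound y)
  have hΦ : ContractingWith (1 / 2 : NNReal) Φ := by
    refine ⟨by rw [div_lt_one] <;> norm_num, LipschitzWith.of_dist_le_mul fun y z => ?_⟩
    rw [BoundedContinuousFunction.dist_le (by positivity)]
    intro t
    rw [dist_eq_norm]
    have := hdiff y z (dist y z) y.continuous z.continuous
      (fun r => by rw [← dist_eq_norm]; exact BoundedContinuousFunction.dist_coe_le_dist r)
      (max t s) (le_max_right _ _)
    simpa [Φ] using this
  let y := hΦ.fixedPoint
  have hy : Φ y = y := hΦ.fixedPoint_isFixedPt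
  refine ⟨fun t => Real.exp (W t) • y t, by fun_prop, fun t ht => ?_⟩
  have h3 : y t = Ψ y t := by
    conv_lhs => rw [← hy]
    simp [Φ, max_eq_left ht]
  simp only
  rw [h3, hΨ]
  simp only
  rw [smul_smul, ← Real.exp_add]
  simp

/-- Gronwall's inequality applied to the primitive `G` of `‖x - y‖`, which is differentiable with
`G' ≤ C G` and `G(s) = 0`. The Lipschitz bound is required only along the two given solutions, so a
local one suffices for solutions bounded on `[s,T]`. -/
theorem eqOn_of_volterra {F : ℝ → ℝ → X → X} {x₀ x y : ℝ → X} {s T C : ℝ}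
    (hx : ContinuousOn x (Icc s T)) (hy : ContinuousOn y (Icc s T))
    (hxi : ∀ t ∈ Icc s T, IntervalIntegrable (fun r => F t r (x r)) volume s t)
    (hyi : ∀ t ∈ Icc s T, IntervalIntegrable (fun r => F t r (y r)) volume s t)
    (hlip : ∀ t ∈ Icc s T, ∀ r ∈ Icc s t, ‖F t r (x r) - F t r (y r)‖ ≤ C * ‖x r - y r‖)
    (hxe : ∀ t ∈ Icc s T, x t = x₀ t + ∫ r in s..t, F t r (x r))
    (hye : ∀ t ∈ Icc s T, y t = x₀ t + ∫ r in s..t, F t r (y r)) :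
    EqOn x y (Icc s T) := by
  rcases lt_or_ge T s with hTs | hsT
  · simp [Icc_eq_empty_of_lt hTs]
  set D : ℝ → ℝ := IccExtend hsT ((Icc s T).domRestrict fun r => ‖x r - y r‖) with hD
  have hDc : Continuous D := (continuousOn_iff_continuous_domRestrict.1 (hx.sub hy).norm).Icc_extend'
  have hDe : ∀ t ∈ Icc s T, D t = ‖x t - y t‖ := fun t ht => by
    rw [hD, IccExtend_of_mem hsT _ ht]
    rfl
  set G : ℝ → ℝ := fun t => ∫ r in s..t, D r
  have hG : ∀ t, HasDerivAt G (D t) t := fun t =>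
    intervalIntegral.integral_hasDerivAt_right (hDc.intervalIntegrable _ _)
      (hDc.stronglyMeasurableAtFilter _ _) hDc.continuousAt
  have hG0 : ∀ t ∈ Icc s T, 0 ≤ G t := fun t ht =>
    intervalIntegral.integral_nonneg ht.1 fun r hr => by
      rw [hDe r ⟨hr.1, hr.2.trans ht.2⟩]
      exact norm_nonneg _
  have key : ∀ t ∈ Icc s T, D t ≤ C * G t := fun t ht => by
    rw [hDe t ht, hxe t ht, hye t ht, add_sub_add_left_eq_sub,
      ← intervalIntegral.integral_sub (hxi t ht) (hyi t ht),
      ← intervalIntegral.integral_const_mul]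
    refine intervalIntegral.norm_integral_le_of_norm_le ht.1 ?_
      ((hDc.const_mul C).intervalIntegrable _ _)
    filter_upwards with r hr
    rw [hDe r ⟨hr.1.le, hr.2.trans ht.2⟩]
    exact hlip t ht r ⟨hr.1.le, hr.2⟩
  have hgron := norm_le_gronwallBound_of_norm_deriv_right_le (f := G) (f' := D) (δ := 0) (K := C)
    (ε := 0) (a := s) (b := T)
    (continuous_iff_continuousAt.2 fun t => (hG t).continuousAt).continuousOn
    (fun t _ => (hG t).hasDerivWithinAt) (by simp [G]) (fun t ht => by
      have ht' : t ∈ Icc s T := ⟨ht.1, ht.2.le⟩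
      rw [add_zero, Real.norm_of_nonneg (hG0 t ht'), Real.norm_of_nonneg
        (by rw [hDe t ht']; exact norm_nonneg _)]
      exact key t ht')
  intro t ht
  have h1 : G t = 0 := by
    have := hgron t ht
    rw [gronwallBound_ε0_δ0] at this
    exact norm_le_zero_iff.1 this
  have h2 := key t ht
  rw [h1, mul_zero, hDe t ht] at h2
  exact sub_eq_zero.1 (norm_le_zero_iff.1 h2)

/-- Fubini on the triangle `s ≤ r < q ≤ t`: both sides are integrals over the square of `k` times
the indicator of `r < q`. -/
theorem integral_triangle_swap {k : ℝ → ℝ → X} (hk : Continuous fun q : ℝ × ℝ => k q.1 q.2)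
    {s t : ℝ} (hst : s ≤ t) :
    ∫ r in s..t, ∫ q in r..t, k q r = ∫ q in s..t, ∫ r in s..q, k q r := by
  have hA : ∀ r ∈ uIcc s t, ∫ q in r..t, k q r = ∫ q in s..t, (Ioi r).indicator (k · r) q := by
    intro r hr
    rw [uIcc_of_le hst] at hr
    rw [intervalIntegral.integral_of_le hr.2, intervalIntegral.integral_of_le hst,
      integral_indicator measurableSet_Ioi, Measure.restrict_restrict measurableSet_Ioi]
    congr 2
    ext q
    simp only [mem_inter_iff, mem_Ioi, mem_Ioc]
    exact ⟨fun h => ⟨h.1, hr.1.trans_lt h.1, h.2⟩, fun h => ⟨h.1, h.2.2⟩⟩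
  have hB : ∀ q ∈ uIcc s t, ∫ r in s..q, k q r = ∫ r in s..t, (Iio q).indicator (k q) r := by
    intro q hq
    rw [uIcc_of_le hst] at hq
    rw [intervalIntegral.integral_of_le hq.1, intervalIntegral.integral_of_le hst,
      integral_indicator measurableSet_Iio, Measure.restrict_restrict measurableSet_Iio,
      integral_Ioc_eq_integral_Ioo]
    congr 2
    ext r
    simp only [mem_inter_iff, mem_Iio, mem_Ioc, mem_Ioo]
    exact ⟨fun h => ⟨h.2, h.1, h.2.le.trans hq.2⟩, fun h => ⟨h.2.1, h.1⟩⟩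
  rw [intervalIntegral.integral_congr hA, intervalIntegral.integral_congr hB]
  set f : ℝ → ℝ → X := fun r q => {p : ℝ × ℝ | p.1 < p.2}.indicator (fun p => k p.2 p.1) (r, q)
  have e1 : ∀ r q, (Ioi r).indicator (k · r) q = f r q := fun r q => by
    simp only [f, indicator, mem_Ioi, mem_ofPred_eq]
  have e2 : ∀ r q, (Iio q).indicator (k q) r = f r q := fun r q => by
    simp only [f, indicator, mem_Iio, mem_ofPred_eq]
  simp only [e1, e2]
  refine intervalIntegral_intervalIntegral_swap ?_
  have hS : MeasurableSet {p : ℝ × ℝ | p.1 < p.2} := measurableSet_lt measurable_fst measurable_snd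
  refine Integrable.indicator (f := fun p : ℝ × ℝ => k p.2 p.1) ?_ hS
  have hc : Continuous fun p : ℝ × ℝ => k p.2 p.1 := hk.comp continuous_swap
  refine (hc.continuousOn.integrableOn_compact
    ((isCompact_uIcc (a := s) (b := t)).prod (isCompact_uIcc (a := s) (b := t)))).mono_set ?_
  exact prod_mono uIoc_subset_uIcc uIoc_subset_uIcc

/-- If `K(t,r) = h(r) + ∫ᵣᵗ k(q,r) dq`, then `t ↦ ∫ₛᵗ K(t,r) dr` is a primitive of
`h(q) + ∫ₛ^q k(q,r) dr`. -/
theorem integral_volterra_eq [CompleteSpace X] {K k : ℝ → ℝ → X} {h : ℝ → X}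
    (hk : Continuous fun q : ℝ × ℝ => k q.1 q.2) (hh : Continuous h) {s t : ℝ} (hst : s ≤ t)
    (hK : ∀ r ∈ Icc s t, K t r = h r + ∫ q in r..t, k q r) :
    ∫ r in s..t, K t r = ∫ q in s..t, (h q + ∫ r in s..q, k q r) := by
  have c1 : Continuous fun r => ∫ q in r..t, k q r := by
    have : Continuous fun r => ∫ q in t..r, k q r :=
      intervalIntegral.continuous_parametric_intervalIntegral_of_continuous
        (f := fun r q => k q r) (hk.comp continuous_swap) continuous_id
    simp_rw [intervalIntegral.integral_symm t]
    exact this.neg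
  have c2 : Continuous fun q => ∫ r in s..q, k q r :=
    intervalIntegral.continuous_parametric_intervalIntegral_of_continuous hk continuous_id
  rw [intervalIntegral.integral_congr (g := fun r => h r + ∫ q in r..t, k q r)
    (fun r hr => hK r (by rwa [uIcc_of_le hst] at hr)),
    intervalIntegral.integral_add (hh.intervalIntegrable _ _) (c1.intervalIntegrable _ _),
    intervalIntegral.integral_add (hh.intervalIntegrable _ _) (c2.intervalIntegrable _ _),
    integral_triangle_swap hk hst]

/-- Truncation of a locally Lipschitz map to a bounded, globally Lipschitz one. -/
theorem exists_lipschitz_truncation {X Y : Type*} [NormedAddCommGroup X]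
    [NormedAddCommGroup Y] [NormedSpace ℝ Y]
    {N : X → Y} (hN0 : N 0 = 0)
    (hN : ∀ R : ℝ, ∃ L : ℝ, ∀ x y, ‖x‖ ≤ R → ‖y‖ ≤ R → ‖N x - N y‖ ≤ L * ‖x - y‖) (R : ℝ)
    (hR : 0 ≤ R) :
    ∃ (N' : X → Y) (L B : ℝ), 0 ≤ L ∧ (∀ x y, ‖N' x - N' y‖ ≤ L * ‖x - y‖) ∧
      (∀ x, ‖N' x‖ ≤ B) ∧ ∀ x, ‖x‖ ≤ R → N' x = N x := by
  obtain ⟨L₀, hL₀⟩ := hN (R + 1)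
  set L := |L₀|
  have hL : ∀ x y, ‖x‖ ≤ R + 1 → ‖y‖ ≤ R + 1 → ‖N x - N y‖ ≤ L * ‖x - y‖ := fun x y hx hy =>
    (hL₀ x y hx hy).trans (by gcongr; exact le_abs_self _)
  have hL0 : 0 ≤ L := abs_nonneg _
  have hB : ∀ x, ‖x‖ ≤ R + 1 → ‖N x‖ ≤ L * (R + 1) := fun x hx => by
    have := hL x 0 hx (by simp; linarith)
    rw [hN0, sub_zero, sub_zero] at this
    exact this.trans (by gcongr)
  -- A 1-Lipschitz cutoff, equal to 1 on the ball of radius `R` and to 0 outside radius `R + 1`; the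
  -- truncation is `θ • N`.
  set θ : X → ℝ := fun x => max 0 (min 1 (R + 1 - ‖x‖)) with hθ
  have θ0 : ∀ x, 0 ≤ θ x := fun x => le_max_left _ _
  have θ1 : ∀ x, θ x ≤ 1 := fun x => max_le zero_le_one (min_le_left _ _)
  have θz : ∀ x, R + 1 ≤ ‖x‖ → θ x = 0 := fun x hx =>
    max_eq_left ((min_le_right _ _).trans (by linarith))
  have θl : ∀ x y, |θ x - θ y| ≤ ‖x - y‖ := fun x y => by
    refine (abs_max_sub_max_le_max _ _ _ _).trans ?_
    rw [sub_self, abs_zero, max_eq_right (abs_nonneg _)]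
    refine (abs_min_sub_min_le_max _ _ _ _).trans ?_
    rw [sub_self, abs_zero, max_eq_right (abs_nonneg _)]
    rw [show R + 1 - ‖x‖ - (R + 1 - ‖y‖) = ‖y‖ - ‖x‖ by ring, abs_sub_comm]
    exact abs_norm_sub_norm_le x y
  -- Only `y` has to lie in the larger ball: if `x` lies outside, `θ x = 0` kills the term in which
  -- `N x` occurs.
  have main : ∀ x y, ‖y‖ ≤ R + 1 → ‖θ x • N x - θ y • N y‖ ≤ (L + L * (R + 1)) * ‖x - y‖ := by
    intro x y hy
    have e : θ x • N x - θ y • N y = θ x • (N x - N y) + (θ x - θ y) • N y := by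
      rw [smul_sub, sub_smul]; abel
    rw [e, add_mul]
    refine (norm_add_le _ _).trans (add_le_add ?_ ?_)
    · rw [norm_smul, Real.norm_of_nonneg (θ0 x)]
      rcases le_or_gt (R + 1) ‖x‖ with hx | hx
      · rw [θz x hx, zero_mul]; positivity
      · calc θ x * ‖N x - N y‖ ≤ 1 * ‖N x - N y‖ := by gcongr; exact θ1 x
          _ ≤ _ := by rw [one_mul]; exact hL x y hx.le hy
    · rw [norm_smul, Real.norm_eq_abs, mul_comm]
      gcongr
      · exact hB y hy
      · exact θl x y
  refine ⟨fun x => θ x • N x, L + L * (R + 1), L * (R + 1), by positivity, fun x y => ?_,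
    fun x => ?_, fun x hx => ?_⟩
  · beta_reduce
    rcases le_or_gt ‖y‖ (R + 1) with hy | hy
    · exact main x y hy
    rcases le_or_gt ‖x‖ (R + 1) with hx | hx
    · rw [norm_sub_rev, norm_sub_rev x y]
      exact main y x hx
    · rw [θz x hx.le, θz y hy.le, zero_smul, zero_smul, sub_zero, norm_zero]
      positivity
  · beta_reduce
    rcases le_or_gt ‖x‖ (R + 1) with hx | hx
    · rw [norm_smul, Real.norm_of_nonneg (θ0 x)]
      calc θ x * ‖N x‖ ≤ 1 * ‖N x‖ := by gcongr; exact θ1 x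
        _ ≤ _ := by rw [one_mul]; exact hB x hx
    · rw [θz x hx.le, zero_smul, norm_zero]
      positivity
  · have : θ x = 1 := by
      simp only [hθ]
      rw [min_eq_left (by linarith), max_eq_right zero_le_one]
    simp only [this, one_smul]

/-- Strong continuity together with a locally bounded operator norm gives joint continuity: write `k
q₁ q₂ - k a x = k q₁ (q₂ - x) + (k q₁ x - k a x)`. -/
theorem continuous_clm_apply_of_bound {α Z : Type*} [TopologicalSpace α] [NormedAddCommGroup Z]
    [NormedSpace ℝ Z] {k : α → X →L[ℝ] Z} (hk : ∀ x, Continuous fun a => k a x) {b : α → ℝ}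
    (hb : Continuous b) (hkb : ∀ a x, ‖k a x‖ ≤ b a * ‖x‖) :
    Continuous fun q : α × X => k q.1 q.2 := by
  refine continuous_iff_continuousAt.2 fun ⟨a, x⟩ => ?_
  have h1 : Tendsto (fun q : α × X => b q.1 * ‖q.2 - x‖ + ‖k q.1 x - k a x‖) (𝓝 (a, x))
      (𝓝 (b a * ‖x - x‖ + ‖k a x - k a x‖)) := by
    refine Continuous.tendsto (f := fun q : α × X => b q.1 * ‖q.2 - x‖ + ‖k q.1 x - k a x‖) ?_ _
    have := hk x
    fun_prop
  rw [sub_self, sub_self, norm_zero, norm_zero, mul_zero, add_zero] at h1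
  refine tendsto_iff_norm_sub_tendsto_zero.2 (squeeze_zero (fun _ => norm_nonneg _) (fun q => ?_) h1)
  calc ‖k q.1 q.2 - k a x‖ = ‖k q.1 (q.2 - x) + (k q.1 x - k a x)‖ := by
        rw [map_sub]; congr 1; abel
    _ ≤ _ := (norm_add_le _ _).trans (add_le_add_left (hkb _ _) _)

end Volterra

end DampedWave

end

/-! ### Translations in `L²`, weak derivatives, and operators on `H¹` and `H²`. -/

noncomputable section

namespace DampedWave

variable {n : ℕ}

/-- The pairing of `L²` functions with a test function. -/
def testPairing {φ : Space n → ℝ} (hφ : Continuous φ) (hc : HasCompactSupport φ) : L2 n →L[ℝ] ℝ :=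
  innerSL ℝ ((hφ.memLp_of_hasCompactSupport hc : MemLp φ 2 volume).toLp φ)

theorem testPairing_apply {φ : Space n → ℝ} (hφ : Continuous φ) (hc : HasCompactSupport φ)
    (f : L2 n) : testPairing hφ hc f = ∫ x, f x * φ x := by
  rw [testPairing, innerSL_apply_apply, L2.inner_def]
  apply integral_congr_ae
  filter_upwards [(hφ.memLp_of_hasCompactSupport hc : MemLp φ 2 volume).coeFn_toLp] with x hx
  simp [hx]

theorem L2_ext_of_test {f g : L2 n} (h : ∀ φ : Space n → ℝ, ContDiff ℝ ∞ φ →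
    HasCompactSupport φ → ∫ x, f x * φ x = ∫ x, g x * φ x) : f = g := by
  rw [← sub_eq_zero, Lp.eq_zero_iff_ae_eq_zero]
  refine ae_eq_zero_of_integral_contDiff_smul_eq_zero
    ((Lp.memLp (f - g)).locallyIntegrable one_le_two) fun φ hφ hc => ?_
  have := testPairing_apply hφ.continuous hc (f - g)
  rw [map_sub, testPairing_apply, testPairing_apply, h φ hφ hc, sub_self] at this
  rw [this]
  simp [mul_comm]

/-- Translations `(translate y f)(x) = f(x + y)` of `L²(ℝⁿ)`. -/
def translate (y : Space n) : L2 n →ₗᵢ[ℝ] L2 n :=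
  Lp.compMeasurePreservingₗᵢ ℝ (fun x => x + y) (measurePreserving_add_right volume y)

theorem translate_ae (y : Space n) (f : L2 n) : translate y f =ᵐ[volume] fun x => f (x + y) :=
  Lp.coeFn_compMeasurePreserving f _

theorem continuous_translate (f : L2 n) : Continuous fun y => translate y f := by
  let g : C(Space n × Space n, Space n) := ⟨fun q => q.2 + q.1, by fun_prop⟩
  exact Continuous.compMeasurePreservingLp (f := fun _ : Space n => f) (g := fun y => g.curry y)
    continuous_const g.curry.continuous (fun y => measurePreserving_add_right volume y) (by simp)

theorem translate_add (y z : Space n) (f : L2 n) :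
    translate (y + z) f = translate y (translate z f) := by
  apply Lp.ext
  have h1 := (measurePreserving_add_right (volume : Measure (Space n)) y).quasiMeasurePreserving.ae_eq
    (translate_ae z f)
  filter_upwards [translate_ae (y + z) f, translate_ae y (translate z f), h1] with x h1 h2 h3
  rw [h1, h2]
  simp only [Function.comp_apply] at h3
  rw [h3, add_assoc]

@[simp] theorem translate_zero (f : L2 n) : translate 0 f = f := by
  apply Lp.ext
  filter_upwards [translate_ae 0 f] with x h1
  rw [h1, add_zero]

theorem inner_translate (y : Space n) (f g : L2 n) :
    inner ℝ (translate y f) g = inner ℝ f (translate (-y) g) := by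
  conv_lhs => rw [show g = translate y (translate (-y) g) by rw [← translate_add]; simp]
  exact (translate y).inner_map_map _ _

theorem integral_translate_mul (y : Space n) (f : L2 n) (φ : Space n → ℝ) :
    ∫ x, translate y f x * φ x = ∫ x, f x * φ (x - y) := by
  rw [← integral_add_right_eq_self (fun x => f x * φ (x - y)) y]
  apply integral_congr_ae
  filter_upwards [translate_ae y f] with x hx
  rw [hx, add_sub_cancel_right]

theorem contDiff_sub_const {φ : Space n → ℝ} (hφ : ContDiff ℝ ∞ φ) (y : Space n) :
    ContDiff ℝ ∞ fun x => φ (x - y) :=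
  hφ.comp (contDiff_id.sub contDiff_const)

theorem hasCompactSupport_sub_const {φ : Space n → ℝ} (hc : HasCompactSupport φ) (y : Space n) :
    HasCompactSupport fun x => φ (x - y) :=
  hc.comp_homeomorph (Homeomorph.subRight y)

theorem fderiv_sub_const_apply {φ : Space n → ℝ} (y x : Space n) :
    fderiv ℝ (fun x => φ (x - y)) x = fderiv ℝ φ (x - y) :=
  fderiv_comp_sub y

theorem HasWeakPartial.translate {i : Fin n} {f g : L2 n} (h : HasWeakPartial i f g)
    (y : Space n) : HasWeakPartial i (translate y f) (translate y g) := by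
  intro φ hφ hc
  rw [integral_translate_mul y f fun x => fderiv ℝ φ x (EuclideanSpace.single i 1),
    integral_translate_mul]
  have := h (fun x => φ (x - y)) (contDiff_sub_const hφ y) (hasCompactSupport_sub_const hc y)
  simpa only [fderiv_sub_const_apply] using this

/-- The integral is the convolution of `f` with the reflected test function, evaluated at `t • y`,
so the derivative falls on the smooth factor. -/
theorem hasDerivAt_integral_mul_translate (f : L2 n) {φ : Space n → ℝ} (hφ : ContDiff ℝ ∞ φ)
    (hc : HasCompactSupport φ) (y : Space n) (t : ℝ) :
    HasDerivAt (fun t : ℝ => ∫ x, f x * φ (x - t • y))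
      (-∫ x, f x * fderiv ℝ φ (x - t • y) y) t := by
  have hf : LocallyIntegrable f (volume : Measure (Space n)) :=
    (Lp.memLp f).locallyIntegrable one_le_two
  have hφ' : ContDiff ℝ 1 fun x => φ (-x) := (hφ.of_le (by simp)).comp contDiff_neg
  have hc' : HasCompactSupport fun x => φ (-x) := hc.comp_homeomorph (Homeomorph.neg _)
  have h := hc'.hasFDerivAt_convolution_right (ContinuousLinearMap.mul ℝ ℝ) hf hφ' (t • y)
  have h2 := h.comp_hasDerivAt t ((hasDerivAt_id t).smul_const y)
  have e : (fun t : ℝ => ∫ x, f x * φ (x - t • y)) =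
      (convolution f (fun x => φ (-x)) (ContinuousLinearMap.mul ℝ ℝ) volume) ∘
        fun t : ℝ => id t • y := by
    funext t
    simp [convolution_def]
  rw [e]
  refine h2.congr_deriv ?_
  rw [one_smul, convolution_precompR_apply _ hf (hc'.fderiv ℝ) (hφ'.continuous_fderiv one_ne_zero),
    convolution_def, ← integral_neg]
  refine integral_congr_ae (Eventually.of_forall fun x => ?_)
  have : fderiv ℝ (fun x => φ (-x)) (t • y - x) = -fderiv ℝ φ (x - t • y) := by
    have := fderiv_comp_smul (f := φ) (x := t • y - x) (-1 : ℝ)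
    simpa only [neg_smul, one_smul, neg_sub] using this
  simp [this]

theorem fderiv_eq_sum_single {φ : Space n → ℝ} (x y : Space n) :
    fderiv ℝ φ x y = ∑ i, y i * fderiv ℝ φ x (EuclideanSpace.single i 1) := by
  conv_lhs => rw [← (EuclideanSpace.basisFun (Fin n) ℝ).sum_repr y]
  simp [map_sum]

/-- If `g` is the weak derivative of `f` in direction `y`, then `t ↦ f(· + t y)` is
differentiable in `L²`. -/
theorem hasDerivAt_translate_smul_of_weak {f g : L2 n} (y : Space n)
    (h : ∀ φ : Space n → ℝ, ContDiff ℝ ∞ φ → HasCompactSupport φ →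
      ∫ x, f x * fderiv ℝ φ x y = -∫ x, g x * φ x) (t : ℝ) :
    HasDerivAt (fun t : ℝ => translate (t • y) f) (translate (t • y) g) t := by
  have hgc : Continuous fun t : ℝ => translate (t • y) g :=
    (continuous_translate g).comp (by fun_prop)
  -- The identity is checked against test functions, where it is the scalar fundamental theorem of
  -- calculus. As translations are strongly continuous, the right side is differentiable in the norm
  -- of `L²`, so a weak derivative becomes a strong one.
  have key : ∀ t : ℝ, translate (t • y) f = f + ∫ q in (0 : ℝ)..t, translate (q • y) g := by
    intro t
    refine L2_ext_of_test fun φ hφ hc => ?_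
    rw [← testPairing_apply hφ.continuous hc, ← testPairing_apply hφ.continuous hc, map_add,
      ← ContinuousLinearMap.intervalIntegral_comp_comm _ (hgc.intervalIntegrable _ _)]
    have hd : ∀ q : ℝ, HasDerivAt
        (fun t : ℝ => testPairing hφ.continuous hc (translate (t • y) f))
        (testPairing hφ.continuous hc (translate (q • y) g)) q := by
      intro q
      simp only [testPairing_apply hφ.continuous hc, integral_translate_mul]
      refine (hasDerivAt_integral_mul_translate f hφ hc _ q).congr_deriv ?_
      have := h _ (contDiff_sub_const hφ (q • y)) (hasCompactSupport_sub_const hc (q • y))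
      simp only [fderiv_sub_const_apply] at this
      rw [this, neg_neg]
    rw [intervalIntegral.integral_eq_sub_of_hasDerivAt (fun q _ => hd q)
      (((testPairing hφ.continuous hc).continuous.comp hgc).intervalIntegrable _ _)]
    simp
  rw [funext key]
  exact (intervalIntegral.integral_hasDerivAt_right (hgc.intervalIntegrable _ _)
    (hgc.stronglyMeasurableAtFilter _ _) hgc.continuousAt).const_add f

theorem HasWeakPartial.hasDerivAt_translate {i : Fin n} {f g : L2 n} (h : HasWeakPartial i f g)
    (t : ℝ) : HasDerivAt (fun t : ℝ => DampedWave.translate (t • EuclideanSpace.single i (1 : ℝ)) f)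
      (DampedWave.translate (t • EuclideanSpace.single i (1 : ℝ)) g) t :=
  hasDerivAt_translate_smul_of_weak _ h t

theorem hasDerivAt_translate_smul {f : L2 n} {g : Fin n → L2 n}
    (h : ∀ i, HasWeakPartial i f (g i)) (y : Space n) (t : ℝ) :
    HasDerivAt (fun t : ℝ => translate (t • y) f) (translate (t • y) (∑ i, y i • g i)) t := by
  refine hasDerivAt_translate_smul_of_weak y (fun φ hφ hc => ?_) t
  simp_rw [fderiv_eq_sum_single _ y, Finset.mul_sum]
  rw [integral_finsetSum, ← testPairing_apply hφ.continuous hc, map_sum,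
    ← Finset.sum_neg_distrib]
  · refine Finset.sum_congr rfl fun i _ => ?_
    rw [map_smul, testPairing_apply, smul_eq_mul, ← mul_neg, ← h i φ hφ hc, ← integral_const_mul]
    congr 1
    ext x
    ring
  · intro i _
    refine ((integrable_mul_of_compact f (continuous_fderiv_single i hφ)
      (compact_fderiv_single i hc)).const_mul (y i)).congr (Eventually.of_forall fun x => ?_)
    simp only
    ring

/-- Integration by parts in `H¹`. -/
theorem HasWeakPartial.inner_eq_neg {i : Fin n} {f g v w : L2 n} (h : HasWeakPartial i f g)
    (h' : HasWeakPartial i v w) : inner ℝ g v = -inner ℝ f w := by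
  -- Translation by `y` has adjoint translation by `-y`. Differentiating `⟨f(· + t e), v⟩ = ⟨f, v(·
  -- - t e)⟩` at `t = 0` in both forms gives the formula, with no approximation by test functions.
  have h1 : HasDerivAt (fun t : ℝ =>
      inner ℝ (DampedWave.translate (t • EuclideanSpace.single i (1 : ℝ)) f) v) (inner ℝ g v) 0 := by
    have := (h.hasDerivAt_translate 0).inner ℝ (hasDerivAt_const (0 : ℝ) v)
    simpa using this
  have h2 : HasDerivAt (fun t : ℝ =>
      inner ℝ f (DampedWave.translate (-t • EuclideanSpace.single i (1 : ℝ)) v))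
      (-inner ℝ f w) 0 := by
    have h3 := (h'.hasDerivAt_translate (-0)).scomp (0 : ℝ) (hasDerivAt_neg (0 : ℝ))
    have := (hasDerivAt_const (0 : ℝ) f).inner ℝ h3
    simpa [Function.comp_def] using this
  refine h1.unique ?_
  simpa only [inner_translate, neg_smul] using h2

/-! ### Cached instances on `H¹` and `H²` -/

/-- Cached instance. -/
@[reducible] def H1.normedAddCommGroup (n : ℕ) : NormedAddCommGroup (H1 n) := inferInstance

attribute [local instance] H1.normedAddCommGroup

/-- Cached instance. -/
@[reducible] def H1.normedSpace (n : ℕ) : NormedSpace ℝ (H1 n) := inferInstance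

attribute [local instance] H1.normedSpace

/-- Cached instance. -/
@[reducible] def H1.module (n : ℕ) : Module ℝ (H1 n) := inferInstance

attribute [local instance] H1.module

/-- Cached instance. -/
@[reducible] def H2.normedAddCommGroup (n : ℕ) : NormedAddCommGroup (H2 n) := inferInstance

attribute [local instance] H2.normedAddCommGroup

/-- Cached instance. -/
@[reducible] def H2.normedSpace (n : ℕ) : NormedSpace ℝ (H2 n) := inferInstance

attribute [local instance] H2.normedSpace

/-- Cached instance. -/
@[reducible] def H2.module (n : ℕ) : Module ℝ (H2 n) := inferInstance

attribute [local instance] H2.module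

/-! ### The maps between `L²`, `H¹` and `H²` -/

/-- The inclusion `H¹ → L²` as a continuous linear map. -/
def H1.toL2L (n : ℕ) : H1 n →L[ℝ] L2 n :=
  (WithLp.fstL 2 ℝ _ _).comp (H1Submodule n).subtypeL

/-- The weak partial derivative as a continuous linear map. -/
def H1.partialL {n : ℕ} (i : Fin n) : H1 n →L[ℝ] L2 n :=
  (PiLp.proj 2 (fun _ : Fin n => L2 n) i : (PiLp 2 fun _ : Fin n => L2 n) →L[ℝ] L2 n).comp
    ((WithLp.sndL 2 ℝ _ _).comp (H1Submodule n).subtypeL)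

/-- The inclusion `H² → H¹` as a continuous linear map. -/
def H2.toH1L (n : ℕ) : H2 n →L[ℝ] H1 n :=
  (WithLp.fstL 2 ℝ _ _).comp (H2Submodule n).subtypeL

/-- The weak second derivative `∂ⱼ∂ᵢ` as a continuous linear map. -/
def H2.partialL {n : ℕ} (q : Fin n × Fin n) : H2 n →L[ℝ] L2 n :=
  (PiLp.proj 2 (fun _ : Fin n × Fin n => L2 n) q :
    (PiLp 2 fun _ : Fin n × Fin n => L2 n) →L[ℝ] L2 n).comp
    ((WithLp.sndL 2 ℝ _ _).comp (H2Submodule n).subtypeL)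

/-- The Laplacian as a continuous linear map. -/
def H2.laplacianL (n : ℕ) : H2 n →L[ℝ] L2 n := ∑ i, H2.partialL (i, i)

@[simp] theorem H1.toL2L_apply (u : H1 n) : H1.toL2L n u = u.toL2 := rfl

@[simp] theorem H2.toH1L_apply (u : H2 n) : H2.toH1L n u = u.toH1 := rfl

@[simp] theorem H2.laplacianL_apply (u : H2 n) : H2.laplacianL n u = u.laplacian := by
  simp only [H2.laplacianL, sum_apply]
  rfl

theorem H1.hasWeakPartial (u : H1 n) (i : Fin n) : HasWeakPartial i u.toL2 (H1.partialL i u) :=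
  u.2 i

theorem H2.hasWeakPartial (u : H2 n) (i j : Fin n) :
    HasWeakPartial j (H1.partialL i u.toH1) (H2.partialL (i, j) u) :=
  u.2 i j

theorem H1.norm_sq (u : H1 n) : ‖u‖ ^ 2 = ‖u.toL2‖ ^ 2 + ∑ i, ‖H1.partialL i u‖ ^ 2 := by
  rw [Submodule.coe_norm, WithLp.prod_norm_sq_eq_of_L2, PiLp.norm_sq_eq_of_L2]
  rfl

theorem H1.inner_eq (u v : H1 n) : inner ℝ u v =
    inner ℝ u.toL2 v.toL2 + ∑ i, inner ℝ (H1.partialL i u) (H1.partialL i v) := by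
  rw [Submodule.coe_inner, WithLp.prod_inner_apply, PiLp.inner_apply]
  rfl

theorem H2.norm_sq (u : H2 n) : ‖u‖ ^ 2 = ‖u.toH1‖ ^ 2 + ∑ q, ‖H2.partialL q u‖ ^ 2 := by
  rw [Submodule.coe_norm, WithLp.prod_norm_sq_eq_of_L2, PiLp.norm_sq_eq_of_L2]
  rfl

theorem H1.norm_toL2_le (u : H1 n) : ‖u.toL2‖ ≤ ‖u‖ := by
  refine le_of_sq_le_sq ?_ (norm_nonneg _)
  rw [H1.norm_sq]
  exact le_add_of_nonneg_right (Finset.sum_nonneg fun _ _ => sq_nonneg _)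

/-- The element of `H¹` with given weak gradient. -/
def H1.ofWeak (f : L2 n) (g : Fin n → L2 n) (h : ∀ i, HasWeakPartial i f (g i)) : H1 n :=
  ⟨WithLp.toLp 2 (f, WithLp.toLp 2 g), h⟩

/-- The element of `H²` with given weak second derivatives. -/
def H2.ofWeak (u : H1 n) (g : Fin n × Fin n → L2 n)
    (h : ∀ i j, HasWeakPartial j (H1.partialL i u) (g (i, j))) : H2 n :=
  ⟨WithLp.toLp 2 (u, WithLp.toLp 2 g), h⟩

@[simp] theorem H1.toL2_ofWeak (f : L2 n) (g : Fin n → L2 n) (h) : (H1.ofWeak f g h).toL2 = f := rfl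

@[simp] theorem H1.partialL_ofWeak (f : L2 n) (g : Fin n → L2 n) (h) (i : Fin n) :
    H1.partialL i (H1.ofWeak f g h) = g i := rfl

@[simp] theorem H2.toH1_ofWeak (u : H1 n) (g : Fin n × Fin n → L2 n) (h) :
    (H2.ofWeak u g h).toH1 = u := rfl

@[simp] theorem H2.partialL_ofWeak (u : H1 n) (g : Fin n × Fin n → L2 n) (h) (q : Fin n × Fin n) :
    H2.partialL q (H2.ofWeak u g h) = g q := rfl

@[simp] theorem H1.toL2_sub (u v : H1 n) : (u - v).toL2 = u.toL2 - v.toL2 := rfl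

@[simp] theorem H1.toL2_smul (c : ℝ) (u : H1 n) : (c • u).toL2 = c • u.toL2 := rfl

@[simp] theorem H1.toL2_zero : (0 : H1 n).toL2 = 0 := rfl

theorem H1.ext' {u v : H1 n} (h : u.toL2 = v.toL2)
    (h' : ∀ i, H1.partialL i u = H1.partialL i v) : u = v :=
  Subtype.ext (WithLp.ofLp_injective 2 (Prod.ext h (WithLp.ofLp_injective 2 (funext h'))))

theorem H2.ext' {u v : H2 n} (h : u.toH1 = v.toH1)
    (h' : ∀ q, H2.partialL q u = H2.partialL q v) : u = v :=
  Subtype.ext (WithLp.ofLp_injective 2 (Prod.ext h (WithLp.ofLp_injective 2 (funext h'))))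

theorem continuous_H1_iff {α : Type*} [TopologicalSpace α] {u : α → H1 n} :
    Continuous u ↔ Continuous (fun a => (u a).toL2) ∧
      ∀ i, Continuous fun a => H1.partialL i (u a) := by
  refine ⟨fun h => ⟨(H1.toL2L n).continuous.comp h, fun i => (H1.partialL i).continuous.comp h⟩,
    fun ⟨h, h'⟩ => ?_⟩
  refine Continuous.subtype_mk (p := fun x => x ∈ H1Submodule n)
    (f := fun a => WithLp.toLp 2 ((u a).toL2, WithLp.toLp 2 fun i => H1.partialL i (u a))) ?_ _
  refine (WithLp.prod_continuous_toLp 2 _ _).comp (h.prodMk ?_)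
  exact (PiLp.continuous_toLp 2 _).comp (continuous_pi h')

theorem continuous_H2_iff {α : Type*} [TopologicalSpace α] {u : α → H2 n} :
    Continuous u ↔ Continuous (fun a => (u a).toH1) ∧
      ∀ q, Continuous fun a => H2.partialL q (u a) := by
  refine ⟨fun h => ⟨(H2.toH1L n).continuous.comp h, fun i => (H2.partialL i).continuous.comp h⟩,
    fun ⟨h, h'⟩ => ?_⟩
  refine Continuous.subtype_mk (p := fun x => x ∈ H2Submodule n)
    (f := fun a => WithLp.toLp 2 ((u a).toH1, WithLp.toLp 2 fun i => H2.partialL i (u a))) ?_ _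
  refine (WithLp.prod_continuous_toLp 2 _ _).comp (h.prodMk ?_)
  exact (PiLp.continuous_toLp 2 _).comp (continuous_pi h')

instance (n : ℕ) : CompleteSpace (H2 n) := by
  have h : IsClosed (H2Submodule n :
      Set (WithLp 2 (H1 n × PiLp 2 fun _ : Fin n × Fin n => L2 n))) := by
    have : (H2Submodule n : Set (WithLp 2 (H1 n × PiLp 2 fun _ : Fin n × Fin n => L2 n))) =
        ⋂ i, ⋂ j, (fun x => (H1.partialL i x.fst, x.snd (i, j))) ⁻¹'
          {q : L2 n × L2 n | HasWeakPartial j q.1 q.2} := by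
      ext x
      simp only [mem_iInter, mem_preimage]
      exact Iff.rfl
    rw [this]
    refine isClosed_iInter fun i => isClosed_iInter fun j =>
      (isClosed_hasWeakPartial j).preimage ?_
    fun_prop
  exact h.completeSpace_coe

/-- `A` commutes with weak differentiation. -/
abbrev CommutesWithPartials (A : L2 n →L[ℝ] L2 n) : Prop :=
  ∀ (i : Fin n) (f g : L2 n), HasWeakPartial i f g → HasWeakPartial i (A f) (A g)

/-- The operator on `H¹` induced by an operator on `L²` commuting with weak differentiation. -/
def H1.liftₗ (A : L2 n →L[ℝ] L2 n) (hA : CommutesWithPartials A) : H1 n →ₗ[ℝ] H1 n where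
  toFun := fun u => H1.ofWeak (A u.toL2) (fun i => A (H1.partialL i u))
    fun i => hA i _ _ (u.hasWeakPartial i)
  map_add' := fun u v => H1.ext' (A.map_add u.toL2 v.toL2)
    fun i => A.map_add (H1.partialL i u) (H1.partialL i v)
  map_smul' := fun c u => H1.ext' (A.map_smul c u.toL2)
    fun i => A.map_smul c (H1.partialL i u)

theorem H1.norm_liftₗ_le (A : L2 n →L[ℝ] L2 n) (hA : CommutesWithPartials A) (u : H1 n) :
    ‖H1.liftₗ A hA u‖ ≤ ‖A‖ * ‖u‖ := by
  refine le_of_sq_le_sq ?_ (by positivity)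
  rw [mul_pow, H1.norm_sq, H1.norm_sq, mul_add, Finset.mul_sum]
  simp only [H1.liftₗ, LinearMap.coe_mk, AddHom.coe_mk, H1.toL2_ofWeak,
    H1.partialL_ofWeak, ← mul_pow]
  gcongr <;> exact A.le_opNorm _

/-- `H1.liftₗ` as a continuous linear map. -/
def H1.lift (A : L2 n →L[ℝ] L2 n) (hA : CommutesWithPartials A) : H1 n →L[ℝ] H1 n :=
  (H1.liftₗ A hA).mkContinuous ‖A‖ (H1.norm_liftₗ_le A hA)

@[simp] theorem H1.partialL_lift (A : L2 n →L[ℝ] L2 n) (hA : CommutesWithPartials A) (u : H1 n)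
    (i : Fin n) : H1.partialL i (H1.lift A hA u) = A (H1.partialL i u) := rfl

theorem H1.norm_lift_le (A : L2 n →L[ℝ] L2 n) (hA : CommutesWithPartials A) (u : H1 n) :
    ‖H1.lift A hA u‖ ≤ ‖A‖ * ‖u‖ :=
  H1.norm_liftₗ_le A hA u

/-- The operator on `H²` induced by an operator on `L²` commuting with weak differentiation. -/
def H2.liftₗ (A : L2 n →L[ℝ] L2 n) (hA : CommutesWithPartials A) : H2 n →ₗ[ℝ] H2 n where
  toFun := fun u => H2.ofWeak (H1.lift A hA u.toH1) (fun q => A (H2.partialL q u))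
    fun i j => (by rw [H1.partialL_lift]; exact hA j _ _ (u.hasWeakPartial i j))
  map_add' := fun u v => H2.ext' ((H1.lift A hA).map_add u.toH1 v.toH1)
    fun q => A.map_add (H2.partialL q u) (H2.partialL q v)
  map_smul' := fun c u => H2.ext' ((H1.lift A hA).map_smul c u.toH1)
    fun q => A.map_smul c (H2.partialL q u)

theorem H2.norm_liftₗ_le (A : L2 n →L[ℝ] L2 n) (hA : CommutesWithPartials A) (u : H2 n) :
    ‖H2.liftₗ A hA u‖ ≤ ‖A‖ * ‖u‖ := by
  refine le_of_sq_le_sq ?_ (by positivity)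
  rw [mul_pow, H2.norm_sq, H2.norm_sq, mul_add, Finset.mul_sum]
  simp only [H2.liftₗ, LinearMap.coe_mk, AddHom.coe_mk, H2.toH1_ofWeak,
    H2.partialL_ofWeak, ← mul_pow]
  gcongr
  · exact H1.norm_lift_le A hA _
  · exact A.le_opNorm _

/-- `H2.liftₗ` as a continuous linear map. -/
def H2.lift (A : L2 n →L[ℝ] L2 n) (hA : CommutesWithPartials A) : H2 n →L[ℝ] H2 n :=
  (H2.liftₗ A hA).mkContinuous ‖A‖ (H2.norm_liftₗ_le A hA)

theorem H2.laplacian_lift (A : L2 n →L[ℝ] L2 n) (hA : CommutesWithPartials A) (u : H2 n) :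
    (H2.lift A hA u).laplacian = A u.laplacian :=
  (map_sum A _ _).symm

theorem H2.norm_lift_le (A : L2 n →L[ℝ] L2 n) (hA : CommutesWithPartials A) (u : H2 n) :
    ‖H2.lift A hA u‖ ≤ ‖A‖ * ‖u‖ :=
  H2.norm_liftₗ_le A hA u

/-- Green's formula `⟨Δw, v⟩ = -⟨∇w, ∇v⟩`. -/
theorem H2.inner_laplacian (w : H2 n) (v : H1 n) :
    inner ℝ w.laplacian v.toL2 =
      -∑ i, inner ℝ (H1.partialL i w.toH1) (H1.partialL i v) := by
  rw [H2.laplacian, sum_inner, ← Finset.sum_neg_distrib]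
  exact Finset.sum_congr rfl fun i _ => (w.hasWeakPartial i i).inner_eq_neg (v.hasWeakPartial i)

end DampedWave

end

/-! ### Gaussian averages of translations and the heat semigroup. -/

noncomputable section

namespace DampedWave

attribute [local instance] H1.normedAddCommGroup H1.normedSpace H1.module H2.normedAddCommGroup
  H2.normedSpace H2.module

variable {n : ℕ}

/-! ### Averages of translates -/

theorem integrable_smul_translate {ρ : Space n → ℝ} (hρ : Integrable ρ) (c : ℝ) (f : L2 n) :
    Integrable fun y => ρ y • translate (c • y) f := by
  refine hρ.smul_of_top_left ?_
  refine memLp_top_of_bound ((continuous_translate f).comp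
    (continuous_const_smul c)).aestronglyMeasurable ‖f‖ (Eventually.of_forall fun y => ?_)
  simp

/-- The average `∫ ρ(y) f(· + c y) dy`. -/
def average {ρ : Space n → ℝ} (hρ : Integrable ρ) (c : ℝ) : L2 n →L[ℝ] L2 n :=
  LinearMap.mkContinuous
    { toFun := fun f => ∫ y, ρ y • translate (c • y) f
      map_add' := fun f g => by
        simp only [map_add, smul_add]
        exact integral_add (integrable_smul_translate hρ c f) (integrable_smul_translate hρ c g)
      map_smul' := fun a f => by
        simp only [map_smul, RingHom.id_apply, smul_comm _ a]
        exact integral_smul a _ }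
    (∫ y, ‖ρ y‖) fun f => by
      refine (norm_integral_le_integral_norm _).trans_eq ?_
      simp only [norm_smul, LinearIsometry.norm_map]
      exact integral_mul_const _ _

theorem average_apply {ρ : Space n → ℝ} (hρ : Integrable ρ) (c : ℝ) (f : L2 n) :
    average hρ c f = ∫ y, ρ y • translate (c • y) f := rfl

theorem norm_average_le {ρ : Space n → ℝ} (hρ : Integrable ρ) (c : ℝ) :
    ‖average hρ c‖ ≤ ∫ y, ‖ρ y‖ :=
  LinearMap.mkContinuous_norm_le _ (integral_nonneg fun _ => norm_nonneg _) _

theorem continuous_average {ρ : Space n → ℝ} (hρ : Integrable ρ) (f : L2 n) :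
    Continuous fun c => average hρ c f := by
  simp only [average_apply]
  refine continuous_of_dominated (bound := fun y => ‖ρ y‖ * ‖f‖)
    (fun c => (integrable_smul_translate hρ c f).aestronglyMeasurable)
    (fun c => Eventually.of_forall fun y => ?_) (hρ.norm.mul_const _)
    (Eventually.of_forall fun y => ?_)
  · simp [norm_smul]
  · exact ((continuous_translate f).comp (by fun_prop : Continuous fun c : ℝ => c • y)).const_smul
      (ρ y)

theorem testPairing_average {φ : Space n → ℝ} (hφ : Continuous φ) (hc : HasCompactSupport φ)
    {ρ : Space n → ℝ} (hρ : Integrable ρ) (c : ℝ) (f : L2 n) :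
    testPairing hφ hc (average hρ c f) = ∫ y, ρ y * testPairing hφ hc (translate (c • y) f) := by
  rw [average_apply, ← ContinuousLinearMap.integral_comp_comm _ (integrable_smul_translate hρ c f)]
  simp

/-- Each translation preserves weak derivatives, and the pairing with a test function passes under
the average. -/
theorem commutesWithPartials_average {ρ : Space n → ℝ} (hρ : Integrable ρ) (c : ℝ) :
    CommutesWithPartials (average hρ c) := by
  intro i f g h φ hφ hc
  rw [← testPairing_apply (continuous_fderiv_single i hφ) (compact_fderiv_single i hc),
    ← testPairing_apply hφ.continuous hc, testPairing_average, testPairing_average, ← integral_neg]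
  congr 1
  ext y
  rw [testPairing_apply, testPairing_apply, h.translate (c • y) φ hφ hc, mul_neg]

/-- Averaging against a smooth kernel is smoothing. -/
theorem hasWeakPartial_average {ρ ρ' : Space n → ℝ} (hρ : Integrable ρ) (hρ' : Integrable ρ')
    {i : Fin n} (hd : ∀ y, HasLineDerivAt ℝ ρ (ρ' y) y (EuclideanSpace.single i 1))
    {c : ℝ} (hc0 : c ≠ 0) (f : L2 n) :
    HasWeakPartial i (average hρ c f) (-c⁻¹ • average hρ' c f) := by
  intro φ hφ hc
  have hφ' := continuous_fderiv_single i hφ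
  have hc' := compact_fderiv_single i hc
  rw [← testPairing_apply hφ' hc', ← testPairing_apply hφ.continuous hc, map_smul,
    testPairing_average, testPairing_average, smul_eq_mul]
  set k : Space n → ℝ := fun y => testPairing hφ.continuous hc (translate (c • y) f) with hk
  set k' : Space n → ℝ := fun y => testPairing hφ' hc' (translate (c • y) f) with hk'
  have hI : ∀ {ψ : Space n → ℝ} (hψ : Continuous ψ) (hψc : HasCompactSupport ψ)
      {r : Space n → ℝ}, Integrable r →
      Integrable fun y => r y * testPairing hψ hψc (translate (c • y) f) := by
    intro ψ hψ hψc r hr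
    simpa using (testPairing hψ hψc).integrable_comp (integrable_smul_translate hr c f)
  -- Moving `y` by `t e_i` translates `f` by `c t e_i`; by duality the derivative falls on the test
  -- function, with factor `-c`. Integration by parts in `y` then moves it to the kernel.
  have hkd : ∀ y, HasLineDerivAt ℝ k (-c * k' y) y (EuclideanSpace.single i 1) := by
    intro y
    have h1 := hasDerivAt_integral_mul_translate (translate (c • y) f) hφ hc
      (EuclideanSpace.single i 1) (0 * c)
    have h2 := h1.comp (0 : ℝ) ((hasDerivAt_id (0 : ℝ)).mul_const c)
    rw [HasLineDerivAt]
    refine (h2.congr_deriv ?_).congr_of_eventuallyEq (Eventually.of_forall fun t => ?_)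
    · simp only [zero_mul, zero_smul, sub_zero, one_mul, hk', testPairing_apply]
      ring
    · simp only [hk, Function.comp_apply, testPairing_apply, id]
      rw [← integral_translate_mul, ← translate_add, smul_add, smul_smul, add_comm, mul_comm t c]
  have hibp := integral_bilinear_hasLineDerivAt_right_eq_neg_left_of_integrable
    (μ := (volume : Measure (Space n))) (B := ContinuousLinearMap.mul ℝ ℝ) (f := ρ) (f' := ρ')
    (g := k) (g' := fun y => -c * k' y) (v := EuclideanSpace.single i 1)
    (hI hφ.continuous hc hρ')
    (by
      have := (hI hφ' hc' hρ).const_mul (-c)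
      refine this.congr (Eventually.of_forall fun y => ?_)
      simp only [ContinuousLinearMap.mul_apply', hk']
      ring)
    (hI hφ.continuous hc hρ) (fun y _ => hd y) (fun y _ => hkd y)
  simp only [ContinuousLinearMap.mul_apply'] at hibp
  have e : ∫ y, ρ y * (-c * k' y) = -c * ∫ y, ρ y * k' y := by
    rw [← integral_const_mul]
    congr 1
    ext y
    ring
  rw [e] at hibp
  field_simp
  linarith

/-- Averaging a weak derivative against a kernel. -/
theorem average_deriv {ρ ρ' : Space n → ℝ} (hρ : Integrable ρ) (hρ' : Integrable ρ')
    {i : Fin n} (hd : ∀ y, HasLineDerivAt ℝ ρ (ρ' y) y (EuclideanSpace.single i 1))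
    (c : ℝ) {f g : L2 n} (h : HasWeakPartial i f g) :
    average hρ' c f = -c • average hρ c g := by
  have hfd : ∀ y, HasLineDerivAt ℝ (fun y => translate (c • y) f) (c • translate (c • y) g) y
      (EuclideanSpace.single i 1) := by
    intro y
    have h1 := (h.hasDerivAt_translate (0 * c)).scomp (0 : ℝ) ((hasDerivAt_id (0 : ℝ)).mul_const c)
    have h2 := (translate (c • y)).toContinuousLinearMap.hasFDerivAt.comp_hasDerivAt (0 : ℝ) h1
    rw [HasLineDerivAt]
    refine (h2.congr_deriv ?_).congr_of_eventuallyEq (Eventually.of_forall fun t => ?_)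
    · simp
    · simp only [Function.comp_apply, LinearIsometry.coe_toContinuousLinearMap, id]
      rw [← translate_add, smul_add, smul_smul, mul_comm t c]
  have hibp := integral_bilinear_hasLineDerivAt_right_eq_neg_left_of_integrable
    (μ := (volume : Measure (Space n))) (B := ContinuousLinearMap.lsmul ℝ ℝ) (f := ρ) (f' := ρ')
    (g := fun y => translate (c • y) f) (g' := fun y => c • translate (c • y) g)
    (v := EuclideanSpace.single i 1)
    (by simpa using integrable_smul_translate hρ' c f)
    (by simpa [smul_comm _ c, Pi.smul_def] using (integrable_smul_translate hρ c g).smul c)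
    (by simpa using integrable_smul_translate hρ c f) (fun y _ => hd y) (fun y _ => hfd y)
  simp only [ContinuousLinearMap.lsmul_apply, smul_comm _ c] at hibp
  rw [integral_smul] at hibp
  rw [average_apply, average_apply, neg_smul, hibp, neg_neg]

/-! ### The Gaussian kernel -/

/-- The unnormalized Gaussian. -/
def gauss (y : Space n) : ℝ := Real.exp (-‖y‖ ^ 2 / 2)

theorem integrable_exp_neg_mul_norm_sq {b : ℝ} (hb : 0 < b) :
    Integrable fun y : Space n => Real.exp (-b * ‖y‖ ^ 2) := by
  have h := (GaussianFourier.integrable_cexp_neg_mul_sq_norm_add (V := Space n) (b := (b : ℂ))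
    (by simpa using hb) 0 0).norm
  refine h.congr (Eventually.of_forall fun y => ?_)
  simp only [Complex.norm_exp]
  congr 1
  simp [← Complex.ofReal_pow]

/-- Half of the Gaussian exponent absorbs a quadratic factor: `1 + r² ≤ 5 e^{r²/4}`, a consequence
of `1 + x ≤ e^x`. Quadratic growth suffices because only two derivatives of the kernel are needed to
land in `H²`. -/
theorem integrable_of_le_gauss {F : Space n → ℝ} (hF : Continuous F) {C : ℝ}
    (h : ∀ y, |F y| ≤ C * ((1 + ‖y‖ ^ 2) * gauss y)) : Integrable F := by
  refine ((integrable_exp_neg_mul_norm_sq (n := n) (b := 1 / 4) (by norm_num)).const_mul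
    (|C| * 5)).mono' hF.aestronglyMeasurable (Eventually.of_forall fun y => ?_)
  rw [Real.norm_eq_abs]
  have h1 : 1 + ‖y‖ ^ 2 ≤ 5 * Real.exp (‖y‖ ^ 2 / 4) := by
    have := Real.add_one_le_exp (‖y‖ ^ 2 / 4)
    have := sq_nonneg ‖y‖
    linarith
  calc |F y| ≤ |C| * ((1 + ‖y‖ ^ 2) * gauss y) :=
        (h y).trans (by
          have : 0 ≤ (1 + ‖y‖ ^ 2) * gauss y := by unfold gauss; positivity
          gcongr
          exact le_abs_self C)
    _ ≤ |C| * (5 * Real.exp (‖y‖ ^ 2 / 4) * gauss y) := by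
        unfold gauss
        gcongr
    _ = |C| * 5 * (Real.exp (‖y‖ ^ 2 / 4) * Real.exp (-‖y‖ ^ 2 / 2)) := by unfold gauss; ring
    _ = _ := by rw [← Real.exp_add]; congr 2; ring

theorem continuous_gauss : Continuous (gauss : Space n → ℝ) := by
  unfold gauss
  fun_prop

theorem gauss_pos (y : Space n) : 0 < gauss y := Real.exp_pos _

theorem integrable_gauss : Integrable (gauss : Space n → ℝ) :=
  integrable_of_le_gauss continuous_gauss (C := 1) fun y => by
    rw [abs_of_pos (gauss_pos y), one_mul]
    nlinarith [gauss_pos y, sq_nonneg ‖y‖]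

theorem continuous_coord (i : Fin n) : Continuous fun y : Space n => y i := by fun_prop

theorem abs_coord_le (y : Space n) (i : Fin n) : |y i| ≤ ‖y‖ := PiLp.norm_apply_le y i

theorem integrable_coord_mul_gauss (i : Fin n) :
    Integrable fun y : Space n => -(y i * gauss y) :=
  integrable_of_le_gauss ((continuous_coord i).mul continuous_gauss).neg (C := 1) fun y => by
    rw [abs_neg, abs_mul, abs_of_pos (gauss_pos y), one_mul]
    have := gauss_pos y
    gcongr
    have := abs_coord_le y i
    nlinarith [sq_nonneg (‖y‖ - 1), norm_nonneg y]

theorem integrable_coord_coord_mul_gauss (i j : Fin n) :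
    Integrable fun y : Space n => y i * y j * gauss y - (if i = j then 1 else 0) * gauss y :=
  integrable_of_le_gauss ((((continuous_coord i).mul (continuous_coord j)).mul
    continuous_gauss).sub (continuous_gauss.const_mul _)) (C := 1) fun y => by
    rw [← sub_mul, abs_mul, abs_of_pos (gauss_pos y), one_mul]
    have := gauss_pos y
    gcongr
    refine (abs_sub _ _).trans ?_
    rw [add_comm (1 : ℝ), abs_mul, sq]
    have h1 := abs_coord_le y i
    have h2 := abs_coord_le y j
    gcongr
    split_ifs <;> simp

theorem hasLineDerivAt_coord (i j : Fin n) (y : Space n) :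
    HasLineDerivAt ℝ (fun y : Space n => y i) (if i = j then 1 else 0) y
      (EuclideanSpace.single j 1) := by
  have h : HasDerivAt (fun t : ℝ => y i + t * (if i = j then 1 else 0)) (1 * (if i = j then 1 else 0)) 0 :=
    ((hasDerivAt_id (0 : ℝ)).mul_const _).const_add _
  rw [one_mul] at h
  rw [HasLineDerivAt]
  refine h.congr_of_eventuallyEq (Eventually.of_forall fun t => ?_)
  simp

theorem hasLineDerivAt_gauss (i : Fin n) (y : Space n) :
    HasLineDerivAt ℝ gauss (-(y i * gauss y)) y (EuclideanSpace.single i 1) := by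
  have h1 : HasFDerivAt (fun y : Space n => ‖y‖ ^ 2) (2 • innerSL ℝ y) y :=
    (hasStrictFDerivAt_norm_sq y).hasFDerivAt
  have h2 := ((h1.neg.mul_const (1 / 2)).exp).hasLineDerivAt (EuclideanSpace.single i 1)
  have e : (gauss : Space n → ℝ) = fun y => Real.exp (-‖y‖ ^ 2 * (1 / 2)) := by
    funext y
    unfold gauss
    congr 1
    ring
  rw [e]
  refine HasDerivAt.congr_deriv h2 ?_
  have : inner ℝ y (EuclideanSpace.single i (1 : ℝ)) = y i := by
    simpa using EuclideanSpace.inner_single_right i (1 : ℝ) y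
  simp [this]
  ring

theorem hasLineDerivAt_coord_mul_gauss (i j : Fin n) (y : Space n) :
    HasLineDerivAt ℝ (fun y : Space n => -(y i * gauss y))
      (y i * y j * gauss y - (if i = j then 1 else 0) * gauss y) y (EuclideanSpace.single j 1) := by
  have h := ((hasLineDerivAt_coord i j y).fun_mul (hasLineDerivAt_gauss j y)).neg
  refine HasDerivAt.congr_deriv h ?_
  simp
  ring

/-! ### The heat semigroup -/

/-- The heat operator `e^{τΔ}` on `L²(ℝⁿ)` (the identity for `τ ≤ 0`), as a Gaussian average. -/
def heat (τ : ℝ) : L2 n →L[ℝ] L2 n :=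
  (∫ y : Space n, gauss y)⁻¹ • average integrable_gauss (√(2 * τ))

theorem integral_gauss_pos : 0 < ∫ y : Space n, gauss y :=
  integral_pos_of_integrable_nonneg_nonzero continuous_gauss integrable_gauss
    (fun y => (gauss_pos y).le) (gauss_pos 0).ne'

theorem norm_heat_le (τ : ℝ) : ‖(heat τ : L2 n →L[ℝ] L2 n)‖ ≤ 1 := by
  have h := norm_average_le (integrable_gauss (n := n)) (√(2 * τ))
  have hp := integral_gauss_pos (n := n)
  rw [heat, norm_smul, norm_inv, Real.norm_of_nonneg hp.le, inv_mul_le_one₀ hp]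
  refine h.trans_eq (integral_congr_ae (Eventually.of_forall fun y => ?_))
  exact Real.norm_of_nonneg (gauss_pos y).le

theorem heat_of_nonpos {τ : ℝ} (hτ : τ ≤ 0) (f : L2 n) : heat τ f = f := by
  have h0 : √(2 * τ) = 0 := Real.sqrt_eq_zero_of_nonpos (by linarith)
  rw [heat, h0, smul_apply, average_apply]
  simp only [zero_smul, translate_zero]
  rw [integral_smul_const, smul_smul, inv_mul_cancel₀ integral_gauss_pos.ne', one_smul]

theorem continuous_heat (f : L2 n) : Continuous fun τ => heat τ f :=
  ((continuous_average integrable_gauss f).comp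
    (by fun_prop : Continuous fun τ : ℝ => √(2 * τ))).const_smul (∫ y : Space n, gauss y)⁻¹

theorem commutesWithPartials_heat (τ : ℝ) : CommutesWithPartials (heat τ : L2 n →L[ℝ] L2 n) :=
  fun _ _ _ h => (commutesWithPartials_average integrable_gauss _ _ _ _ h).smul _

/-- The heat equation for Gaussian averages. With `c = √(2τ)`, differentiation under the integral
produces `c' = 1/c` times averages of the first derivatives against `y_i gauss = -∂_i gauss`;
integration by parts produces a factor `c` and the second derivatives. The two factors cancel. -/
theorem hasDerivAt_average_gauss {f : L2 n} {g h : Fin n → L2 n}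
    (hg : ∀ i, HasWeakPartial i f (g i)) (hh : ∀ i, HasWeakPartial i (g i) (h i)) {τ : ℝ}
    (hτ : 0 < τ) :
    HasDerivAt (fun τ => average integrable_gauss (√(2 * τ)) f)
      (average integrable_gauss (√(2 * τ)) (∑ i, h i)) τ := by
  set c : ℝ → ℝ := fun τ => √(2 * τ) with hc
  have hcd : ∀ τ : ℝ, 0 < τ → HasDerivAt c (c τ)⁻¹ τ := by
    intro τ hτ
    refine (((hasDerivAt_id τ).const_mul 2).sqrt (by simp; linarith)).congr_deriv ?_
    simp only [hc, id]
    have : √(2 * τ) ≠ 0 := (Real.sqrt_pos.2 (by linarith)).ne'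
    field_simp
  have hc0 : c τ ≠ 0 := (Real.sqrt_pos.2 (by linarith)).ne'
  set F' : ℝ → Space n → L2 n := fun τ y =>
    (c τ)⁻¹ • ∑ i, (y i * gauss y) • translate (c τ • y) (g i) with hF'
  -- On `q > τ/2` the singular factor `1/c(q)` is bounded by `1/c(τ/2)`, which supplies the
  -- dominating function.
  have key := hasDerivAt_integral_of_dominated_loc_of_deriv_le (μ := (volume : Measure (Space n)))
    (F := fun τ y => gauss y • translate (c τ • y) f) (F' := F') (x₀ := τ)
    (s := Ioi (τ / 2)) (bound := fun y => (c (τ / 2))⁻¹ * ∑ i, ‖-(y i * gauss y)‖ * ‖g i‖)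
    (Ioi_mem_nhds (by linarith))
    (Eventually.of_forall fun τ => (integrable_smul_translate integrable_gauss _ f).aestronglyMeasurable)
    (integrable_smul_translate integrable_gauss _ f) ?_ ?_ ?_ ?_
  · refine key.2.congr_deriv ?_
    have hI : ∀ i, Integrable fun y : Space n => (y i * gauss y) • translate (c τ • y) (g i) :=
      fun i => by
        simpa using (integrable_smul_translate (integrable_coord_mul_gauss i) (c τ) (g i)).neg
    rw [hF', integral_smul, integral_finsetSum _ fun i _ => hI i, map_sum, Finset.smul_sum]
    refine Finset.sum_congr rfl fun i _ => ?_
    have h1 := average_deriv integrable_gauss (integrable_coord_mul_gauss i)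
      (hasLineDerivAt_gauss i) (c τ) (hh i)
    rw [average_apply] at h1
    simp only [neg_smul, integral_neg] at h1
    rw [neg_inj.1 h1, smul_smul, inv_mul_cancel₀ hc0, one_smul]
  · refine Continuous.aestronglyMeasurable ?_
    refine (continuous_finsetSum _ fun i _ => ?_).const_smul ((c τ)⁻¹)
    exact ((continuous_coord i).mul continuous_gauss).smul
      ((continuous_translate (g i)).comp (continuous_const_smul (c τ)))
  · refine Eventually.of_forall fun y q hq => ?_
    have hq' : τ / 2 < q := hq
    rw [hF', norm_smul, norm_inv, Real.norm_of_nonneg (Real.sqrt_nonneg _)]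
    have hpos : 0 < c (τ / 2) := Real.sqrt_pos.2 (by linarith)
    refine mul_le_mul ?_ ?_ (norm_nonneg _) (by positivity)
    · exact inv_anti₀ hpos (Real.sqrt_le_sqrt (by linarith))
    · refine (norm_sum_le _ _).trans (Finset.sum_le_sum fun i _ => ?_)
      rw [norm_smul, norm_neg, LinearIsometry.norm_map]
  · refine Integrable.const_mul (integrable_finsetSum _ fun i _ => ?_) _
    exact (integrable_coord_mul_gauss i).norm.mul_const _
  · refine Eventually.of_forall fun y q hq => ?_
    have hq' : τ / 2 < q := hq
    have h1 := (hasDerivAt_translate_smul hg y (c q)).scomp q (hcd q (by linarith))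
    refine (h1.const_smul (gauss y)).congr_deriv ?_
    rw [hF', map_sum, smul_comm, Finset.smul_sum]
    congr 1
    refine Finset.sum_congr rfl fun i _ => ?_
    rw [map_smul, smul_smul, mul_comm]

/-- The heat equation in integrated form. -/
theorem heat_eq_add_integral {f : L2 n} {g h : Fin n → L2 n}
    (hg : ∀ i, HasWeakPartial i f (g i)) (hh : ∀ i, HasWeakPartial i (g i) (h i)) {τ : ℝ}
    (hτ : 0 ≤ τ) : heat τ f = f + ∫ q in (0 : ℝ)..τ, heat q (∑ i, h i) := by
  have := intervalIntegral.integral_eq_sub_of_hasDerivAt_of_le hτ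
    (f := fun q => heat q f) (f' := fun q => heat q (∑ i, h i))
    (continuous_heat f).continuousOn
    (fun q hq => (hasDerivAt_average_gauss hg hh hq.1).const_smul (∫ y : Space n, gauss y)⁻¹)
    ((continuous_heat _).intervalIntegrable _ _)
  rw [this, heat_of_nonpos le_rfl, add_sub_cancel]

theorem H2.heat_eq_add_integral (u : H2 n) {τ : ℝ} (hτ : 0 ≤ τ) :
    heat τ u.toH1.toL2 = u.toH1.toL2 + ∫ q in (0 : ℝ)..τ, heat q u.laplacian :=
  DampedWave.heat_eq_add_integral (fun i => u.toH1.hasWeakPartial i)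
    (fun i => u.hasWeakPartial i i) hτ

/-! ### Density of `H²` -/

/-- The Gaussian regularization `e^{τΔ} f ∈ H²` of `f ∈ L²` for `τ > 0`. -/
def heatH2 {τ : ℝ} (hτ : 0 < τ) (f : L2 n) : H2 n :=
  have hc : √(2 * τ) ≠ 0 := (Real.sqrt_pos.2 (by linarith)).ne'
  H2.ofWeak (H1.ofWeak (heat τ f)
    (fun i => (∫ y : Space n, gauss y)⁻¹ •
      (-(√(2 * τ))⁻¹ • average (integrable_coord_mul_gauss i) (√(2 * τ)) f))
    fun i => (hasWeakPartial_average integrable_gauss (integrable_coord_mul_gauss i)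
      (hasLineDerivAt_gauss i) hc f).smul _)
    (fun q => (∫ y : Space n, gauss y)⁻¹ • (-(√(2 * τ))⁻¹ • (-(√(2 * τ))⁻¹ •
      average (integrable_coord_coord_mul_gauss q.1 q.2) (√(2 * τ)) f)))
    fun i j => ((hasWeakPartial_average (integrable_coord_mul_gauss i)
      (integrable_coord_coord_mul_gauss i j) (hasLineDerivAt_coord_mul_gauss i j) hc f).smul
        _).smul _

theorem denseRange_H2_toL2 : DenseRange fun u : H2 n => u.toH1.toL2 := by
  intro f
  have h : Tendsto (fun τ => heat τ f) (𝓝[>] 0) (𝓝 f) := by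
    have := (continuous_heat f).tendsto 0
    rw [heat_of_nonpos le_rfl] at this
    exact this.mono_left nhdsWithin_le_nhds
  refine mem_closure_of_tendsto h ?_
  filter_upwards [self_mem_nhdsWithin] with τ hτ
  exact ⟨heatH2 hτ f, rfl⟩

theorem weakPartial_unique {i : Fin n} {f g h : L2 n} (hg : HasWeakPartial i f g)
    (hh : HasWeakPartial i f h) : g = h :=
  L2_ext_of_test fun φ hφ hc => neg_injective ((hg φ hφ hc).symm.trans (hh φ hφ hc))

/-- For `u ∈ H¹` the regularization `heatH2` has the heat operator applied to `∂_i u` as its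
gradient, by uniqueness of weak derivatives. Strong continuity of the heat operator at `0` therefore
gives convergence in `H¹`, not only in `L²`. -/
theorem denseRange_H2_toH1 : DenseRange (H2.toH1 : H2 n → H1 n) := by
  intro u
  have h : Tendsto (fun τ => H1.lift (heat τ) (commutesWithPartials_heat τ) u) (𝓝[>] 0) (𝓝 u) := by
    have hc : Continuous fun τ => H1.lift (heat τ) (commutesWithPartials_heat τ) u :=
      continuous_H1_iff.2 ⟨continuous_heat _, fun i => continuous_heat _⟩
    have h0 : H1.lift (heat 0) (commutesWithPartials_heat 0) u = u :=
      H1.ext' (heat_of_nonpos le_rfl _) fun i => heat_of_nonpos le_rfl _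
    have := hc.tendsto 0
    rw [h0] at this
    exact this.mono_left nhdsWithin_le_nhds
  refine mem_closure_of_tendsto h ?_
  filter_upwards [self_mem_nhdsWithin] with τ hτ
  refine ⟨heatH2 hτ u.toL2, H1.ext' rfl fun i => ?_⟩
  exact weakPartial_unique ((heatH2 hτ u.toL2).toH1.hasWeakPartial i)
    ((H1.lift (heat τ) (commutesWithPartials_heat τ) u).hasWeakPartial i)

end DampedWave

end

/-! ### The abstract damped wave equation: energy inequality and regular solutions. -/

noncomputable section

namespace DampedWave

/-- A triple of spaces `V₂ → V₁ → V₀` modelled on `H² → H¹ → L²`, with a Laplacian `V₂ → V₀` and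
the contraction semigroup generated by it. -/
structure HeatTriple (V₀ V₁ V₂ : Type*) [NormedAddCommGroup V₀] [InnerProductSpace ℝ V₀]
    [NormedAddCommGroup V₁] [InnerProductSpace ℝ V₁] [NormedAddCommGroup V₂] [NormedSpace ℝ V₂]
    where
  i₁ : V₁ →L[ℝ] V₀
  i₂ : V₂ →L[ℝ] V₁
  lap : V₂ →L[ℝ] V₀
  heat₀ : ℝ → V₀ →L[ℝ] V₀
  heat₂ : ℝ → V₂ →L[ℝ] V₂
  norm_i₁_le : ∀ v, ‖i₁ v‖ ≤ ‖v‖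
  green : ∀ w v, inner ℝ (lap w) (i₁ v) = inner ℝ (i₁ (i₂ w)) (i₁ v) - inner ℝ (i₂ w) v
  norm_heat₀_le : ∀ τ f, ‖heat₀ τ f‖ ≤ ‖f‖
  norm_heat₂_le : ∀ τ u, ‖heat₂ τ u‖ ≤ ‖u‖
  continuous_heat₀ : ∀ f, Continuous fun τ => heat₀ τ f
  continuous_heat₂ : ∀ u, Continuous fun τ => heat₂ τ u
  heat₂_zero : ∀ u, heat₂ 0 u = u
  i_heat₂ : ∀ τ u, i₁ (i₂ (heat₂ τ u)) = heat₀ τ (i₁ (i₂ u))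
  lap_heat₂ : ∀ τ u, lap (heat₂ τ u) = heat₀ τ (lap u)
  heat_eq : ∀ τ u, 0 ≤ τ →
    heat₀ τ (i₁ (i₂ u)) = i₁ (i₂ u) + ∫ q in (0 : ℝ)..τ, heat₀ q (lap u)
  dense_i₂ : DenseRange i₂
  dense_i : DenseRange fun u => i₁ (i₂ u)

/-- A positive damping coefficient on `[0,∞)` whose inverse is continuously differentiable. -/
structure IsDamping (a α' : ℝ → ℝ) : Prop where
  continuous : Continuous a
  continuous' : Continuous α'
  pos : ∀ t, 0 < a t
  hasDeriv : ∀ t, 0 ≤ t → HasDerivWithinAt (fun t => (a t)⁻¹) (α' t) (Ici 0) t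

variable {V₀ V₁ V₂ : Type*} [NormedAddCommGroup V₀] [InnerProductSpace ℝ V₀]
    [NormedAddCommGroup V₁] [InnerProductSpace ℝ V₁] [NormedAddCommGroup V₂] [NormedSpace ℝ V₂]

namespace HeatTriple

variable (E : HeatTriple V₀ V₁ V₂)

/-- The embedding `V₂ → V₀`. -/
def i : V₂ →L[ℝ] V₀ := E.i₁.comp E.i₂

theorem i_apply (u : V₂) : E.i u = E.i₁ (E.i₂ u) := rfl

/-- `w` is a solution, with derivative `w'`, of `w'' = Δw + aΔw' + h` on `[s,∞)`. -/
structure IsSolution (a : ℝ → ℝ) (s : ℝ) (h : ℝ → V₀) (w w' : ℝ → V₂) : Prop where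
  hasDeriv : ∀ t ∈ Ici s, HasDerivWithinAt w (w' t) (Ici s) t
  continuousOn : ContinuousOn w' (Ici s)
  hasDeriv' : ∀ t ∈ Ici s,
    HasDerivWithinAt (fun t => E.i (w' t)) (E.lap (w t) + a t • E.lap (w' t) + h t) (Ici s) t

variable {E}

/-- The energy inequality. -/
theorem IsSolution.energy_le {a : ℝ → ℝ} (ha : ∀ t, 0 < a t) {s T H : ℝ} {h : ℝ → V₀}
    {w w' : ℝ → V₂} (hw : E.IsSolution a s h w w') (hH : ∀ t ∈ Icc s T, ‖h t‖ ≤ H) {t : ℝ}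
    (ht : t ∈ Icc s T) :
    ‖E.i₂ (w t)‖ ^ 2 + ‖E.i (w' t)‖ ^ 2 ≤
      Real.exp (2 * (t - s)) * (‖E.i₂ (w s)‖ ^ 2 + ‖E.i (w' s)‖ ^ 2 + (t - s) * H ^ 2) := by
  set e : ℝ → ℝ := fun t => ‖E.i₂ (w t)‖ ^ 2 + ‖E.i (w' t)‖ ^ 2 with he
  set e' : ℝ → ℝ := fun t => 2 * inner ℝ (E.i₂ (w t)) (E.i₂ (w' t)) +
    2 * inner ℝ (E.i (w' t)) (E.lap (w t) + a t • E.lap (w' t) + h t)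
  have hd : ∀ t ∈ Ici s, HasDerivWithinAt e (e' t) (Ici s) t := fun t ht =>
    ((E.i₂.hasFDerivAt.comp_hasDerivWithinAt t (hw.hasDeriv t ht)).norm_sq).add
      ((hw.hasDeriv' t ht).norm_sq)
  -- By Green's identity, `2⟨w', Δw⟩` cancels the term `2⟨w, w'⟩` in `V₁` up to an inner product in
  -- `V₀`, and the damping contributes `2a(‖w'‖²_{V₀} - ‖w'‖²_{V₁}) ≤ 0`. Young's inequality handles
  -- the rest.
  have hle : ∀ t, e' t ≤ 2 * e t + ‖h t‖ ^ 2 := fun t => by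
    have g1 := E.green (w t) (E.i₂ (w' t))
    have g2 := E.green (w' t) (E.i₂ (w' t))
    rw [real_inner_self_eq_norm_sq, real_inner_self_eq_norm_sq] at g2
    have n1 := pow_le_pow_left₀ (norm_nonneg _) (E.norm_i₁_le (E.i₂ (w' t))) 2
    have n2 := pow_le_pow_left₀ (norm_nonneg _) (E.norm_i₁_le (E.i₂ (w t))) 2
    have c1 := real_inner_le_norm (E.i (w t)) (E.i (w' t))
    have c2 := real_inner_le_norm (E.i (w' t)) (h t)
    have q1 := sq_nonneg (‖E.i (w t)‖ - ‖E.i (w' t)‖)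
    have q2 := sq_nonneg (‖E.i (w' t)‖ - ‖h t‖)
    have p := mul_nonneg (ha t).le (sub_nonneg.2 n1)
    simp only [e', he, inner_add_right, inner_smul_right, i_apply] at *
    rw [real_inner_comm] at g1 g2
    rw [g1, g2]
    nlinarith
  -- Gronwall's inequality in integrated form: the exponential factor removes `2e` and the linear
  -- term compensates `‖h‖² ≤ H²`.
  have hanti : AntitoneOn (fun t => Real.exp (-(2 * (t - s))) * e t - (t - s) * H ^ 2)
      (Icc s T) := by
    refine antitoneOn_of_hasDerivWithinAt_nonpos (convex_Icc s T)
      (f' := fun t => Real.exp (-(2 * (t - s))) * (e' t - 2 * e t) - H ^ 2) ?_ ?_ ?_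
    · refine ContinuousOn.sub (ContinuousOn.mul (by fun_prop) fun t ht => ?_) (by fun_prop)
      exact ((hd t ht.1).continuousWithinAt).mono Icc_subset_Ici_self
    · intro t ht
      rw [interior_Icc] at ht ⊢
      have h1 := (hd t ht.1.le).mono (s := Ioo s T) fun x hx => hx.1.le
      have h2 : HasDerivWithinAt (fun t => Real.exp (-(2 * (t - s))))
          (Real.exp (-(2 * (t - s))) * (-(2 * 1))) (Ioo s T) t :=
        ((((hasDerivAt_id t).sub_const s).const_mul 2).neg.exp).hasDerivWithinAt
      have h3 : HasDerivWithinAt (fun t => (t - s) * H ^ 2) (1 * H ^ 2) (Ioo s T) t :=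
        (((hasDerivAt_id t).sub_const s).mul_const _).hasDerivWithinAt
      refine ((h2.mul h1).sub h3).congr_deriv ?_
      ring
    · intro t ht
      rw [interior_Icc] at ht
      have h1 := hle t
      have h2 := pow_le_pow_left₀ (norm_nonneg _) (hH t ⟨ht.1.le, ht.2.le⟩) 2
      have h3 : Real.exp (-(2 * (t - s))) ≤ 1 := Real.exp_le_one_iff.2 (by linarith [ht.1])
      have h4 := Real.exp_pos (-(2 * (t - s)))
      have h5 : Real.exp (-(2 * (t - s))) * (e' t - 2 * e t) ≤
          Real.exp (-(2 * (t - s))) * H ^ 2 := by gcongr; linarith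
      nlinarith [sq_nonneg H]
  have := hanti (left_mem_Icc.2 (ht.1.trans ht.2)) ht ht.1
  simp only [sub_self, mul_zero, neg_zero, Real.exp_zero, one_mul, zero_mul, sub_zero] at this
  calc e t = Real.exp (2 * (t - s)) * (Real.exp (-(2 * (t - s))) * e t) := by
        rw [← mul_assoc, ← Real.exp_add]; simp
    _ ≤ _ := by gcongr; linarith

theorem continuous_heat₂_apply :
    Continuous fun q : ℝ × V₂ => E.heat₂ q.1 q.2 :=
  continuous_clm_apply_of_bound E.continuous_heat₂ (b := fun _ => 1) continuous_const
    fun τ u => by simpa using E.norm_heat₂_le τ u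

theorem continuous_heat₀_apply :
    Continuous fun q : ℝ × V₀ => E.heat₀ q.1 q.2 :=
  continuous_clm_apply_of_bound E.continuous_heat₀ (b := fun _ => 1) continuous_const
    fun τ u => by simpa using E.norm_heat₀_le τ u

/-- Variation of constants in `V₀` for the heat equation `g' = aΔg + h`. -/
theorem i_eq_integral [CompleteSpace V₀] [CompleteSpace V₂] {a ζ : ℝ → ℝ} (ha : Continuous a)
    (hζ : ∀ t, HasDerivAt ζ (a t) t) (hapos : ∀ t, 0 < a t) {s : ℝ} {g h : ℝ → V₂} {g₀ : V₂}
    (hh : Continuous h)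
    (hg : ∀ t, s ≤ t → g t = E.heat₂ (ζ t - ζ s) g₀ + ∫ r in s..t, E.heat₂ (ζ t - ζ r) (h r))
    {t : ℝ} (hst : s ≤ t) :
    E.i (g t) = E.i g₀ + ∫ q in s..t, (a q • E.lap (g q) + E.i (h q)) := by
  have hζc : Continuous ζ := continuous_iff_continuousAt.2 fun t => (hζ t).continuousAt
  have hζm : Monotone ζ := monotone_of_deriv_nonneg (fun t => (hζ t).differentiableAt)
    fun t => by rw [(hζ t).deriv]; exact (hapos t).le
  -- The primitive `ζ` of `a` is the intrinsic time of `g' = aΔg`: substituting `ζ q - ζ r` in the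
  -- integrated heat equation puts the factor `a q` under the integral.
  have hheat : ∀ (u : V₂) (r t : ℝ), r ≤ t → E.heat₀ (ζ t - ζ r) (E.i u) =
      E.i u + ∫ q in r..t, a q • E.heat₀ (ζ q - ζ r) (E.lap u) := by
    intro u r t hrt
    have h1 := E.heat_eq (ζ t - ζ r) u (sub_nonneg.2 (hζm hrt))
    have h2 := intervalIntegral.integral_deriv_smul_comp (a := r) (b := t)
      (f := fun q => ζ q - ζ r) (f' := a) (g := fun q => E.heat₀ q (E.lap u))
      (fun q _ => (hζ q).sub_const _) ha.continuousOn (E.continuous_heat₀ _)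
    simp only [Function.comp_apply, sub_self] at h2
    rw [i_apply, h1, h2]
  have hint : ∀ t, Continuous fun r => E.heat₂ (ζ t - ζ r) (h r) := fun t =>
    E.continuous_heat₂_apply.comp (by fun_prop : Continuous fun r => (ζ t - ζ r, h r))
  have hi : ∀ t, s ≤ t → E.i (g t) = E.heat₀ (ζ t - ζ s) (E.i g₀) +
      ∫ r in s..t, E.heat₀ (ζ t - ζ r) (E.i (h r)) := by
    intro t ht
    rw [hg t ht, map_add, ← ContinuousLinearMap.intervalIntegral_comp_comm _
      ((hint t).intervalIntegrable _ _)]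
    simp only [i_apply, E.i_heat₂]
  have hlap : ∀ t, s ≤ t → E.lap (g t) = E.heat₀ (ζ t - ζ s) (E.lap g₀) +
      ∫ r in s..t, E.heat₀ (ζ t - ζ r) (E.lap (h r)) := by
    intro t ht
    rw [hg t ht, map_add, ← ContinuousLinearMap.intervalIntegral_comp_comm _
      ((hint t).intervalIntegrable _ _)]
    simp only [E.lap_heat₂]
  have hk : Continuous fun q : ℝ × ℝ => a q.1 • E.heat₀ (ζ q.1 - ζ q.2) (E.lap (h q.2)) := by
    have : Continuous fun q : ℝ × ℝ => E.heat₀ (ζ q.1 - ζ q.2) (E.lap (h q.2)) :=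
      E.continuous_heat₀_apply.comp
        (by fun_prop : Continuous fun q : ℝ × ℝ => (ζ q.1 - ζ q.2, E.lap (h q.2)))
    fun_prop
  -- Exchanging the order of integration differentiates the Duhamel term; the semigroup law of the
  -- heat flow is never needed.
  have hvol := integral_volterra_eq (K := fun t r => E.heat₀ (ζ t - ζ r) (E.i (h r)))
    (k := fun q r => a q • E.heat₀ (ζ q - ζ r) (E.lap (h r))) (h := fun r => E.i (h r))
    hk (by fun_prop) hst fun r hr => hheat (h r) r t hr.2
  have hc1 : Continuous fun q => a q • E.heat₀ (ζ q - ζ s) (E.lap g₀) := by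
    have := (E.continuous_heat₀ (E.lap g₀)).comp (by fun_prop : Continuous fun q => ζ q - ζ s)
    exact ha.smul this
  have hc2 : Continuous fun q => E.i (h q) +
      ∫ r in s..q, a q • E.heat₀ (ζ q - ζ r) (E.lap (h r)) :=
    (by fun_prop : Continuous fun q => E.i (h q)).add
      (intervalIntegral.continuous_parametric_intervalIntegral_of_continuous
        (f := fun q r => a q • E.heat₀ (ζ q - ζ r) (E.lap (h r))) hk continuous_id)
  rw [hi t hst, hheat g₀ s t hst, hvol, add_assoc,
    ← intervalIntegral.integral_add (hc1.intervalIntegrable _ _) (hc2.intervalIntegrable _ _)]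
  congr 1
  refine intervalIntegral.integral_congr fun q hq => ?_
  rw [uIcc_of_le hst] at hq
  rw [hlap q hq.1, smul_add, intervalIntegral.integral_smul]
  abel

variable (E) in
/-- Solvability of the linear Cauchy problem `w'' = Δw + aΔw'` with data in `V₂ × V₂`. -/
theorem exists_isSolution [CompleteSpace V₀] [CompleteSpace V₂] {a α' : ℝ → ℝ}
    (ha : IsDamping a α') {s : ℝ} (hs : 0 ≤ s) (v₀ v₁ : V₂) :
    ∃ w w', E.IsSolution a s 0 w w' ∧ w s = v₀ ∧ w' s = v₁ := by
  -- With `g = w' + αw` one has `aΔg = Δw + aΔw'`, hence `w' = g - αw` and `g' = aΔg + αg + (α' -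
  -- α²)w`. The heat flow handles `aΔg`, and all remaining terms are bounded on `V₂`.
  set α : ℝ → ℝ := fun t => (a t)⁻¹ with hα
  have hαc : Continuous α := ha.continuous.inv₀ fun t => (ha.pos t).ne'
  set c : ℝ → ℝ := fun t => α' t - α t ^ 2 with hc
  have hcc : Continuous c := ha.continuous'.sub (hαc.pow 2)
  set ζ : ℝ → ℝ := fun t => ∫ q in (0 : ℝ)..t, a q
  have hζ : ∀ t, HasDerivAt ζ (a t) t := fun t =>
    intervalIntegral.integral_hasDerivAt_right (ha.continuous.intervalIntegrable _ _)
      (ha.continuous.stronglyMeasurableAtFilter _ _) ha.continuous.continuousAt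
  have hζc : Continuous ζ := continuous_iff_continuousAt.2 fun t => (hζ t).continuousAt
  set g₀ : V₂ := v₁ + α s • v₀ with hg₀
  -- The Duhamel kernel of this system for the pair `x = (w, g)`. It is linear in `x`, and since
  -- `heat₂` is a contraction its norm is at most `1 + |α| + |c|`.
  set F : ℝ → ℝ → V₂ × V₂ → V₂ × V₂ := fun t r x =>
    (x.2 - α r • x.1, E.heat₂ (ζ t - ζ r) (α r • x.2 + c r • x.1)) with hF
  have hFc : Continuous fun q : ℝ × ℝ × (V₂ × V₂) => F q.1 q.2.1 q.2.2 := by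
    refine Continuous.prodMk (by fun_prop) ?_
    exact E.continuous_heat₂_apply.comp (by fun_prop : Continuous fun q : ℝ × ℝ × (V₂ × V₂) =>
      (ζ q.1 - ζ q.2.1, α q.2.1 • q.2.2.2 + c q.2.1 • q.2.2.1))
  have hFs : ∀ t r x y, F t r x - F t r y = F t r (x - y) := fun t r x y => by
    ext
    · simp only [hF, Prod.fst_sub, Prod.snd_sub, smul_sub]; abel
    · simp only [hF, Prod.fst_sub, Prod.snd_sub, smul_sub, ← map_sub]
      congr 1
      abel
  have hFn : ∀ t r x, ‖F t r x‖ ≤ (1 + |α r| + |c r|) * ‖x‖ := fun t r x => by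
    have h1 := norm_fst_le x
    have h2 := norm_snd_le x
    have p1 := abs_nonneg (α r)
    have p2 := abs_nonneg (c r)
    refine max_le ?_ ?_
    · refine (norm_sub_le _ _).trans ?_
      rw [norm_smul, Real.norm_eq_abs]
      nlinarith [norm_nonneg x, mul_nonneg p2 (norm_nonneg x)]
    · refine (E.norm_heat₂_le _ _).trans ((norm_add_le _ _).trans ?_)
      rw [norm_smul, norm_smul, Real.norm_eq_abs, Real.norm_eq_abs]
      nlinarith [norm_nonneg x, mul_nonneg p2 (norm_nonneg x)]
  obtain ⟨x, hxc, hx⟩ := exists_volterra_solution (F := F) (m := fun r => 1 + |α r| + |c r|)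
    (x₀ := fun t => (v₀, E.heat₂ (ζ t - ζ s) g₀)) (s := s)
    (C := ‖((v₀, g₀) : V₂ × V₂)‖ * Real.exp (-s)) hFc (by fun_prop)
    (fun r => by positivity)
    (fun t r x y _ hrt => by
      rw [hFs]
      refine (hFn t r _).trans ?_
      have : 1 ≤ Real.exp (t - r) := Real.one_le_exp (by linarith)
      have h0 : 0 ≤ (1 + |α r| + |c r|) * ‖x - y‖ := by positivity
      nlinarith)
    (fun t r => by simp [hF])
    (continuous_const.prodMk ((E.continuous_heat₂ g₀).comp
      (by fun_prop : Continuous fun t => ζ t - ζ s)))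
    (fun t ht => by
      rw [mul_assoc, ← Real.exp_add]
      have h1 : 1 ≤ Real.exp (-s + t) := Real.one_le_exp (by linarith)
      have h2 : ‖(v₀, E.heat₂ (ζ t - ζ s) g₀)‖ ≤ ‖((v₀, g₀) : V₂ × V₂)‖ :=
        max_le (le_max_left _ _) ((E.norm_heat₂_le _ _).trans (le_max_right _ _))
      nlinarith [norm_nonneg ((v₀, g₀) : V₂ × V₂)])
  set f : ℝ → V₂ := fun t => (x t).1
  set g : ℝ → V₂ := fun t => (x t).2
  have hfc : Continuous f := continuous_fst.comp hxc
  have hgc : Continuous g := continuous_snd.comp hxc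
  set h : ℝ → V₂ := fun r => α r • g r + c r • f r
  have hhc : Continuous h := by fun_prop
  set w' : ℝ → V₂ := fun t => g t - α t • f t with hw'
  have hw'c : Continuous w' := by fun_prop
  have hFi : ∀ t, IntervalIntegrable (fun r => F t r (x r)) volume s t := fun t =>
    (hFc.comp (by fun_prop : Continuous fun r => (t, r, x r))).intervalIntegrable _ _
  have hf : ∀ t, s ≤ t → f t = v₀ + ∫ r in s..t, w' r := fun t ht => by
    have h1 := congrArg Prod.fst (hx t ht)
    rw [Prod.fst_add] at h1
    have h2 := (ContinuousLinearMap.fst ℝ V₂ V₂).intervalIntegral_comp_comm (hFi t)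
    simp only [ContinuousLinearMap.coe_fst'] at h2
    rw [← h2] at h1
    exact h1
  have hg : ∀ t, s ≤ t → g t = E.heat₂ (ζ t - ζ s) g₀ + ∫ r in s..t, E.heat₂ (ζ t - ζ r) (h r) :=
    fun t ht => by
    have h1 := congrArg Prod.snd (hx t ht)
    rw [Prod.snd_add] at h1
    have h2 := (ContinuousLinearMap.snd ℝ V₂ V₂).intervalIntegral_comp_comm (hFi t)
    simp only [ContinuousLinearMap.coe_snd'] at h2
    rw [← h2] at h1
    exact h1
  have hfs : f s = v₀ := by simpa using hf s le_rfl
  have hgs : g s = g₀ := by simpa [E.heat₂_zero] using hg s le_rfl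
  have hfd : ∀ t ∈ Ici s, HasDerivWithinAt f (w' t) (Ici s) t := fun t ht => by
    have h1 : HasDerivAt (fun t => v₀ + ∫ r in s..t, w' r) (w' t) t :=
      (intervalIntegral.integral_hasDerivAt_right (hw'c.intervalIntegrable _ _)
        (hw'c.stronglyMeasurableAtFilter _ _) hw'c.continuousAt).const_add _
    exact h1.hasDerivWithinAt.congr (fun t ht => hf t ht) (hf t ht)
  have hgd : ∀ t ∈ Ici s, HasDerivWithinAt (fun t => E.i (g t))
      (a t • E.lap (g t) + E.i (h t)) (Ici s) t := fun t ht => by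
    have hcont : Continuous fun q => a q • E.lap (g q) + E.i (h q) := by
      have := ha.continuous
      fun_prop
    have h1 : HasDerivAt (fun t => E.i g₀ + ∫ q in s..t, (a q • E.lap (g q) + E.i (h q)))
        (a t • E.lap (g t) + E.i (h t)) t :=
      (intervalIntegral.integral_hasDerivAt_right (hcont.intervalIntegrable _ _)
        (hcont.stronglyMeasurableAtFilter _ _) hcont.continuousAt).const_add _
    exact h1.hasDerivWithinAt.congr
      (fun t ht => i_eq_integral ha.continuous hζ ha.pos hhc hg ht)
      (i_eq_integral ha.continuous hζ ha.pos hhc hg ht)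
  -- The equation for `g` has been integrated only in `V₀`, where `aΔg` lives. Undoing the
  -- substitution there gives the second-order equation, while `w` itself is `C¹` with values in
  -- `V₂`.
  refine ⟨f, w', ⟨hfd, hw'c.continuousOn, fun t ht => ?_⟩, hfs, ?_⟩
  · have h1 : HasDerivWithinAt α (α' t) (Ici s) t :=
      (ha.hasDeriv t (hs.trans ht)).mono (Ici_subset_Ici.2 hs)
    have h2 := E.i.hasFDerivAt.comp_hasDerivWithinAt t (hfd t ht)
    have h3 := (hgd t ht).sub (h1.smul h2)
    have e : (fun t => E.i (w' t)) =
        (fun t => E.i (g t)) - (α • (E.i ∘ f) : ℝ → V₀) := by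
      funext t
      simp [hw']
    rw [e]
    refine h3.congr_deriv ?_
    have hne := (ha.pos t).ne'
    have haα : a t * α t = 1 := mul_inv_cancel₀ hne
    simp only [Pi.zero_apply, add_zero, h, hw', hc, map_add, map_sub, map_smul, smul_sub,
      smul_smul, haα, one_smul, sub_smul, Function.comp_apply, pow_two]
    abel
  · simp [hw', hgs, hfs, hg₀]

end HeatTriple

end DampedWave

end

/-! ### The propagator on the energy space. -/

noncomputable section

namespace DampedWave

variable {V₀ V₁ V₂ : Type*} [NormedAddCommGroup V₀] [InnerProductSpace ℝ V₀]
    [NormedAddCommGroup V₁] [InnerProductSpace ℝ V₁] [NormedAddCommGroup V₂] [NormedSpace ℝ V₂]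

namespace HeatTriple

variable {E : HeatTriple V₀ V₁ V₂}

theorem IsSolution.add {a : ℝ → ℝ} {s : ℝ} {h k : ℝ → V₀} {w w' z z' : ℝ → V₂}
    (hw : E.IsSolution a s h w w') (hz : E.IsSolution a s k z z') :
    E.IsSolution a s (h + k) (w + z) (w' + z') where
  hasDeriv t ht := (hw.hasDeriv t ht).add (hz.hasDeriv t ht)
  continuousOn := hw.continuousOn.add hz.continuousOn
  hasDeriv' t ht := by
    have := (hw.hasDeriv' t ht).add (hz.hasDeriv' t ht)
    have e : (fun t => E.i ((w' + z') t)) = (fun t => E.i (w' t)) + fun t => E.i (z' t) := by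
      ext; simp
    rw [e]
    refine this.congr_deriv ?_
    simp only [Pi.add_apply, map_add, smul_add]
    abel

theorem IsSolution.smul {a : ℝ → ℝ} {s : ℝ} {h : ℝ → V₀} {w w' : ℝ → V₂}
    (hw : E.IsSolution a s h w w') (c : ℝ) :
    E.IsSolution a s (c • h) (c • w) (c • w') where
  hasDeriv t ht := (hw.hasDeriv t ht).const_smul c
  continuousOn := hw.continuousOn.const_smul c
  hasDeriv' t ht := by
    have := (hw.hasDeriv' t ht).const_smul c
    have e : (fun t => E.i ((c • w') t)) = c • fun t => E.i (w' t) := by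
      ext; simp
    rw [e]
    refine this.congr_deriv ?_
    simp only [Pi.smul_apply, map_smul, smul_add, smul_comm c]

theorem IsSolution.mono {a : ℝ → ℝ} {s r : ℝ} {h : ℝ → V₀} {w w' : ℝ → V₂}
    (hw : E.IsSolution a s h w w') (hr : s ≤ r) : E.IsSolution a r h w w' where
  hasDeriv t ht := (hw.hasDeriv t (hr.trans ht)).mono (Ici_subset_Ici.2 hr)
  continuousOn := hw.continuousOn.mono (Ici_subset_Ici.2 hr)
  hasDeriv' t ht := (hw.hasDeriv' t (hr.trans ht)).mono (Ici_subset_Ici.2 hr)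

theorem prod_norm_le_of_sq {X Y : Type*} [NormedAddCommGroup X] [NormedAddCommGroup Y]
    {x : X × Y} {M : ℝ} (hM : 0 ≤ M)
    (h : ‖x.1‖ ^ 2 + ‖x.2‖ ^ 2 ≤ M ^ 2) : ‖x‖ ≤ M :=
  max_le (le_of_sq_le_sq (by nlinarith [sq_nonneg ‖x.2‖]) hM)
    (le_of_sq_le_sq (by nlinarith [sq_nonneg ‖x.1‖]) hM)

variable (E) in
/-- The energy-space state `(w, w')` of a pair in `V₂ × V₂`. -/
def stateEmb : V₂ × V₂ →L[ℝ] V₁ × V₀ := E.i₂.prodMap E.i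

@[simp] theorem stateEmb_apply (d : V₂ × V₂) : E.stateEmb d = (E.i₂ d.1, E.i d.2) := rfl

theorem denseRange_stateEmb : DenseRange E.stateEmb :=
  E.dense_i₂.prodMap E.dense_i

/-- The homogeneous case of the energy inequality. The factor `2` leaves room for comparing the sum
of squares with the maximum norm of the product, where `√2` would do. -/
theorem IsSolution.norm_state_le {a : ℝ → ℝ} (ha : ∀ t, 0 < a t) {s t : ℝ} {w w' : ℝ → V₂}
    (hw : E.IsSolution a s 0 w w') (ht : s ≤ t) :
    ‖E.stateEmb (w t, w' t)‖ ≤ 2 * Real.exp (t - s) * ‖E.stateEmb (w s, w' s)‖ := by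
  refine prod_norm_le_of_sq (by positivity) ?_
  have h1 := hw.energy_le ha (T := t) (H := 0) (fun _ _ => by simp) ⟨ht, le_rfl⟩
  refine h1.trans ?_
  have h2 := pow_le_pow_left₀ (norm_nonneg _) (norm_fst_le (E.stateEmb (w s, w' s))) 2
  have h3 := pow_le_pow_left₀ (norm_nonneg _) (norm_snd_le (E.stateEmb (w s, w' s))) 2
  rw [mul_pow, mul_pow, ← Real.exp_nat_mul]
  simp only [stateEmb_apply] at *
  push_cast
  have := Real.exp_pos (2 * (t - s))
  nlinarith

/-- The energy bound for the difference of the solutions. This uniqueness makes the solution map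
linear and independent of the chosen solutions. -/
theorem IsSolution.state_eq {a : ℝ → ℝ} (ha : ∀ t, 0 < a t) {s t : ℝ} {w w' z z' : ℝ → V₂}
    (hw : E.IsSolution a s 0 w w') (hz : E.IsSolution a s 0 z z')
    (h : E.stateEmb (w s, w' s) = E.stateEmb (z s, z' s)) (ht : s ≤ t) :
    E.stateEmb (w t, w' t) = E.stateEmb (z t, z' t) := by
  have hd := hw.add (hz.smul (-1))
  rw [smul_zero, add_zero] at hd
  have h1 := hd.norm_state_le ha ht
  have e : ∀ t, E.stateEmb ((w + (-1 : ℝ) • z) t, (w' + (-1 : ℝ) • z') t) =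
      E.stateEmb (w t, w' t) - E.stateEmb (z t, z' t) := fun t => by
    rw [← map_sub]
    simp [sub_eq_add_neg]
  rw [e, e, h, sub_self, norm_zero, mul_zero] at h1
  exact sub_eq_zero.1 (norm_le_zero_iff.1 h1)

section Propagator

variable [CompleteSpace V₀] [CompleteSpace V₁] [CompleteSpace V₂]

/-- A chosen solution of the linear problem with data `d` at time `s ≥ 0`. -/
def linSol (E : HeatTriple V₀ V₁ V₂) {a α' : ℝ → ℝ} (ha : IsDamping a α') {s : ℝ} (hs : 0 ≤ s)
    (d : V₂ × V₂) : ℝ → V₂ × V₂ := fun t =>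
  ((E.exists_isSolution ha hs d.1 d.2).choose t,
    (E.exists_isSolution ha hs d.1 d.2).choose_spec.choose t)

omit [CompleteSpace V₁] in
theorem linSol_isSolution {a α' : ℝ → ℝ} (ha : IsDamping a α') {s : ℝ} (hs : 0 ≤ s)
    (d : V₂ × V₂) :
    E.IsSolution a s 0 (fun t => (E.linSol ha hs d t).1) (fun t => (E.linSol ha hs d t).2) :=
  (E.exists_isSolution ha hs d.1 d.2).choose_spec.choose_spec.1

omit [CompleteSpace V₁] in
theorem linSol_init {a α' : ℝ → ℝ} (ha : IsDamping a α') {s : ℝ} (hs : 0 ≤ s)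
    (d : V₂ × V₂) : E.linSol ha hs d s = d :=
  Prod.ext (E.exists_isSolution ha hs d.1 d.2).choose_spec.choose_spec.2.1
    (E.exists_isSolution ha hs d.1 d.2).choose_spec.choose_spec.2.2

/-- The solution map on regular data. -/
def regularPropagator (E : HeatTriple V₀ V₁ V₂) {a α' : ℝ → ℝ} (ha : IsDamping a α') {s t : ℝ}
    (hs : 0 ≤ s) (ht : s ≤ t) : V₂ × V₂ →ₗ[ℝ] V₁ × V₀ where
  toFun d := E.stateEmb (E.linSol ha hs d t)
  map_add' d e := by
    rw [← map_add]
    have h := (linSol_isSolution (E := E) ha hs d).add (linSol_isSolution ha hs e)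
    rw [add_zero] at h
    refine (linSol_isSolution ha hs (d + e)).state_eq ha.pos h ?_ ht
    simp [linSol_init]
  map_smul' c d := by
    rw [RingHom.id_apply, ← map_smul]
    have h := (linSol_isSolution (E := E) ha hs d).smul c
    rw [smul_zero] at h
    refine (linSol_isSolution ha hs (c • d)).state_eq ha.pos h ?_ ht
    simp [linSol_init]

/-- The propagator of the linear equation on the energy space, extended to all times by
clamping them to `0 ≤ s ≤ t`. -/
def propagator (E : HeatTriple V₀ V₁ V₂) {a α' : ℝ → ℝ} (ha : IsDamping a α') (t s : ℝ) :
    V₁ × V₀ →L[ℝ] V₁ × V₀ :=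
  (E.regularPropagator ha (le_max_right s 0) (le_max_right t (max s 0))).extendOfNorm
    E.stateEmb.toLinearMap

variable {a α' : ℝ → ℝ} (ha : IsDamping a α')

omit [CompleteSpace V₁] in
theorem norm_regularPropagator_le {s t : ℝ} (hs : 0 ≤ s) (ht : s ≤ t) (d : V₂ × V₂) :
    ‖E.regularPropagator ha hs ht d‖ ≤ 2 * Real.exp (t - s) * ‖E.stateEmb d‖ := by
  have := (linSol_isSolution (E := E) ha hs d).norm_state_le ha.pos ht
  simp only [Prod.mk.eta, linSol_init] at this
  exact this

theorem propagator_clamp (t s : ℝ) :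
    E.propagator ha t s = E.propagator ha (max t (max s 0)) (max s 0) := by
  unfold propagator
  congr 2 <;> simp

/-- The characterization of the propagator through which all its properties are derived: they are
verified on regular solutions and extended by density. -/
theorem propagator_stateEmb {w w' : ℝ → V₂} {s t : ℝ} (hs : 0 ≤ s) (ht : s ≤ t)
    (hw : E.IsSolution a s 0 w w') :
    E.propagator ha t s (E.stateEmb (w s, w' s)) = E.stateEmb (w t, w' t) := by
  unfold propagator
  have h1 := LinearMap.extendOfNorm_eq
    (f := E.regularPropagator ha (le_max_right s 0) (le_max_right t (max s 0)))
    (e := E.stateEmb.toLinearMap) E.denseRange_stateEmb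
    ⟨_, norm_regularPropagator_le ha (le_max_right s 0) (le_max_right t (max s 0))⟩
    (w s, w' s)
  refine Eq.trans h1 ?_
  have es : max s 0 = s := max_eq_left hs
  have et : max t (max s 0) = t := by rw [es, max_eq_left ht]
  have key : ∀ s' t' (hs' : 0 ≤ s') (ht' : s' ≤ t'), s' = s → t' = t →
      E.regularPropagator ha hs' ht' (w s, w' s) = E.stateEmb (w t, w' t) := by
    rintro s' t' hs' ht' rfl rfl
    exact (linSol_isSolution ha hs' _).state_eq ha.pos hw (by simp [linSol_init]) ht'
  exact key _ _ _ _ es et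

theorem norm_propagator_clamp_le (t s : ℝ) (x : V₁ × V₀) :
    ‖E.propagator ha t s x‖ ≤ 2 * Real.exp (max t (max s 0) - max s 0) * ‖x‖ :=
  LinearMap.norm_extendOfNorm_apply_le E.denseRange_stateEmb _
    (norm_regularPropagator_le ha (le_max_right s 0) (le_max_right t (max s 0))) x

theorem norm_propagator_le {t s : ℝ} (hs : 0 ≤ s) (ht : s ≤ t) (x : V₁ × V₀) :
    ‖E.propagator ha t s x‖ ≤ 2 * Real.exp (t - s) * ‖x‖ := by
  have := norm_propagator_clamp_le (E := E) ha t s x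
  rwa [max_eq_left hs, max_eq_left ht] at this

theorem propagator_self {s : ℝ} (hs : 0 ≤ s) (x : V₁ × V₀) : E.propagator ha s s x = x := by
  refine E.denseRange_stateEmb.induction_on x
    (isClosed_eq (E.propagator ha s s).continuous continuous_id) fun d => ?_
  have := propagator_stateEmb ha hs le_rfl (linSol_isSolution (E := E) ha hs d)
  simpa only [Prod.mk.eta, linSol_init] using this

theorem propagator_comp {r s t : ℝ} (hr : 0 ≤ r) (hs : r ≤ s) (ht : s ≤ t) (x : V₁ × V₀) :
    E.propagator ha t s (E.propagator ha s r x) = E.propagator ha t r x := by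
  refine E.denseRange_stateEmb.induction_on x
    (isClosed_eq (by fun_prop) (by fun_prop)) fun d => ?_
  have hsol := linSol_isSolution (E := E) ha hr d
  have h1 := propagator_stateEmb ha hr hs hsol
  have h2 := propagator_stateEmb ha (hr.trans hs) ht (hsol.mono hs)
  have h3 := propagator_stateEmb ha hr (hs.trans ht) hsol
  simp only [Prod.mk.eta, linSol_init] at h1 h2 h3
  rw [h1, h2, h3]

/-- The solution with regular data is close to its data, uniformly in the initial time. -/
theorem exists_norm_propagator_sub_le (T : ℝ) (d : V₂ × V₂) : ∃ C, ∀ s t, 0 ≤ s → s ≤ t → t ≤ T →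
    ‖E.propagator ha t s (E.stateEmb d) - E.stateEmb d‖ ≤ C * (√(t - s) + (t - s)) := by
  obtain ⟨A, hA⟩ := (isCompact_Icc (a := (0 : ℝ)) (b := T)).exists_bound_of_continuousOn
    ha.continuous.continuousOn
  set H : ℝ := ‖E.lap d.1‖ + (T + A) * ‖E.lap d.2‖
  refine ⟨Real.exp T * |H| + ‖E.i₂ d.2‖, fun s t hs hst htT => ?_⟩
  -- The affine function `d.1 + (q - s) d.2` is subtracted below. The remainder has zero data and a
  -- source term bounded by `H` on `[0,T]`, so the energy inequality bounds its state by a multiple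
  -- of `√(t - s)`.
  set w := E.linSol ha hs d
  have hw := linSol_isSolution (E := E) ha hs d
  have hws : w s = d := linSol_init ha hs d
  set z : ℝ → V₂ := fun q => (w q).1 - (d.1 + (q - s) • d.2)
  set z' : ℝ → V₂ := fun q => (w q).2 - d.2
  have hz : E.IsSolution a s
      (fun q => E.lap d.1 + (q - s) • E.lap d.2 + a q • E.lap d.2) z z' := by
    refine ⟨fun q hq => ?_, hw.continuousOn.sub continuousOn_const, fun q hq => ?_⟩
    · have h1 : HasDerivAt (fun q : ℝ => d.1 + (q - s) • d.2) ((1 : ℝ) • d.2) q :=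
        (((hasDerivAt_id q).sub_const s).smul_const d.2).const_add d.1
      refine ((hw.hasDeriv q hq).sub h1.hasDerivWithinAt).congr_deriv ?_
      rw [one_smul]
    · have h1 := (hw.hasDeriv' q hq).sub_const (E.i d.2)
      simp only [z', map_sub]
      refine h1.congr_deriv ?_
      simp only [z, map_sub, map_add, map_smul, smul_sub, Pi.zero_apply]
      abel
  have hT : 0 ≤ T := hs.trans (hst.trans htT)
  have hA0 : 0 ≤ A := (norm_nonneg _).trans (hA 0 ⟨le_rfl, hT⟩)
  have hen := hz.energy_le ha.pos (T := t) (H := H) (fun q hq => by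
    refine (norm_add_le _ _).trans ((add_le_add_left (norm_add_le _ _) _).trans ?_)
    rw [norm_smul, norm_smul]
    have h1 : ‖q - s‖ ≤ T := by
      rw [Real.norm_of_nonneg (by linarith [hq.1])]
      linarith [hq.2]
    have h2 : ‖a q‖ ≤ A := hA q ⟨hs.trans hq.1, hq.2.trans htT⟩
    have h3 := norm_nonneg (E.lap d.2)
    simp only [H]
    nlinarith) (t := t) ⟨hst, le_rfl⟩
  have hz0 : z s = 0 := by simp [z, hws]
  have hz0' : z' s = 0 := by simp [z', hws]
  rw [hz0, hz0', map_zero, map_zero, norm_zero, norm_zero] at hen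
  have hzn : ‖E.stateEmb (z t, z' t)‖ ≤ Real.exp T * |H| * √(t - s) := by
    refine prod_norm_le_of_sq (by positivity) (hen.trans ?_)
    rw [mul_pow, mul_pow, sq_abs, Real.sq_sqrt (by linarith), ← Real.exp_nat_mul]
    have : Real.exp (2 * (t - s)) ≤ Real.exp ((2 : ℕ) * T) := by
      rw [Real.exp_le_exp]
      push_cast
      linarith
    have h0 : 0 ≤ H ^ 2 * (t - s) := mul_nonneg (sq_nonneg _) (by linarith)
    nlinarith
  have hP := propagator_stateEmb ha hs hst hw
  have e : E.propagator ha t s (E.stateEmb d) - E.stateEmb d =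
      E.stateEmb (z t, z' t) + (t - s) • (E.i₂ d.2, 0) := by
    have hP' : E.propagator ha t s (E.stateEmb d) = E.stateEmb (w t) := by
      simpa only [Prod.mk.eta, linSol_init] using hP
    rw [hP']
    ext
    · simp [z]
      abel
    · simp [z']
  rw [e]
  refine (norm_add_le _ _).trans ?_
  have h4 : ‖(t - s) • ((E.i₂ d.2, 0) : V₁ × V₀)‖ ≤ (t - s) * ‖E.i₂ d.2‖ := by
    rw [norm_smul, Real.norm_of_nonneg (by linarith), Prod.norm_mk, norm_zero,
      max_eq_left (norm_nonneg _)]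
  have h5 : 0 ≤ Real.exp T * |H| := by positivity
  nlinarith [Real.sqrt_nonneg (t - s), norm_nonneg (E.i₂ d.2)]

/-- On the diagonal of the clamped times, the uniform closeness of solutions to their data suffices.
Off the diagonal, continuity in `t` is that of one fixed solution, and a change of initial time is
controlled by `P(t,s) - P(t,r) = P(t,s)(1 - P(s,r))` for `r ≤ s`. -/
theorem continuous_propagator_stateEmb (d : V₂ × V₂) :
    Continuous fun q : ℝ × ℝ => E.propagator ha q.1 q.2 (E.stateEmb d) := by
  refine continuous_iff_continuousAt.2 fun ⟨t₀, s₀⟩ => ?_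
  set σ : ℝ × ℝ → ℝ := fun q => max q.2 0
  set τ : ℝ × ℝ → ℝ := fun q => max q.1 (σ q)
  have hσ : Continuous σ := by fun_prop
  have hτ : Continuous τ := by fun_prop
  have hσ0 : ∀ q, 0 ≤ σ q := fun q => le_max_right _ _
  have hστ : ∀ q, σ q ≤ τ q := fun q => le_max_right _ _
  have hP : (fun q : ℝ × ℝ => E.propagator ha q.1 q.2 (E.stateEmb d)) =
      fun q => E.propagator ha (τ q) (σ q) (E.stateEmb d) := by
    funext q
    rw [propagator_clamp]
  rw [hP]
  set q₀ : ℝ × ℝ := (t₀, s₀)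
  obtain ⟨C, hC⟩ := exists_norm_propagator_sub_le (E := E) ha (τ q₀ + 1) d
  have hτ1 : ∀ᶠ q in 𝓝 q₀, τ q ≤ τ q₀ + 1 :=
    (hτ.tendsto q₀).eventually (Iic_mem_nhds (by linarith))
  rcases (hστ q₀).eq_or_lt with heq | hlt
  · have h0 : E.propagator ha (τ q₀) (σ q₀) (E.stateEmb d) = E.stateEmb d := by
      rw [← heq]
      exact propagator_self ha (hσ0 _) _
    rw [ContinuousAt, h0, tendsto_iff_norm_sub_tendsto_zero]
    have h1 : Tendsto (fun q => C * (√(τ q - σ q) + (τ q - σ q))) (𝓝 q₀)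
        (𝓝 (C * (√(τ q₀ - σ q₀) + (τ q₀ - σ q₀)))) :=
      Continuous.tendsto (by fun_prop) q₀
    rw [heq, sub_self, Real.sqrt_zero, add_zero, mul_zero] at h1
    refine squeeze_zero' (Eventually.of_forall fun _ => norm_nonneg _) ?_ h1
    filter_upwards [hτ1] with q hq
    exact hC _ _ (hσ0 q) (hστ q) hq
  · have hev1 : ∀ᶠ q in 𝓝 q₀, σ q₀ ≤ τ q :=
      (hτ.tendsto q₀).eventually (Ici_mem_nhds hlt)
    have hw := linSol_isSolution (E := E) ha (hσ0 q₀) d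
    set w := E.linSol ha (hσ0 q₀) d
    have hPw : ∀ t, σ q₀ ≤ t → E.propagator ha t (σ q₀) (E.stateEmb d) = E.stateEmb (w t) :=
      fun t ht => by
      have := propagator_stateEmb ha (hσ0 q₀) ht hw
      simpa only [Prod.mk.eta, w, linSol_init] using this
    have hwc : ContinuousAt (fun t => E.stateEmb (w t)) (τ q₀) := by
      have h1 : ContinuousOn (fun t => E.stateEmb ((w t).1, (w t).2)) (Ici (σ q₀)) :=
        E.stateEmb.continuous.comp_continuousOn
          (ContinuousOn.prodMk (fun t ht => (hw.hasDeriv t ht).continuousWithinAt)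
            hw.continuousOn)
      exact h1.continuousAt (Ici_mem_nhds hlt)
    have ht1 : Tendsto (fun q => E.propagator ha (τ q) (σ q₀) (E.stateEmb d)) (𝓝 q₀)
        (𝓝 (E.propagator ha (τ q₀) (σ q₀) (E.stateEmb d))) := by
      rw [hPw _ (hστ q₀)]
      refine (hwc.tendsto.comp (hτ.tendsto q₀)).congr' ?_
      filter_upwards [hev1] with q hq
      exact (hPw _ hq).symm
    have ht2 : Tendsto (fun q => E.propagator ha (τ q) (σ q) (E.stateEmb d) -
        E.propagator ha (τ q) (σ q₀) (E.stateEmb d)) (𝓝 q₀) (𝓝 0) := by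
      rw [tendsto_zero_iff_norm_tendsto_zero]
      have h1 : Tendsto (fun q => 2 * Real.exp (τ q₀ + 1) *
          (C * (√|σ q - σ q₀| + |σ q - σ q₀|))) (𝓝 q₀)
          (𝓝 (2 * Real.exp (τ q₀ + 1) * (C * (√|σ q₀ - σ q₀| + |σ q₀ - σ q₀|)))) :=
        Continuous.tendsto (by fun_prop) q₀
      rw [sub_self, abs_zero, Real.sqrt_zero, add_zero, mul_zero, mul_zero] at h1
      refine squeeze_zero' (Eventually.of_forall fun _ => norm_nonneg _) ?_ h1
      have key : ∀ r s t, 0 ≤ r → r ≤ s → s ≤ t → t ≤ τ q₀ + 1 →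
          ‖E.propagator ha t s (E.stateEmb d) - E.propagator ha t r (E.stateEmb d)‖ ≤
            2 * Real.exp (τ q₀ + 1) * (C * (√|s - r| + |s - r|)) := by
        intro r s t hr hrs hst ht
        rw [← propagator_comp ha hr hrs hst, ← map_sub, abs_of_nonneg (sub_nonneg.2 hrs)]
        refine (norm_propagator_le ha (hr.trans hrs) hst _).trans ?_
        rw [norm_sub_rev]
        have h2 := hC r s hr hrs (hst.trans ht)
        gcongr
        linarith
      filter_upwards [hτ1, hev1] with q hq1 hq2
      rcases le_total (σ q) (σ q₀) with h | h
      · rw [norm_sub_rev, abs_sub_comm]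
        exact key _ _ _ (hσ0 _) h hq2 hq1
      · exact key _ _ _ (hσ0 _) h (hστ q) hq1
    have := ht2.add ht1
    simpa [ContinuousAt] using this

theorem continuous_propagator :
    Continuous fun q : ℝ × ℝ × (V₁ × V₀) => E.propagator ha q.1 q.2.1 q.2.2 := by
  set b : ℝ × ℝ → ℝ := fun q => 2 * Real.exp (max q.1 (max q.2 0) - max q.2 0)
  have hb : Continuous b := by fun_prop
  have hb0 : ∀ q, 0 < b q := fun q => by positivity
  -- Dividing by the norm bound `b` makes the family 1-Lipschitz in the data uniformly in the times,
  -- so joint continuity passes from the dense set of regular data to all data.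
  have h1 : Continuous fun q : (V₁ × V₀) × (ℝ × ℝ) =>
      (b q.2)⁻¹ • E.propagator ha q.2.1 q.2.2 q.1 := by
    refine continuous_prod_of_dense_continuous_lipschitzWith
      (f := fun q : (V₁ × V₀) × (ℝ × ℝ) => (b q.2)⁻¹ • E.propagator ha q.2.1 q.2.2 q.1)
      1 E.denseRange_stateEmb ?_ ?_
    · rintro _ ⟨d, rfl⟩
      exact (hb.inv₀ fun q => (hb0 q).ne').smul (continuous_propagator_stateEmb ha d)
    · intro q
      refine LipschitzWith.of_dist_le_mul fun x y => ?_
      rw [dist_eq_norm, dist_eq_norm, ← smul_sub, ← map_sub, norm_smul, norm_inv,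
        Real.norm_of_nonneg (hb0 q).le, NNReal.coe_one, one_mul]
      rw [inv_mul_le_iff₀ (hb0 q)]
      exact norm_propagator_clamp_le ha q.1 q.2 _
  have h2 : (fun q : ℝ × ℝ × (V₁ × V₀) => E.propagator ha q.1 q.2.1 q.2.2) = fun q =>
      b (q.1, q.2.1) • ((b (q.1, q.2.1))⁻¹ • E.propagator ha q.1 q.2.1 q.2.2) := by
    funext q
    rw [smul_smul, mul_inv_cancel₀ (hb0 _).ne', one_smul]
  rw [h2]
  have h3 := h1.comp (by fun_prop : Continuous fun q : ℝ × ℝ × (V₁ × V₀) =>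
    (q.2.2, (q.1, q.2.1)))
  exact (hb.comp (by fun_prop : Continuous fun q : ℝ × ℝ × (V₁ × V₀) => (q.1, q.2.1))).smul h3

/-- The second component of the propagator is the time derivative of the first one. -/
theorem propagator_fst_eq {s t : ℝ} (hs : 0 ≤ s) (ht : s ≤ t) (x : V₁ × V₀) :
    E.i₁ (E.propagator ha t s x).1 = E.i₁ x.1 + ∫ q in s..t, (E.propagator ha q s x).2 := by
  have hP := continuous_propagator (E := E) ha
  refine E.denseRange_stateEmb.induction_on x (isClosed_eq
    (E.i₁.continuous.comp (continuous_fst.comp (E.propagator ha t s).continuous)) ?_) fun d => ?_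
  · refine (E.i₁.continuous.comp continuous_fst).add ?_
    have h1 : Continuous fun q : (V₁ × V₀) × ℝ => ((q.2, s, q.1) : ℝ × ℝ × (V₁ × V₀)) :=
      continuous_snd.prodMk (continuous_const.prodMk continuous_fst)
    have h2 := hP.comp h1
    simp only [Function.comp_def] at h2
    have h3 : Continuous (Function.uncurry fun (x : V₁ × V₀) q =>
        (E.propagator ha q s x).2) := continuous_snd.comp h2
    exact intervalIntegral.continuous_parametric_intervalIntegral_of_continuous h3
      continuous_const
  · have hw := linSol_isSolution (E := E) ha hs d
    set w := E.linSol ha hs d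
    have hPw : ∀ t, s ≤ t → E.propagator ha t s (E.stateEmb d) = E.stateEmb (w t) :=
      fun t ht => by
      have := propagator_stateEmb ha hs ht hw
      simpa only [Prod.mk.eta, w, linSol_init] using this
    have hwd : ∀ t ∈ Ici s, HasDerivWithinAt (fun t => E.i (w t).1) (E.i (w t).2) (Ici s) t :=
      fun t ht => E.i.hasFDerivAt.comp_hasDerivWithinAt t (hw.hasDeriv t ht)
    have h1 := intervalIntegral.integral_eq_sub_of_hasDerivAt_of_le ht
      (f := fun t => E.i (w t).1) (f' := fun t => E.i (w t).2)
      (fun q hq => (hwd q hq.1).continuousWithinAt.mono Icc_subset_Ici_self)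
      (fun q hq => (hwd q hq.1.le).hasDerivAt (Ici_mem_nhds hq.1))
      (ContinuousOn.intervalIntegrable (by
        rw [uIcc_of_le ht]
        exact (E.i.continuous.comp_continuousOn hw.continuousOn).mono Icc_subset_Ici_self))
    have h2 : ∫ q in s..t, (E.propagator ha q s (E.stateEmb d)).2 = ∫ q in s..t, E.i (w q).2 := by
      refine intervalIntegral.integral_congr fun q hq => ?_
      rw [uIcc_of_le ht] at hq
      rw [hPw q hq.1, stateEmb_apply]
    have hws : w s = d := linSol_init ha hs d
    rw [h2, h1, hPw t ht, hws]
    simp only [stateEmb_apply, i_apply]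
    abel

end Propagator

end HeatTriple

end DampedWave

end

/-! ### Regularity of abstract solutions and identification of `R`. -/

noncomputable section

namespace DampedWave

section Regularity

variable {V₀ V₁ V₂ : Type*} [NormedAddCommGroup V₀] [InnerProductSpace ℝ V₀]
    [NormedAddCommGroup V₁] [InnerProductSpace ℝ V₁] [NormedAddCommGroup V₂] [NormedSpace ℝ V₂]

namespace HeatTriple

variable {E : HeatTriple V₀ V₁ V₂}

theorem IsSolution.derivWithin_eq {a : ℝ → ℝ} {s : ℝ} {h : ℝ → V₀} {w w' : ℝ → V₂}
    (hw : E.IsSolution a s h w w') : EqOn (derivWithin w (Ici s)) w' (Ici s) := fun t ht =>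
  (hw.hasDeriv t ht).derivWithin (uniqueDiffOn_Ici s t ht)

theorem IsSolution.derivWithin_i_eq {a : ℝ → ℝ} {s : ℝ} {h : ℝ → V₀} {w w' : ℝ → V₂}
    (hw : E.IsSolution a s h w w') :
    EqOn (derivWithin (fun t => E.i (w t)) (Ici s)) (fun t => E.i (w' t)) (Ici s) := fun t ht =>
  (E.i.hasFDerivAt.comp_hasDerivWithinAt t (hw.hasDeriv t ht)).derivWithin (uniqueDiffOn_Ici s t ht)

theorem IsSolution.iteratedDerivWithin_eq {a : ℝ → ℝ} {s : ℝ} {h : ℝ → V₀} {w w' : ℝ → V₂}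
    (hw : E.IsSolution a s h w w') {t : ℝ} (ht : t ∈ Ici s) :
    iteratedDerivWithin 2 (fun t => E.i (w t)) (Ici s) t =
      E.lap (w t) + a t • E.lap (w' t) + h t := by
  rw [show 2 = 1 + 1 from rfl, iteratedDerivWithin_succ, iteratedDerivWithin_one,
    derivWithin_congr hw.derivWithin_i_eq (hw.derivWithin_i_eq ht)]
  exact (hw.hasDeriv' t ht).derivWithin (uniqueDiffOn_Ici s t ht)

theorem IsSolution.contDiffOn {a : ℝ → ℝ} {s : ℝ} {h : ℝ → V₀} {w w' : ℝ → V₂}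
    (hw : E.IsSolution a s h w w') : ContDiffOn ℝ 1 w (Ici s) :=
  (contDiffOn_one_iff_derivWithin (uniqueDiffOn_Ici s)).2
    ⟨fun t ht => (hw.hasDeriv t ht).differentiableWithinAt,
      hw.continuousOn.congr hw.derivWithin_eq⟩

theorem IsSolution.contDiffOn_i {a : ℝ → ℝ} (ha : Continuous a) {s : ℝ} {h : ℝ → V₀}
    (hh : Continuous h) {w w' : ℝ → V₂} (hw : E.IsSolution a s h w w') :
    ContDiffOn ℝ 2 (fun t => E.i (w t)) (Ici s) := by
  rw [show (2 : ℕ∞ω) = 1 + 1 from rfl, contDiffOn_succ_iff_derivWithin (uniqueDiffOn_Ici s)]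
  refine ⟨fun t ht => (E.i.hasFDerivAt.comp_hasDerivWithinAt t
    (hw.hasDeriv t ht)).differentiableWithinAt, by simp, ?_⟩
  refine ContDiffOn.congr ?_ hw.derivWithin_i_eq
  refine (contDiffOn_one_iff_derivWithin (uniqueDiffOn_Ici s)).2
    ⟨fun t ht => (hw.hasDeriv' t ht).differentiableWithinAt, ?_⟩
  refine ContinuousOn.congr (f := fun t => E.lap (w t) + a t • E.lap (w' t) + h t) ?_
    fun t ht => (hw.hasDeriv' t ht).derivWithin (uniqueDiffOn_Ici s t ht)
  have hwc : ContinuousOn w (Ici s) := fun t ht => (hw.hasDeriv t ht).continuousWithinAt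
  exact ((E.lap.continuous.comp_continuousOn hwc).add
    (ha.continuousOn.smul (E.lap.continuous.comp_continuousOn hw.continuousOn))).add
    hh.continuousOn

/-- The two notions of first derivative, in `V₂` and in `V₀`, correspond under the continuous
embedding `E.i`. Hence the second derivative in `V₀` is the derivative of the embedded
`V₂`-derivative. -/
theorem isSolution_of_contDiffOn {a : ℝ → ℝ} {s : ℝ} {h : ℝ → V₀} {w : ℝ → V₂}
    (h1 : ContDiffOn ℝ 1 w (Ici s)) (h2 : ContDiffOn ℝ 2 (fun t => E.i (w t)) (Ici s))
    (he : ∀ t ∈ Ici s, iteratedDerivWithin 2 (fun t => E.i (w t)) (Ici s) t =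
      E.lap (w t) + a t • E.lap (derivWithin w (Ici s) t) + h t) :
    E.IsSolution a s h w (derivWithin w (Ici s)) := by
  obtain ⟨hd, hc⟩ := (contDiffOn_one_iff_derivWithin (uniqueDiffOn_Ici s)).1 h1
  rw [show (2 : ℕ∞ω) = 1 + 1 from rfl, contDiffOn_succ_iff_derivWithin (uniqueDiffOn_Ici s)] at h2
  have hd2 := ((contDiffOn_one_iff_derivWithin (uniqueDiffOn_Ici s)).1 h2.2.2).1
  have hi : EqOn (derivWithin (fun t => E.i (w t)) (Ici s))
      (fun t => E.i (derivWithin w (Ici s) t)) (Ici s) := fun t ht =>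
    (E.i.hasFDerivAt.comp_hasDerivWithinAt t (hd t ht).hasDerivWithinAt).derivWithin
      (uniqueDiffOn_Ici s t ht)
  refine ⟨fun t ht => (hd t ht).hasDerivWithinAt, hc, fun t ht => ?_⟩
  have h3 := (hd2 t ht).hasDerivWithinAt
  rw [← iteratedDerivWithin_one, ← iteratedDerivWithin_succ] at h3
  rw [← he t ht]
  rw [iteratedDerivWithin_one] at h3
  exact h3.congr (fun q hq => (hi hq).symm) (hi ht).symm

end HeatTriple

end Regularity

/-! ### The concrete damping coefficient -/

/-- The coefficient `b₀ (1+t)^(-β)`, extended to be constant on the negative axis. -/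
def dampingCoeff (b₀ β t : ℝ) : ℝ := b₀ / (1 + max t 0) ^ β

/-- Clamping the time keeps the base of the power positive on all of `ℝ`. The reciprocal may then
have a corner at `0`, which is why `IsDamping` asks for its derivative within `[0,∞)` only. -/
theorem isDamping_dampingCoeff {b₀ : ℝ} (hb₀ : 0 < b₀) (β : ℝ) :
    IsDamping (dampingCoeff b₀ β) fun t => β * (1 + max t 0) ^ (β - 1) / b₀ := by
  have h1 : ∀ t : ℝ, 0 < 1 + max t 0 := fun t => by positivity
  have hc : Continuous fun t : ℝ => 1 + max t 0 := by fun_prop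
  refine ⟨?_, ?_, fun t => div_pos hb₀ (Real.rpow_pos_of_pos (h1 t) β), fun t ht => ?_⟩
  · exact continuous_const.div (hc.rpow_const fun t => Or.inl (h1 t).ne')
      fun t => (Real.rpow_pos_of_pos (h1 t) β).ne'
  · exact (continuous_const.mul (hc.rpow_const fun t => Or.inl (h1 t).ne')).div_const _
  · have h2 : HasDerivAt (fun t : ℝ => (1 + t) ^ β / b₀)
        (β * (1 + max t 0) ^ (β - 1) / b₀) t := by
      have := (((hasDerivAt_id t).const_add 1).rpow_const (p := β)
        (Or.inl (by simp only [id]; linarith))).div_const b₀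
      simpa [max_eq_left ht] using this
    refine h2.hasDerivWithinAt.congr (fun q hq => ?_) ?_
    · simp only [dampingCoeff, max_eq_left (mem_Ici.1 hq), inv_div]
    · simp only [dampingCoeff, max_eq_left ht, inv_div]

theorem dampingCoeff_of_nonneg (b₀ β : ℝ) {t : ℝ} (ht : 0 ≤ t) :
    dampingCoeff b₀ β t = b₀ / (1 + t) ^ β := by
  rw [dampingCoeff, max_eq_left ht]

/-! ### The propagator of the damped wave equation -/

section Concrete

attribute [local instance] H1.normedAddCommGroup H1.normedSpace H1.module H2.normedAddCommGroup
  H2.normedSpace H2.module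

variable {n : ℕ}

/-- The heat semigroup on `L²(ℝⁿ)`, `H¹(ℝⁿ)` and `H²(ℝⁿ)`. -/
def heatTriple (n : ℕ) : HeatTriple (L2 n) (H1 n) (H2 n) where
  i₁ := H1.toL2L n
  i₂ := H2.toH1L n
  lap := H2.laplacianL n
  heat₀ := heat
  heat₂ τ := H2.lift (heat τ) (commutesWithPartials_heat τ)
  norm_i₁_le := H1.norm_toL2_le
  green w v := by
    rw [H2.laplacianL_apply, H1.toL2L_apply, H2.toH1L_apply, H1.toL2L_apply, H2.inner_laplacian,
      H1.inner_eq]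
    abel
  norm_heat₀_le τ f := ((heat τ).le_opNorm f).trans
    (mul_le_of_le_one_left (norm_nonneg _) (norm_heat_le τ))
  norm_heat₂_le τ u := (H2.norm_lift_le _ _ u).trans
    (mul_le_of_le_one_left (norm_nonneg _) (norm_heat_le τ))
  continuous_heat₀ := continuous_heat
  continuous_heat₂ u := by
    rw [continuous_H2_iff]
    refine ⟨?_, fun q => ?_⟩
    · rw [continuous_H1_iff]
      exact ⟨continuous_heat _, fun i => continuous_heat _⟩
    · exact continuous_heat _
  heat₂_zero u := by
    refine H2.ext' (H1.ext' ?_ fun i => ?_) fun q => ?_ <;> exact heat_of_nonpos le_rfl _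
  i_heat₂ τ u := rfl
  lap_heat₂ τ u := by
    rw [H2.laplacianL_apply, H2.laplacianL_apply, H2.laplacian_lift]
  heat_eq τ u hτ := by
    simp only [H2.laplacianL_apply]
    exact H2.heat_eq_add_integral u hτ
  dense_i₂ := denseRange_H2_toH1
  dense_i := denseRange_H2_toL2

theorem heatTriple_i_apply (u : H2 n) : (heatTriple n).i u = u.toH1.toL2 := rfl

theorem heatTriple_lap_apply (u : H2 n) : (heatTriple n).lap u = u.laplacian :=
  H2.laplacianL_apply u

theorem exists_isStrongSolution {b₀ : ℝ} (hb₀ : 0 < b₀) (β : ℝ) {s : ℝ} (hs : 0 ≤ s)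
    (d : H2 n × H2 n) : ∃ w, IsStrongSolution b₀ β s d.1 d.2 w := by
  have ha := isDamping_dampingCoeff hb₀ β
  obtain ⟨w, w', hw, h0, h1⟩ := (heatTriple n).exists_isSolution ha hs d.1 d.2
  refine ⟨w, hw.contDiffOn, hw.contDiffOn_i ha.continuous continuous_zero, h0,
    (hw.derivWithin_eq self_mem_Ici).trans h1, fun t ht => ?_⟩
  have := hw.iteratedDerivWithin_eq ht
  simp only [heatTriple_i_apply, heatTriple_lap_apply] at this
  rw [this, hw.derivWithin_eq ht, dampingCoeff_of_nonneg b₀ β (hs.trans ht)]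
  simp

theorem IsStrongSolution.isSolution {b₀ β s : ℝ} (hs : 0 ≤ s) {u₀ u₁ : H2 n} {w : ℝ → H2 n}
    (hw : IsStrongSolution b₀ β s u₀ u₁ w) :
    (heatTriple n).IsSolution (dampingCoeff b₀ β) s 0 w (derivWithin w (Ici s)) := by
  refine HeatTriple.isSolution_of_contDiffOn hw.contDiffOn_H2 hw.contDiffOn_L2 fun t ht => ?_
  have := hw.equation t ht
  rw [sub_sub, sub_eq_zero] at this
  simp only [heatTriple_i_apply, heatTriple_lap_apply]
  rw [this, dampingCoeff_of_nonneg b₀ β (hs.trans ht)]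
  simp

/-- The propagator of the damped wave equation on `H¹ × L²`. -/
def waveProp (n : ℕ) {b₀ : ℝ} (hb₀ : 0 < b₀) (β t s : ℝ) : H1 n × L2 n →L[ℝ] H1 n × L2 n :=
  (heatTriple n).propagator (isDamping_dampingCoeff hb₀ β) t s

/-- Existence makes the choice behind `strongSolution` meaningful, and `propagator_stateEmb` applies
to every strong solution, so it does not matter which one is chosen. -/
theorem strongSolution_toH1 {b₀ : ℝ} (hb₀ : 0 < b₀) (β : ℝ) {s t : ℝ} (hs : 0 ≤ s) (ht : s ≤ t)
    (d : H2 n × H2 n) :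
    (strongSolution b₀ β s d t).toH1 = (waveProp n hb₀ β t s (d.1.toH1, d.2.toH1.toL2)).1 := by
  have hw : IsStrongSolution b₀ β s d.1 d.2 (strongSolution b₀ β s d) :=
    Classical.epsilon_spec (exists_isStrongSolution hb₀ β hs d)
  have h1 := HeatTriple.propagator_stateEmb (isDamping_dampingCoeff hb₀ β) hs ht (hw.isSolution hs)
  rw [hw.init, hw.init_deriv] at h1
  exact (congrArg Prod.fst h1).symm

/-- Density of `H² × H²` makes the filter defining `R` nontrivial, so its limit is unique;
continuity of the propagator identifies that limit. -/
theorem R_eq_waveProp {b₀ : ℝ} (hb₀ : 0 < b₀) (β : ℝ) {s t : ℝ} (hs : 0 ≤ s) (ht : s ≤ t)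
    (d : H1 n × L2 n) : R b₀ β t s d = (waveProp n hb₀ β t s d).1 := by
  have hd : DenseRange fun e : H2 n × H2 n => (e.1.toH1, e.2.toH1.toL2) :=
    (heatTriple n).denseRange_stateEmb
  have hne : (comap (fun e : H2 n × H2 n => (e.1.toH1, e.2.toH1.toL2)) (𝓝 d)).NeBot :=
    comap_neBot fun t ht => by
      obtain ⟨_, h, e, rfl⟩ := mem_closure_iff_nhds.1 (hd d) t ht
      exact ⟨e, h⟩
  refine Tendsto.limUnder_eq ?_
  simp only [strongSolution_toH1 hb₀ β hs ht]
  exact ((continuous_fst.comp (waveProp n hb₀ β t s).continuous).tendsto d).comp tendsto_comap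

end Concrete

end DampedWave

end

/-! ### Sobolev inequalities for compactly supported `C¹` functions. -/

noncomputable section

namespace DampedWave

open scoped ENNReal NNReal

/-- The Sobolev bound for the exponent `q` on the unit ball of `H¹`, for `C¹` functions with
compact support. -/
def SobolevBound (n : ℕ) (q : ℝ) : Prop :=
  ∃ C : ℝ≥0∞, C ≠ ⊤ ∧ ∀ u : Space n → ℝ, ContDiff ℝ 1 u → HasCompactSupport u →
    eLpNorm u 2 volume ≤ 1 → eLpNorm (fderiv ℝ u) 2 volume ≤ 1 → ∫⁻ x, ‖u x‖ₑ ^ q ≤ C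

theorem lintegral_enorm_rpow_two_le {α E : Type*} [MeasurableSpace α] {μ : Measure α}
    [NormedAddCommGroup E] {u : α → E} (h : eLpNorm u 2 μ ≤ 1) :
    ∫⁻ x, ‖u x‖ₑ ^ (2 : ℝ) ∂μ ≤ 1 := by
  have := eLpNorm_nnreal_pow_eq_lintegral (f := u) (μ := μ) (p := 2) two_ne_zero
  simp only [NNReal.coe_ofNat, ENNReal.coe_ofNat] at this
  rw [← this]
  exact ENNReal.rpow_le_one h zero_le_two

/-- Interpolation in its simplest form: `y^q ≤ y² + y^r` for `2 ≤ q ≤ r`. -/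
theorem SobolevBound.of_le {n : ℕ} {q r : ℝ} (hq : 2 ≤ q) (hqr : q ≤ r) (h : SobolevBound n r) :
    SobolevBound n q := by
  obtain ⟨C, hC, h⟩ := h
  refine ⟨1 + C, by simp [hC], fun u hu hc h0 h1 => ?_⟩
  calc ∫⁻ x, ‖u x‖ₑ ^ q ≤ ∫⁻ x, (‖u x‖ₑ ^ (2 : ℝ) + ‖u x‖ₑ ^ r) := by
        refine lintegral_mono fun x => ?_
        rcases le_total ‖u x‖ₑ 1 with hx | hx
        · exact (ENNReal.rpow_le_rpow_of_exponent_ge hx hq).trans le_self_add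
        · exact (ENNReal.rpow_le_rpow_of_exponent_le hx hqr).trans le_add_self
    _ = (∫⁻ x, ‖u x‖ₑ ^ (2 : ℝ)) + ∫⁻ x, ‖u x‖ₑ ^ r := by
        refine lintegral_add_left' ?_ _
        exact (hu.continuous.enorm.measurable.pow_const _).aemeasurable
    _ ≤ 1 + C := add_le_add (lintegral_enorm_rpow_two_le h0) (h u hu hc h0 h1)

/-- The Gagliardo–Nirenberg–Sobolev inequality at the critical exponent of `W^{1,2}`. -/
theorem sobolevBound_of_three_le {n : ℕ} (hn : 3 ≤ n) :
    SobolevBound n (2 * (n : ℝ) / ((n : ℝ) - 2)) := by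
  have hn' : (3 : ℝ) ≤ n := by exact_mod_cast hn
  have hr : 0 < 2 * (n : ℝ) / ((n : ℝ) - 2) := by
    apply div_pos <;> linarith
  set r : ℝ≥0 := ⟨2 * (n : ℝ) / ((n : ℝ) - 2), hr.le⟩ with hrdef
  have hrr : (r : ℝ) = 2 * (n : ℝ) / ((n : ℝ) - 2) := rfl
  refine ⟨(SNormLESNormFDerivOfEqConst ℝ (volume : Measure (Space n)) (2 : ℝ≥0) : ℝ≥0∞) ^ (r : ℝ),
    ENNReal.rpow_ne_top_of_nonneg r.2 ENNReal.coe_ne_top, fun u hu hc _ h1 => ?_⟩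
  have h2 := eLpNorm_le_eLpNorm_fderiv_of_eq (volume : Measure (Space n)) hu hc (p := 2) (p' := r)
    one_le_two (by rw [finrank_euclideanSpace_fin]; omega) (by
      rw [finrank_euclideanSpace_fin, hrr]
      push_cast
      field_simp)
  have h3 := eLpNorm_nnreal_pow_eq_lintegral (f := u) (μ := (volume : Measure (Space n))) (p := r)
    (by rw [← NNReal.coe_ne_zero, hrr]; exact hr.ne')
  rw [← hrr, ← h3]
  refine ENNReal.rpow_le_rpow (h2.trans ?_) r.2
  exact mul_le_of_le_one_right' h1

/-- In the plane `W^{1,1}` embeds in `L²`. Applied to `u^{k+2}`, with Cauchy–Schwarz on `u^{k+1}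
∇u`, this gives `‖u^{k+2}‖₂ ≤ A (k+2) ‖u^{k+1}‖₂ ‖∇u‖₂`, and induction reaches arbitrarily large
exponents. -/
theorem sobolevBound_two (k : ℕ) : SobolevBound 2 (2 * ((k : ℝ) + 1)) := by
  set A : ℝ≥0∞ := (eLpNormLESNormFDerivOneConst (volume : Measure (Space 2)) ((2 : ℝ≥0) : ℝ) : ℝ≥0∞)
  have key : ∀ k : ℕ, ∃ C : ℝ≥0∞, C ≠ ⊤ ∧ ∀ u : Space 2 → ℝ, ContDiff ℝ 1 u →
      HasCompactSupport u → eLpNorm u 2 volume ≤ 1 → eLpNorm (fderiv ℝ u) 2 volume ≤ 1 →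
      eLpNorm (fun x => u x ^ (k + 1)) 2 volume ≤ C := by
    intro k
    induction k with
    | zero => exact ⟨1, by simp, fun u _ _ h0 _ => by simpa using h0⟩
    | succ k ih =>
      obtain ⟨C, hC, ih⟩ := ih
      refine ⟨A * (((k + 1 + 1 : ℕ) : ℝ≥0∞) * C), ?_, fun u hu hc h0 h1 => ?_⟩
      · exact ENNReal.mul_ne_top ENNReal.coe_ne_top (ENNReal.mul_ne_top (by simp) hC)
      have hpc : HasCompactSupport fun x => u x ^ (k + 1 + 1) :=
        hc.comp_left (g := fun y : ℝ => y ^ (k + 1 + 1)) (by simp)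
      have h2 := eLpNorm_le_eLpNorm_fderiv_one (volume : Measure (Space 2)) (p := 2)
        (hu.pow (k + 1 + 1)) hpc (by
          rw [finrank_euclideanSpace_fin]
          exact_mod_cast (NNReal.HolderConjugate.two_two))
      refine h2.trans (mul_le_mul_right ?_ A)
      have hf : fderiv ℝ (fun x => u x ^ (k + 1 + 1)) =
          ((k + 1 + 1 : ℕ) : ℝ) • ((fun x => u x ^ (k + 1)) • fderiv ℝ u) := by
        funext x
        rw [fderiv_fun_pow _ (hu.differentiable (by simp) x)]
        simp [smul_smul]
      rw [hf]
      have h3 := eLpNorm_const_smul_le (c := ((k + 1 + 1 : ℕ) : ℝ)) (p := 1)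
        (f := (fun x => u x ^ (k + 1)) • fderiv ℝ u) (μ := (volume : Measure (Space 2)))
      rw [show ‖((k + 1 + 1 : ℕ) : ℝ)‖ₑ = ((k + 1 + 1 : ℕ) : ℝ≥0∞) by
        rw [Real.enorm_eq_ofReal (Nat.cast_nonneg _), ENNReal.ofReal_natCast]] at h3
      refine h3.trans (mul_le_mul_right ?_ _)
      refine (eLpNorm_smul_le_mul_eLpNorm (p := 2) (q := 2)
        (hu.continuous_fderiv (by simp)).aestronglyMeasurable
        (hu.continuous.pow _).aestronglyMeasurable).trans ?_
      exact (mul_le_of_le_one_right' h1).trans (ih u hu hc h0 h1)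
  obtain ⟨C, hC, h⟩ := key k
  refine ⟨C ^ (2 : ℝ), ENNReal.rpow_ne_top_of_nonneg zero_le_two hC, fun u hu hc h0 h1 => ?_⟩
  have h3 := eLpNorm_nnreal_pow_eq_lintegral (f := fun x => u x ^ (k + 1))
    (μ := (volume : Measure (Space 2))) (p := 2) two_ne_zero
  simp only [NNReal.coe_ofNat, ENNReal.coe_ofNat] at h3
  have h4 : ∀ x, ‖u x‖ₑ ^ (2 * ((k : ℝ) + 1)) = ‖u x ^ (k + 1)‖ₑ ^ (2 : ℝ) := fun x => by
    rw [enorm_pow, mul_comm, ENNReal.rpow_mul]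
    congr 1
    exact_mod_cast ENNReal.rpow_natCast ‖u x‖ₑ (k + 1)
  simp only [h4]
  rw [← h3]
  exact ENNReal.rpow_le_rpow (h u hu hc h0 h1) zero_le_two

/-- On the line `u² ≤ ∫ |(u²)'| ≤ 2 ‖u‖₂ ‖u'‖₂ ≤ 2`, so `|u| ≤ 2` and `|u|^q ≤ 2^{q-2} u²`. The
isometry `e` identifies `ℝ` with the one-dimensional Euclidean space. -/
theorem sobolevBound_one {q : ℝ} (hq : 2 ≤ q) : SobolevBound 1 q := by
  refine ⟨2 ^ (q - 2), ENNReal.rpow_ne_top_of_nonneg (by linarith) (by simp),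
    fun u hu hc h0 h1 => ?_⟩
  set e := (OrthonormalBasis.singleton (Fin 1) ℝ).repr
  have hsup : ∀ x, ‖u x‖ₑ ≤ 2 := by
    intro x
    set f : ℝ → ℝ := fun t => u (e t) ^ 2 with hf
    have hud : Differentiable ℝ u := hu.differentiable (by simp)
    have hfd : ContDiff ℝ 1 f := (hu.comp e.toContinuousLinearEquiv.contDiff).pow 2
    have hfc : HasCompactSupport f :=
      (hc.comp_homeomorph e.toHomeomorph).comp_left (g := fun y : ℝ => y ^ 2) (by simp)
    have hder : ∀ t, ‖deriv f t‖ₑ ≤ 2 * (‖u (e t)‖ₑ * ‖fderiv ℝ u (e t)‖ₑ) := by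
      intro t
      have h1 : HasDerivAt (fun t => u (e t)) (fderiv ℝ u (e t) (e 1)) t :=
        (hud (e t)).hasFDerivAt.comp_hasDerivAt t
          (e.toContinuousLinearEquiv : ℝ →L[ℝ] Space 1).hasDerivAt
      have h2 : HasDerivAt f _ t := h1.pow 2
      rw [h2.deriv]
      have h3 : ‖fderiv ℝ u (e t) (e 1)‖ₑ ≤ ‖fderiv ℝ u (e t)‖ₑ := by
        refine enorm_le_iff_norm_le.2 ?_
        have := (fderiv ℝ u (e t)).le_opNorm (e 1)
        have he : ‖e 1‖ = 1 := (e.norm_map (1 : ℝ)).trans norm_one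
        rwa [he, mul_one] at this
      simp only [Nat.cast_ofNat, Nat.add_one_sub_one, pow_one, enorm_mul]
      rw [mul_assoc, show ‖(2 : ℝ)‖ₑ = 2 by simp [enorm_eq_nnnorm]]
      gcongr
    have hmp := e.measurePreserving
    have h2 : ‖u x‖ₑ ^ 2 ≤ 2 := by
      calc ‖u x‖ₑ ^ 2 = ‖f (e.symm x)‖ₑ := by rw [hf]; simp [enorm_pow]
        _ ≤ ∫⁻ t, ‖deriv f t‖ₑ :=
            (hfc.enorm_le_lintegral_Ici_deriv hfd _).trans (setLIntegral_le_lintegral _ _)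
        _ ≤ ∫⁻ t, 2 * (‖u (e t)‖ₑ * ‖fderiv ℝ u (e t)‖ₑ) := lintegral_mono hder
        _ = ∫⁻ y, 2 * (‖u y‖ₑ * ‖fderiv ℝ u y‖ₑ) :=
            hmp.lintegral_comp_emb e.toHomeomorph.measurableEmbedding
              fun y => 2 * (‖u y‖ₑ * ‖fderiv ℝ u y‖ₑ)
        _ = 2 * ∫⁻ y, ‖u y • fderiv ℝ u y‖ₑ := by
            rw [lintegral_const_mul' _ _ (by simp)]
            simp only [enorm_smul]
        _ = 2 * eLpNorm (u • fderiv ℝ u) 1 volume := by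
            rw [eLpNorm_one_eq_lintegral_enorm]
            rfl
        _ ≤ 2 * (eLpNorm u 2 volume * eLpNorm (fderiv ℝ u) 2 volume) := by
            gcongr
            exact eLpNorm_smul_le_mul_eLpNorm (hu.continuous_fderiv (by simp)).aestronglyMeasurable
              hu.continuous.aestronglyMeasurable
        _ ≤ 2 * (1 * 1) := by gcongr
        _ = 2 := by simp
    by_contra! hlt
    have h4 : (2 : ℝ≥0∞) ^ 2 ≤ ‖u x‖ₑ ^ 2 := pow_le_pow_left' hlt.le 2
    have h5 := h4.trans h2
    norm_num at h5
  calc ∫⁻ x, ‖u x‖ₑ ^ q ≤ ∫⁻ x, 2 ^ (q - 2) * ‖u x‖ₑ ^ (2 : ℝ) := by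
        refine lintegral_mono fun x => ?_
        rw [show q = (q - 2) + 2 by ring, ENNReal.rpow_add_of_nonneg _ _ (by linarith) zero_le_two,
          add_sub_cancel_right]
        exact mul_le_mul_left (ENNReal.rpow_le_rpow (hsup x) (by linarith)) _
    _ = 2 ^ (q - 2) * ∫⁻ x, ‖u x‖ₑ ^ (2 : ℝ) :=
        lintegral_const_mul' _ _ (ENNReal.rpow_ne_top_of_nonneg (by linarith) (by simp))
    _ ≤ 2 ^ (q - 2) := mul_le_of_le_one_right' (lintegral_enorm_rpow_two_le h0)

/-- The Sobolev bound for all exponents admitted by the embedding of `H¹(ℝⁿ)`. -/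
theorem sobolevBound {n : ℕ} (hn : 1 ≤ n) {q : ℝ} (hq : 2 ≤ q)
    (hqn : 3 ≤ n → q ≤ 2 * (n : ℝ) / ((n : ℝ) - 2)) : SobolevBound n q := by
  rcases le_or_gt 3 n with h | h
  · exact (sobolevBound_of_three_le h).of_le hq (hqn h)
  interval_cases n
  · exact sobolevBound_one hq
  · obtain ⟨k, hk⟩ := exists_nat_ge q
    exact (sobolevBound_two k).of_le hq (by linarith)

end DampedWave

end

/-! ### Transfer of the Sobolev inequalities to `H¹` by mollification. -/

noncomputable section

namespace DampedWave

open scoped ENNReal NNReal Convolution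

variable {n : ℕ}

/-! ### Mollification -/

/-- The convolution of `f ∈ L²` with `φ`. -/
def mollify (φ : Space n → ℝ) (f : L2 n) : Space n → ℝ :=
  (f : Space n → ℝ) ⋆[ContinuousLinearMap.lsmul ℝ ℝ, volume] φ

theorem mollify_apply (φ : Space n → ℝ) (f : L2 n) (x : Space n) :
    mollify φ f x = ∫ y, f y * φ (x - y) := rfl

theorem locallyIntegrable_L2 (f : L2 n) : LocallyIntegrable (f : Space n → ℝ) :=
  (Lp.memLp f).locallyIntegrable one_le_two

theorem contDiff_mollify {φ : Space n → ℝ} (hφ : ContDiff ℝ ∞ φ) (hc : HasCompactSupport φ)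
    (f : L2 n) : ContDiff ℝ 1 (mollify φ f) := by
  have := hc.contDiff_convolution_right (ContinuousLinearMap.lsmul ℝ ℝ) (locallyIntegrable_L2 f) hφ
  exact this.of_le (by exact_mod_cast le_top)

theorem HasWeakPartial.fderiv_mollify {i : Fin n} {f g : L2 n} (h : HasWeakPartial i f g)
    {φ : Space n → ℝ} (hφ : ContDiff ℝ ∞ φ) (hc : HasCompactSupport φ) (x : Space n) :
    fderiv ℝ (mollify φ f) x (EuclideanSpace.single i 1) = mollify φ g x := by
  have h1 : ContDiff ℝ 1 φ := hφ.of_le (by exact_mod_cast le_top)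
  have hd := hc.hasFDerivAt_convolution_right (ContinuousLinearMap.lsmul ℝ ℝ)
    (locallyIntegrable_L2 f) h1 x
  rw [mollify, hd.fderiv, convolution_precompR_apply _ (locallyIntegrable_L2 f) (hc.fderiv ℝ)
    (h1.continuous_fderiv (by simp)), convolution_lsmul, mollify_apply]
  have hψ : ContDiff ℝ ∞ fun y => φ (x - y) := hφ.comp (contDiff_const.sub contDiff_id)
  have hψc : HasCompactSupport fun y => φ (x - y) := hc.comp_homeomorph (Homeomorph.subLeft x)
  have hψd : ∀ y, fderiv ℝ (fun y => φ (x - y)) y (EuclideanSpace.single i 1) =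
      -fderiv ℝ φ (x - y) (EuclideanSpace.single i 1) := fun y => by
    have h2 : HasFDerivAt (fun y => φ (x - y)) ((fderiv ℝ φ (x - y)).comp
        (-ContinuousLinearMap.id ℝ (Space n))) y :=
      (h1.differentiable (by simp) (x - y)).hasFDerivAt.comp y ((hasFDerivAt_id y).const_sub x)
    rw [h2.fderiv]
    simp
  have h3 := h _ hψ hψc
  simp only [hψd, mul_neg, integral_neg, neg_inj] at h3
  exact h3

/-- Jensen's inequality for the probability measure `φ(x - y) dy`, here as the comparison of its
`L¹` and `L²` norms, followed by Tonelli's theorem. -/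
theorem eLpNorm_mollify_le {φ : Space n → ℝ} (hφ : Continuous φ) (h0 : ∀ x, 0 ≤ φ x)
    (hc : HasCompactSupport φ) (h1 : ∫ x, φ x = 1) (f : L2 n) :
    eLpNorm (mollify φ f) 2 volume ≤ eLpNorm f 2 volume := by
  have hl1 : ∫⁻ y, ENNReal.ofReal (φ y) = 1 := by
    rw [← ofReal_integral_eq_lintegral_ofReal (hφ.integrable_of_hasCompactSupport hc)
      (Eventually.of_forall h0), h1, ENNReal.ofReal_one]
  have hfm : Measurable (f : Space n → ℝ) := (Lp.stronglyMeasurable f).measurable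
  have hpt : ∀ x, ‖mollify φ f x‖ₑ ^ (2 : ℝ) ≤
      ∫⁻ y, ENNReal.ofReal (φ (x - y)) * ‖f y‖ₑ ^ (2 : ℝ) := by
    intro x
    have hmφ : Measurable fun y => ENNReal.ofReal (φ (x - y)) :=
      (hφ.comp (continuous_const.sub continuous_id)).measurable.ennreal_ofReal
    set ν : Measure (Space n) := volume.withDensity fun y => ENNReal.ofReal (φ (x - y)) with hν
    have hνp : IsProbabilityMeasure ν := by
      refine ⟨?_⟩
      rw [hν, withDensity_apply _ MeasurableSet.univ, setLIntegral_univ,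
        lintegral_sub_left_eq_self (fun y => ENNReal.ofReal (φ y)) x, hl1]
    have h2 := eLpNorm_le_eLpNorm_of_exponent_le (μ := ν) (p := 1) (q := 2) one_le_two
      hfm.aestronglyMeasurable
    have h3 := eLpNorm_nnreal_pow_eq_lintegral (f := f) (μ := ν) (p := 2) two_ne_zero
    simp only [NNReal.coe_ofNat, ENNReal.coe_ofNat] at h3
    have h4 : ∀ g : Space n → ℝ≥0∞, Measurable g →
        ∫⁻ y, g y ∂ν = ∫⁻ y, ENNReal.ofReal (φ (x - y)) * g y := fun g hg =>
      lintegral_withDensity_eq_lintegral_mul _ hmφ hg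
    rw [← h4 _ (hfm.enorm.pow_const _), ← h3]
    refine ENNReal.rpow_le_rpow (le_trans ?_ h2) zero_le_two
    rw [eLpNorm_one_eq_lintegral_enorm, h4 _ hfm.enorm, mollify_apply]
    refine (enorm_integral_le_lintegral_enorm _).trans_eq (lintegral_congr fun y => ?_)
    rw [enorm_mul, mul_comm, Real.enorm_eq_ofReal (h0 _)]
  have h5 : ∀ g : Space n → ℝ, eLpNorm g 2 volume ^ (2 : ℝ) = ∫⁻ x, ‖g x‖ₑ ^ (2 : ℝ) := fun g => by
    have := eLpNorm_nnreal_pow_eq_lintegral (f := g) (μ := (volume : Measure (Space n))) (p := 2)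
      two_ne_zero
    simpa only [NNReal.coe_ofNat, ENNReal.coe_ofNat] using this
  rw [← ENNReal.rpow_le_rpow_iff zero_lt_two, h5, h5]
  calc ∫⁻ x, ‖mollify φ f x‖ₑ ^ (2 : ℝ)
      ≤ ∫⁻ x, ∫⁻ y, ENNReal.ofReal (φ (x - y)) * ‖f y‖ₑ ^ (2 : ℝ) := lintegral_mono hpt
    _ = ∫⁻ y, ∫⁻ x, ENNReal.ofReal (φ (x - y)) * ‖f y‖ₑ ^ (2 : ℝ) := by
        refine lintegral_lintegral_swap (Measurable.aemeasurable ?_)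
        refine Measurable.mul ?_ ((hfm.comp measurable_snd).enorm.pow_const _)
        exact (hφ.comp (continuous_fst.sub continuous_snd)).measurable.ennreal_ofReal
    _ = ∫⁻ y, ‖f y‖ₑ ^ (2 : ℝ) := by
        refine lintegral_congr fun y => ?_
        have hm : Measurable fun x => ENNReal.ofReal (φ (x - y)) :=
          (hφ.comp (continuous_id.sub continuous_const)).measurable.ennreal_ofReal
        rw [lintegral_mul_const _ hm,
          lintegral_sub_right_eq_self (fun x => ENNReal.ofReal (φ x)) y, hl1, one_mul]

theorem norm_fderiv_le_sum (v : Space n → ℝ) (x : Space n) :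
    ‖fderiv ℝ v x‖ ≤ ∑ i, ‖fderiv ℝ v x (EuclideanSpace.single i 1)‖ := by
  refine ContinuousLinearMap.opNorm_le_bound _ (Finset.sum_nonneg fun _ _ => norm_nonneg _)
    fun y => ?_
  rw [fderiv_eq_sum_single, Finset.sum_mul]
  refine (norm_sum_le _ _).trans (Finset.sum_le_sum fun i _ => ?_)
  rw [norm_mul, mul_comm]
  exact mul_le_mul_of_nonneg_left (PiLp.norm_apply_le y i) (norm_nonneg _)

theorem eLpNorm_fderiv_mollify_le {φ : Space n → ℝ} (hφ : ContDiff ℝ ∞ φ) (h0 : ∀ x, 0 ≤ φ x)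
    (hc : HasCompactSupport φ) (h1 : ∫ x, φ x = 1) (f : L2 n) (g : Fin n → L2 n)
    (h : ∀ i, HasWeakPartial i f (g i)) :
    eLpNorm (fderiv ℝ (mollify φ f)) 2 volume ≤ ∑ i, eLpNorm (g i) 2 volume := by
  calc eLpNorm (fderiv ℝ (mollify φ f)) 2 volume
      ≤ eLpNorm (∑ i, fun x => ‖mollify φ (g i) x‖) 2 volume := by
        refine eLpNorm_mono_real fun x => ?_
        refine (norm_fderiv_le_sum _ x).trans_eq ?_
        rw [Finset.sum_apply]
        exact Finset.sum_congr rfl fun i _ => by rw [(h i).fderiv_mollify hφ hc]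
    _ ≤ ∑ i, eLpNorm (fun x => ‖mollify φ (g i) x‖) 2 volume :=
        eLpNorm_sum_le (fun i _ => (contDiff_mollify hφ hc
          (g i)).continuous.norm.aestronglyMeasurable) one_le_two
    _ ≤ ∑ i, eLpNorm (g i) 2 volume := Finset.sum_le_sum fun i _ => by
        rw [eLpNorm_norm]
        exact eLpNorm_mollify_le hφ.continuous h0 hc h1 (g i)

theorem H1.eLpNorm_toL2_le {u : H1 n} : eLpNorm u.toL2 2 volume ≤ ENNReal.ofReal ‖u‖ := by
  rw [← Lp.enorm_def, ← ofReal_norm]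
  exact ENNReal.ofReal_le_ofReal u.norm_toL2_le

theorem H1.norm_partialL_le (u : H1 n) (i : Fin n) : ‖H1.partialL i u‖ ≤ ‖u‖ := by
  refine le_of_sq_le_sq ?_ (norm_nonneg _)
  rw [H1.norm_sq]
  exact (Finset.single_le_sum (f := fun i => ‖H1.partialL i u‖ ^ 2)
    (fun _ _ => sq_nonneg _) (Finset.mem_univ i)).trans (le_add_of_nonneg_left (sq_nonneg _))

theorem H1.eLpNorm_partialL_le (u : H1 n) (i : Fin n) :
    eLpNorm (H1.partialL i u) 2 volume ≤ ENNReal.ofReal ‖u‖ := by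
  rw [← Lp.enorm_def, ← ofReal_norm]
  exact ENNReal.ofReal_le_ofReal (u.norm_partialL_le i)

/-! ### Sobolev's inequality on `H¹` -/

/-- Mollifying and cutting off `u` gives admissible functions `v j` in the unit balls that converge
to `u` almost everywhere. Fatou's lemma then passes the bound to `u` without any convergence in
norm. -/
theorem SobolevBound.exists_lintegral_le {q : ℝ} (h : SobolevBound n q) :
    ∃ C : ℝ≥0∞, C ≠ ⊤ ∧ ∃ ε > 0, ∀ u : H1 n, ‖u‖ ≤ ε → ∫⁻ x, ‖u.toL2 x‖ₑ ^ q ≤ C := by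
  obtain ⟨C, hC, h⟩ := h
  let χ : ContDiffBump (0 : Space n) := ⟨1, 2, one_pos, one_lt_two⟩
  have hχ : ContDiff ℝ ∞ χ := χ.contDiff
  have hχc : HasCompactSupport χ := χ.hasCompactSupport
  obtain ⟨K, hK⟩ := (hχc.fderiv ℝ).exists_bound_of_continuous (hχ.continuous_fderiv (by simp))
  have hK0 : 0 ≤ K := (norm_nonneg _).trans (hK 0)
  -- The gradient of `v j` has norm at most `n‖u‖ + K‖u‖`: `n` from summing the partial derivatives,
  -- `K` from the gradient of the cutoff.
  refine ⟨C, hC, 1 / (n + K + 1), by positivity, fun u hu => ?_⟩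
  have hu1 : ‖u‖ ≤ 1 := hu.trans (by
    rw [div_le_one (by positivity)]
    have : (0 : ℝ) ≤ n := n.cast_nonneg
    linarith)
  let ψ : ℕ → ContDiffBump (0 : Space n) := fun j =>
    ⟨1 / ((j : ℝ) + 1), 2 * (1 / ((j : ℝ) + 1)), by positivity,
      lt_mul_of_one_lt_left (by positivity) one_lt_two⟩
  let φ : ℕ → Space n → ℝ := fun j => (ψ j).normed volume
  have hφ : ∀ j, ContDiff ℝ ∞ (φ j) := fun j => (ψ j).contDiff_normed
  have hφc : ∀ j, HasCompactSupport (φ j) := fun j => (ψ j).hasCompactSupport_normed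
  have hφ0 : ∀ j x, 0 ≤ φ j x := fun j x => (ψ j).nonneg_normed x
  have hφ1 : ∀ j, ∫ x, φ j x = 1 := fun j => (ψ j).integral_normed
  let c : ℕ → ℝ := fun j => 1 / ((j : ℝ) + 1)
  have hc0 : ∀ j, 0 < c j := fun j => by positivity
  have hc1 : ∀ j, c j ≤ 1 := fun j => by
    rw [div_le_one (by positivity)]
    have : (0 : ℝ) ≤ j := j.cast_nonneg
    linarith
  have hclim : Tendsto c atTop (𝓝 0) := tendsto_one_div_add_atTop_nhds_zero_nat
  let v : ℕ → Space n → ℝ := fun j x => χ (c j • x) * mollify (φ j) u.toL2 x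
  have hm : ∀ j, ContDiff ℝ 1 (mollify (φ j) u.toL2) := fun j => contDiff_mollify (hφ j) (hφc j) _
  have hχj : ∀ j, ContDiff ℝ 1 fun x : Space n => χ (c j • x) := fun j =>
    (hχ.of_le (by exact_mod_cast le_top)).comp (contDiff_const_smul (c j))
  have hv : ∀ j, ContDiff ℝ 1 (v j) := fun j => (hχj j).mul (hm j)
  have hvc : ∀ j, HasCompactSupport (v j) := fun j =>
    (hχc.comp_smul (hc0 j).ne').mul_right
  have hm2 : ∀ j, eLpNorm (mollify (φ j) u.toL2) 2 volume ≤ ENNReal.ofReal ‖u‖ := fun j =>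
    (eLpNorm_mollify_le (hφ j).continuous (hφ0 j) (hφc j) (hφ1 j) _).trans H1.eLpNorm_toL2_le
  have hv0 : ∀ j, eLpNorm (v j) 2 volume ≤ 1 := fun j => by
    refine le_trans (eLpNorm_mono fun x => ?_) ((hm2 j).trans (ENNReal.ofReal_le_one.2 hu1))
    rw [norm_mul]
    refine mul_le_of_le_one_left (norm_nonneg _) ?_
    rw [Real.norm_of_nonneg χ.nonneg]
    exact χ.le_one
  have hv1 : ∀ j, eLpNorm (fderiv ℝ (v j)) 2 volume ≤ 1 := fun j => by
    have hle : ∀ x, ‖fderiv ℝ (v j) x‖ ≤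
        ((fun x => ‖fderiv ℝ (mollify (φ j) u.toL2) x‖) +
          fun x => K * ‖mollify (φ j) u.toL2 x‖) x := fun x => by
      have hd : fderiv ℝ (v j) x = χ (c j • x) • fderiv ℝ (mollify (φ j) u.toL2) x +
          mollify (φ j) u.toL2 x • fderiv ℝ (fun x : Space n => χ (c j • x)) x :=
        fderiv_mul ((hχj j).differentiable (by simp) x) ((hm j).differentiable (by simp) x)
      rw [hd]
      refine (norm_add_le _ _).trans (add_le_add ?_ ?_)
      · rw [norm_smul, Real.norm_of_nonneg χ.nonneg]
        exact mul_le_of_le_one_left (norm_nonneg _) χ.le_one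
      · rw [norm_smul, mul_comm, fderiv_comp_smul, norm_smul, Real.norm_of_nonneg (hc0 j).le]
        refine mul_le_mul_of_nonneg_right ?_ (norm_nonneg _)
        exact (mul_le_of_le_one_left (norm_nonneg _) (hc1 j)).trans (hK _)
    refine (eLpNorm_mono_real hle).trans ((eLpNorm_add_le
      ((hm j).continuous_fderiv (by simp)).norm.aestronglyMeasurable
      (continuous_const.mul (hm j).continuous.norm).aestronglyMeasurable one_le_two).trans ?_)
    have h1 : eLpNorm (fun x => ‖fderiv ℝ (mollify (φ j) u.toL2) x‖) 2 volume ≤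
        ENNReal.ofReal (n * ‖u‖) := by
      rw [eLpNorm_norm]
      refine (eLpNorm_fderiv_mollify_le (hφ j) (hφ0 j) (hφc j) (hφ1 j) _ _
        u.hasWeakPartial).trans ((Finset.sum_le_sum fun i _ => u.eLpNorm_partialL_le i).trans ?_)
      rw [Finset.sum_const, Finset.card_univ, Fintype.card_fin, nsmul_eq_mul,
        ENNReal.ofReal_mul n.cast_nonneg, ENNReal.ofReal_natCast]
    have h2 : eLpNorm (fun x => K * ‖mollify (φ j) u.toL2 x‖) 2 volume ≤
        ENNReal.ofReal (K * ‖u‖) := by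
      rw [ENNReal.ofReal_mul hK0]
      refine (eLpNorm_le_mul_eLpNorm_of_ae_le_mul (g := mollify (φ j) u.toL2) (c := K)
        (Eventually.of_forall fun x => ?_) 2).trans (mul_le_mul_right (hm2 j) _)
      rw [norm_mul, norm_norm, Real.norm_of_nonneg hK0]
    refine (add_le_add h1 h2).trans ?_
    rw [← ENNReal.ofReal_add (by positivity) (by positivity), ENNReal.ofReal_le_one]
    rw [le_div_iff₀ (by positivity)] at hu
    nlinarith [norm_nonneg u]
  have hlim : ∀ᵐ x, Tendsto (fun j => v j x) atTop (𝓝 (u.toL2 x)) := by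
    have h1 := ContDiffBump.ae_convolution_tendsto_right_of_locallyIntegrable
      (φ := ψ) (l := atTop) (K := 2) (μ := (volume : Measure (Space n)))
      (by simpa using hclim.const_mul 2) (Eventually.of_forall fun j => le_rfl)
      (locallyIntegrable_L2 u.toL2)
    filter_upwards [h1] with x hx
    have h2 : ∀ᶠ j in atTop, χ (c j • x) = 1 := by
      have h3 : Tendsto (fun j => c j • x) atTop (𝓝 ((0 : ℝ) • x)) := hclim.smul_const x
      rw [zero_smul] at h3
      filter_upwards [h3 (Metric.closedBall_mem_nhds 0 one_pos)] with j hj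
      exact χ.one_of_mem_closedBall hj
    refine hx.congr' ?_
    filter_upwards [h2] with j hj
    simp only [v]
    rw [hj, one_mul, mollify_apply, convolution_lsmul_swap]
    refine integral_congr_ae (Eventually.of_forall fun y => ?_)
    simp only [smul_eq_mul]
    exact mul_comm _ _
  calc ∫⁻ x, ‖u.toL2 x‖ₑ ^ q = ∫⁻ x, liminf (fun j => ‖v j x‖ₑ ^ q) atTop := by
        refine lintegral_congr_ae ?_
        filter_upwards [hlim] with x hx
        exact (((ENNReal.continuous_rpow_const.tendsto _).comp
          ((continuous_enorm.tendsto _).comp hx)).liminf_eq).symm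
    _ ≤ liminf (fun j => ∫⁻ x, ‖v j x‖ₑ ^ q) atTop :=
        lintegral_liminf_le fun j => (hv j).continuous.enorm.measurable.pow_const _
    _ ≤ C := by
        refine liminf_le_of_le (by isBoundedDefault) fun b hb => ?_
        obtain ⟨j, hj⟩ := hb.exists
        exact hj.trans (h (v j) (hv j) (hvc j) (hv0 j) (hv1 j))

/-- **Sobolev's inequality** in `H¹(ℝⁿ)`. -/
theorem H1.exists_eLpNorm_le (hn : 1 ≤ n) {q : ℝ≥0} (hq : 2 ≤ q)
    (hqn : 3 ≤ n → (q : ℝ) ≤ 2 * (n : ℝ) / ((n : ℝ) - 2)) :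
    ∃ C : ℝ≥0, ∀ u : H1 n, eLpNorm u.toL2 q volume ≤ C * ENNReal.ofReal ‖u‖ := by
  obtain ⟨C, hC, ε, hε, h⟩ := (sobolevBound hn (by exact_mod_cast hq) hqn).exists_lintegral_le
  have hq0 : q ≠ 0 := by
    rintro rfl
    simp at hq
  have hq0' : (0 : ℝ) < q := by positivity
  set D : ℝ≥0∞ := C ^ (q : ℝ)⁻¹
  have hD : D ≠ ⊤ := ENNReal.rpow_ne_top_of_nonneg (by positivity) hC
  have h1 : ∀ u : H1 n, ‖u‖ ≤ ε → eLpNorm u.toL2 q volume ≤ D := fun u hu => by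
    have h2 := eLpNorm_nnreal_pow_eq_lintegral (f := u.toL2) (μ := (volume : Measure (Space n))) hq0
    rw [ENNReal.le_rpow_inv_iff hq0', h2]
    exact h u hu
  refine ⟨D.toNNReal * (ε⁻¹).toNNReal, fun u => ?_⟩
  rw [ENNReal.coe_mul, ENNReal.coe_toNNReal hD]
  rcases eq_or_ne u 0 with rfl | hu
  · have : eLpNorm (H1.toL2 (0 : H1 n)) q volume = 0 := by
      rw [H1.toL2_zero, eLpNorm_congr_ae (Lp.coeFn_zero ℝ 2 volume), eLpNorm_zero]
    rw [this]
    exact zero_le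
  have hu0 : 0 < ‖u‖ := norm_pos_iff.2 hu
  -- The bound on a small ball extends to all of `H¹` by homogeneity.
  have h3 := h1 ((ε / ‖u‖) • u) (by
    rw [norm_smul, Real.norm_of_nonneg (by positivity), div_mul_cancel₀ _ hu0.ne'])
  have h4 : eLpNorm ((ε / ‖u‖) • u).toL2 q volume =
      ENNReal.ofReal (ε / ‖u‖) * eLpNorm u.toL2 q volume := by
    rw [H1.toL2_smul, eLpNorm_congr_ae (Lp.coeFn_smul _ _), eLpNorm_const_smul,
      Real.enorm_eq_ofReal (by positivity)]
  rw [h4] at h3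
  have h5 : ENNReal.ofReal (‖u‖ / ε) * ENNReal.ofReal (ε / ‖u‖) = 1 := by
    rw [← ENNReal.ofReal_mul (by positivity), div_mul_div_cancel₀ hε.ne', div_self hu0.ne',
      ENNReal.ofReal_one]
  calc eLpNorm u.toL2 q volume
      = ENNReal.ofReal (‖u‖ / ε) * (ENNReal.ofReal (ε / ‖u‖) * eLpNorm u.toL2 q volume) := by
        rw [← mul_assoc, h5, one_mul]
    _ ≤ ENNReal.ofReal (‖u‖ / ε) * D := mul_le_mul_right h3 _
    _ = D * ENNReal.ofReal (ε⁻¹) * ENNReal.ofReal ‖u‖ := by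
        rw [mul_comm, mul_assoc, ← ENNReal.ofReal_mul (by positivity), div_eq_inv_mul]

end DampedWave

end

noncomputable section

namespace DampedWave

open scoped ENNReal NNReal

/-! ### The power nonlinearity -/

/-- Convexity of the power function, obtained for `y > 0` from Bernoulli's inequality with increment
`y/x - 1`. -/
theorem rpow_sub_rpow_le {p x y : ℝ} (hp : 1 ≤ p) (hy : 0 ≤ y) (hxy : y ≤ x) :
    x ^ p - y ^ p ≤ p * x ^ (p - 1) * (x - y) := by
  rcases hy.eq_or_lt with rfl | hy'
  · rcases hxy.eq_or_lt with rfl | hx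
    · simp
    · rw [Real.zero_rpow (by linarith), sub_zero, sub_zero, mul_assoc, ← Real.rpow_add_one hx.ne',
        sub_add_cancel]
      exact le_mul_of_one_le_left (Real.rpow_nonneg hx.le _) hp
  have hx : 0 < x := hy'.trans_le hxy
  have h1 := one_add_mul_self_le_rpow_one_add (s := y / x - 1)
    (by have : 0 ≤ y / x := by positivity
        linarith) hp
  rw [add_sub_cancel, Real.div_rpow hy hx.le, le_div_iff₀ (by positivity)] at h1
  have h2 : x ^ p = x ^ (p - 1) * x := by rw [← Real.rpow_add_one hx.ne', sub_add_cancel]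
  have h3 : (1 + p * (y / x - 1)) * x ^ p = x ^ p - p * x ^ (p - 1) * (x - y) := by
    rw [h2]
    field_simp
    ring
  linarith

theorem abs_rpow_sub_rpow_le {p : ℝ} (hp : 1 ≤ p) (a b : ℝ) :
    |(|a| ^ p - |b| ^ p)| ≤ p * ((|a| + |b|) ^ (p - 1) * |a - b|) := by
  wlog h : |b| ≤ |a| generalizing a b
  · have := this b a (le_of_not_ge h)
    rwa [abs_sub_comm, add_comm, abs_sub_comm b a] at this
  rw [abs_of_nonneg (sub_nonneg.2 (Real.rpow_le_rpow (abs_nonneg _) h (by linarith)))]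
  refine (rpow_sub_rpow_le hp (abs_nonneg _) h).trans ?_
  rw [mul_assoc]
  refine mul_le_mul_of_nonneg_left ?_ (by linarith)
  refine mul_le_mul ?_ (abs_sub_abs_le_abs_sub a b) (sub_nonneg.2 h) (by positivity)
  exact Real.rpow_le_rpow (abs_nonneg _) (le_add_of_nonneg_right (abs_nonneg _)) (by linarith)

variable {n : ℕ}

theorem absPow_zero {p : ℝ} (hp : 0 < p) : absPow p (0 : L2 n) = 0 := by
  unfold absPow
  split_ifs with h
  · rw [← norm_eq_zero, Lp.norm_toLp]
    have : (fun x => |(0 : L2 n) x| ^ p) =ᵐ[volume] 0 := by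
      filter_upwards [Lp.coeFn_zero ℝ 2 (volume : Measure (Space n))] with x hx
      rw [hx]
      simp [Real.zero_rpow hp.ne']
    rw [eLpNorm_congr_ae this, eLpNorm_zero, ENNReal.toReal_zero]
  · rfl

section

variable {p : ℝ} (hp : 1 < p)
include hp

theorem memLp_abs_rpow {f : L2 n} (hf : MemLp f (ENNReal.ofReal (2 * p)) volume) :
    MemLp (fun x => |f x| ^ p) 2 volume := by
  have hp0 : 0 < p := by linarith
  have h0 : AEStronglyMeasurable (fun x => |f x| ^ p) volume := by
    have := (Lp.stronglyMeasurable f).measurable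
    exact (this.abs.pow_const p).aestronglyMeasurable
  refine ⟨h0, ?_⟩
  have h1 := eLpNorm_norm_rpow (p := 2) (μ := (volume : Measure (Space n))) f hp0
  simp only [Real.norm_eq_abs] at h1
  have h2 : 2 * ENNReal.ofReal p = ENNReal.ofReal (2 * p) := by
    rw [ENNReal.ofReal_mul zero_le_two, ENNReal.ofReal_ofNat]
  rw [h1, h2]
  exact ENNReal.rpow_lt_top_of_nonneg hp0.le hf.2.ne

/-- The pointwise bound `p (|f| + |g|)^{p-1} |f - g|` and Hölder's inequality with `1/2 = (p-1)/(2p)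
+ 1/(2p)`. -/
theorem norm_absPow_sub_le {f g : L2 n} (hf : MemLp f (ENNReal.ofReal (2 * p)) volume)
    (hg : MemLp g (ENNReal.ofReal (2 * p)) volume) :
    ENNReal.ofReal ‖absPow p f - absPow p g‖ ≤ ENNReal.ofReal p *
      ((eLpNorm f (ENNReal.ofReal (2 * p)) volume + eLpNorm g (ENNReal.ofReal (2 * p)) volume) ^
        (p - 1) * eLpNorm (fun x => f x - g x) (ENNReal.ofReal (2 * p)) volume) := by
  have hp0 : 0 < p := by linarith
  have h2p : (1 : ℝ≥0∞) ≤ ENNReal.ofReal (2 * p) := by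
    rw [ENNReal.one_le_ofReal]
    linarith
  have hF := memLp_abs_rpow hp hf
  have hG := memLp_abs_rpow hp hg
  rw [absPow, absPow, dif_pos hF, dif_pos hG, ← MemLp.toLp_sub, ofReal_norm, Lp.enorm_toLp]
  have hfm : Measurable (f : Space n → ℝ) := (Lp.stronglyMeasurable f).measurable
  have hgm : Measurable (g : Space n → ℝ) := (Lp.stronglyMeasurable g).measurable
  have hsm : Measurable fun x => |f x| + |g x| := hfm.abs.add hgm.abs
  have h1 : eLpNorm ((fun x => |f x| ^ p) - fun x => |g x| ^ p) 2 volume ≤ ENNReal.ofReal p *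
      eLpNorm ((fun x => (|f x| + |g x|) ^ (p - 1)) • fun x => f x - g x) 2 volume := by
    refine eLpNorm_le_mul_eLpNorm_of_ae_le_mul (Eventually.of_forall fun x => ?_) 2
    simp only [Pi.sub_apply, Pi.smul_apply', smul_eq_mul, Real.norm_eq_abs, abs_mul]
    rw [abs_of_nonneg (Real.rpow_nonneg (by positivity) (p - 1))]
    exact abs_rpow_sub_rpow_le hp.le _ _
  refine h1.trans (mul_le_mul_right ?_ _)
  have : ENNReal.HolderTriple (ENNReal.ofReal (2 * p / (p - 1))) (ENNReal.ofReal (2 * p)) 2 := by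
    refine ⟨?_⟩
    rw [← ENNReal.ofReal_inv_of_pos (div_pos (by linarith) (by linarith)),
      ← ENNReal.ofReal_inv_of_pos (by linarith), ← ENNReal.ofReal_add
        (inv_nonneg.2 (div_nonneg (by linarith) (by linarith))) (by positivity),
      ← ENNReal.ofReal_ofNat 2, ← ENNReal.ofReal_inv_of_pos zero_lt_two]
    congr 1
    field_simp
    ring
  refine (eLpNorm_smul_le_mul_eLpNorm (p := ENNReal.ofReal (2 * p / (p - 1)))
    (q := ENNReal.ofReal (2 * p)) (hfm.sub hgm).aestronglyMeasurable
    (hsm.pow_const _).aestronglyMeasurable).trans (mul_le_mul_left ?_ _)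
  have h2 := eLpNorm_norm_rpow (p := ENNReal.ofReal (2 * p / (p - 1)))
    (μ := (volume : Measure (Space n))) (fun x => |f x| + |g x|) (sub_pos.2 hp)
  have h3 : ∀ x, ‖|f x| + |g x|‖ = |f x| + |g x| := fun x =>
    Real.norm_of_nonneg (by positivity)
  simp only [h3] at h2
  rw [h2, ← ENNReal.ofReal_mul (div_nonneg (by linarith) (by linarith)),
    div_mul_cancel₀ _ (sub_ne_zero.2 hp.ne')]
  refine ENNReal.rpow_le_rpow ?_ (by linarith)
  refine (eLpNorm_add_le hfm.abs.aestronglyMeasurable hgm.abs.aestronglyMeasurable h2p).trans ?_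
  exact add_le_add (eLpNorm_norm (f : Space n → ℝ)).le (eLpNorm_norm (g : Space n → ℝ)).le

variable (hn : 1 ≤ n) (hpn : 3 ≤ n → p ≤ (n : ℝ) / ((n : ℝ) - 2))
include hn hpn

theorem H1.exists_eLpNorm_two_mul_le : ∃ C : ℝ≥0, ∀ u : H1 n,
    eLpNorm u.toL2 (ENNReal.ofReal (2 * p)) volume ≤ C * ENNReal.ofReal ‖u‖ := by
  have h2p : ((2 * p).toNNReal : ℝ) = 2 * p := Real.coe_toNNReal _ (by linarith)
  refine H1.exists_eLpNorm_le hn (q := (2 * p).toNNReal) ?_ fun h => ?_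
  · rw [← NNReal.coe_le_coe, h2p]
    push_cast
    linarith
  · rw [h2p, mul_div_assoc]
    linarith [hpn h]

theorem H1.memLp_abs_rpow (u : H1 n) : MemLp (fun x => |u.toL2 x| ^ p) 2 volume := by
  obtain ⟨C, hC⟩ := H1.exists_eLpNorm_two_mul_le hp hn hpn
  exact DampedWave.memLp_abs_rpow hp ⟨(Lp.memLp u.toL2).1, (hC u).trans_lt
    (ENNReal.mul_lt_top ENNReal.coe_lt_top ENNReal.ofReal_lt_top)⟩

/-- The Hölder bound combined with the embedding of `H¹` in `L^{2p}`; the restriction on `p` in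
dimension at least 3 is exactly `2p ≤ 2n/(n-2)`. -/
theorem H1.exists_norm_absPow_sub_le (M : ℝ) : ∃ L : ℝ, ∀ u v : H1 n, ‖u‖ ≤ M → ‖v‖ ≤ M →
    ‖absPow p u.toL2 - absPow p v.toL2‖ ≤ L * ‖u - v‖ := by
  obtain ⟨C, hC⟩ := H1.exists_eLpNorm_two_mul_le hp hn hpn
  refine ⟨p * ((C * M + C * M) ^ (p - 1) * C), fun u v hu hv => ?_⟩
  have hM : 0 ≤ M := (norm_nonneg _).trans hu
  have hm : ∀ w : H1 n, MemLp w.toL2 (ENNReal.ofReal (2 * p)) volume := fun w =>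
    ⟨(Lp.memLp w.toL2).1, (hC w).trans_lt
      (ENNReal.mul_lt_top ENNReal.coe_lt_top ENNReal.ofReal_lt_top)⟩
  have hb : ∀ w : H1 n, ‖w‖ ≤ M →
      eLpNorm w.toL2 (ENNReal.ofReal (2 * p)) volume ≤ ENNReal.ofReal (C * M) := fun w hw => by
    refine (hC w).trans ?_
    rw [ENNReal.ofReal_mul C.coe_nonneg, ENNReal.ofReal_coe_nnreal]
    exact mul_le_mul_right (ENNReal.ofReal_le_ofReal hw) _
  have h := norm_absPow_sub_le hp (hm u) (hm v)
  have hCM : 0 ≤ (C : ℝ) * M := mul_nonneg C.coe_nonneg hM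
  rw [← ENNReal.ofReal_le_ofReal_iff (mul_nonneg (mul_nonneg (by linarith)
    (mul_nonneg (Real.rpow_nonneg (by linarith) _) C.coe_nonneg)) (norm_nonneg _))]
  refine h.trans ?_
  rw [mul_assoc, mul_assoc, ENNReal.ofReal_mul (by linarith : 0 ≤ p),
    ENNReal.ofReal_mul (Real.rpow_nonneg (by linarith) _),
    ← ENNReal.ofReal_rpow_of_nonneg (by linarith) (by linarith), ENNReal.ofReal_mul C.coe_nonneg,
    ENNReal.ofReal_coe_nnreal, ENNReal.ofReal_add hCM hCM]
  refine mul_le_mul_right (mul_le_mul' ?_ ?_) _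
  · exact ENNReal.rpow_le_rpow (add_le_add (hb u hu) (hb v hv)) (by linarith)
  · have h2 := hC (u - v)
    rwa [H1.toL2_sub, eLpNorm_congr_ae (Lp.coeFn_sub _ _)] at h2

end

end DampedWave

end

noncomputable section

namespace DampedWave

/-! ### Semilinear evolution equations and their maximal mild solutions. -/

section Semilinear

variable {X : Type*} [NormedAddCommGroup X] [NormedSpace ℝ X]

/-- `P` is a strongly continuous evolution system on `[0,∞)` with exponential growth. -/
structure IsEvolution (P : ℝ → ℝ → X →L[ℝ] X) : Prop where
  continuous : Continuous fun q : ℝ × ℝ × X => P q.1 q.2.1 q.2.2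
  norm_le : ∀ {t s : ℝ}, 0 ≤ s → s ≤ t → ∀ x, ‖P t s x‖ ≤ 2 * Real.exp (t - s) * ‖x‖
  self : ∀ {s : ℝ}, 0 ≤ s → ∀ x, P s s x = x
  comp : ∀ {r s t : ℝ}, 0 ≤ r → r ≤ s → s ≤ t → ∀ x, P t s (P s r x) = P t r x

/-- `U` is a mild solution of the semilinear evolution equation with nonlinearity `N`
on `[s,t]`. -/
def IsMildOn (P : ℝ → ℝ → X →L[ℝ] X) (N : X → X) (s t : ℝ) (U : ℝ → X) : Prop :=
  ContinuousOn U (Icc s t) ∧ ∀ q ∈ Icc s t, U q = P q s (U s) + ∫ r in s..q, P q r (N (U r))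

variable {P : ℝ → ℝ → X →L[ℝ] X} {N N' : X → X} {s t : ℝ} {U W : ℝ → X}

theorem IsEvolution.continuousOn_comp (hP : IsEvolution P) (hN : Continuous N) {A : Set ℝ}
    (hU : ContinuousOn U A) (q : ℝ) : ContinuousOn (fun r => P q r (N (U r))) A :=
  hP.continuous.comp_continuousOn
    (continuousOn_const.prodMk (continuousOn_id.prodMk (hN.comp_continuousOn hU)))

theorem IsEvolution.intervalIntegrable (hP : IsEvolution P) (hN : Continuous N)
    (hU : ContinuousOn U (Icc s t)) {a b : ℝ} (ha : a ∈ Icc s t) (hb : b ∈ Icc s t) (q : ℝ) :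
    IntervalIntegrable (fun r => P q r (N (U r))) volume a b :=
  (hP.continuousOn_comp hN (hU.mono (ordConnected_Icc.uIcc_subset ha hb)) q).intervalIntegrable

theorem IsMildOn.mono (h : IsMildOn P N s t U) {t' : ℝ} (ht : t' ≤ t) : IsMildOn P N s t' U :=
  ⟨h.1.mono (Icc_subset_Icc_right ht), fun q hq => h.2 q ⟨hq.1, hq.2.trans ht⟩⟩

theorem IsMildOn.congr_nonlinearity (h : IsMildOn P N s t U)
    (hN : ∀ r ∈ Icc s t, N (U r) = N' (U r)) : IsMildOn P N' s t U := by
  refine ⟨h.1, fun q hq => ?_⟩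
  rw [h.2 q hq]
  congr 1
  refine intervalIntegral.integral_congr fun r hr => ?_
  rw [uIcc_of_le hq.1] at hr
  simp only [hN r ⟨hr.1, hr.2.trans hq.2⟩]

theorem IsMildOn.eqOn (hP : IsEvolution P) (hs : 0 ≤ s) {L : ℝ}
    (hN : ∀ x y, ‖N x - N y‖ ≤ L * ‖x - y‖) (hNc : Continuous N) (hU : IsMildOn P N s t U)
    (hW : IsMildOn P N s t W) (h : U s = W s) : EqOn U W (Icc s t) := by
  refine eqOn_of_volterra (F := fun q r x => P q r (N x)) (x₀ := fun q => P q s (U s))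
    (C := 2 * Real.exp (t - s) * L) hU.1 hW.1
    (fun q hq => hP.intervalIntegrable hNc hU.1 ⟨le_rfl, hq.1.trans hq.2⟩ hq q)
    (fun q hq => hP.intervalIntegrable hNc hW.1 ⟨le_rfl, hq.1.trans hq.2⟩ hq q)
    (fun q hq r hr => ?_) hU.2 (fun q hq => by rw [h]; exact hW.2 q hq)
  rw [← map_sub, mul_assoc]
  refine (hP.norm_le (hs.trans hr.1) hr.2 _).trans (mul_le_mul ?_ (hN _ _) (norm_nonneg _)
    (by positivity))
  have : Real.exp (q - r) ≤ Real.exp (t - s) := Real.exp_le_exp.2 (by linarith [hr.1, hq.2])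
  linarith

/-- Splitting the Duhamel integral at `s'` and pulling `P q s'` out of its first part by the
evolution law. -/
theorem IsMildOn.restart [CompleteSpace X] (hP : IsEvolution P) (hs : 0 ≤ s) (hN : Continuous N)
    (hU : IsMildOn P N s t U) {s' : ℝ} (hs' : s ≤ s') : IsMildOn P N s' t U := by
  refine ⟨hU.1.mono (Icc_subset_Icc_left hs'), fun q hq => ?_⟩
  have hst : s ≤ t := hs'.trans (hq.1.trans hq.2)
  have h1 : s' ∈ Icc s t := ⟨hs', hq.1.trans hq.2⟩
  have h2 : q ∈ Icc s t := ⟨hs'.trans hq.1, hq.2⟩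
  have h0 : s ∈ Icc s t := ⟨le_rfl, hst⟩
  rw [hU.2 q h2, hU.2 s' h1, map_add, hP.comp hs hs' hq.1,
    ← (P q s').intervalIntegral_comp_comm (hP.intervalIntegrable hN hU.1 h0 h1 s'), add_assoc]
  congr 1
  rw [← intervalIntegral.integral_add_adjacent_intervals
    (hP.intervalIntegrable hN hU.1 h0 h1 q) (hP.intervalIntegrable hN hU.1 h1 h2 q)]
  congr 1
  refine intervalIntegral.integral_congr fun r hr => ?_
  rw [uIcc_of_le hs'] at hr
  exact (hP.comp (hs.trans hr.1) hr.2 hq.1 _).symm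

theorem exists_isMildOn [CompleteSpace X] (hP : IsEvolution P) (hs : 0 ≤ s) {L : ℝ} (hL : 0 ≤ L)
    (hN : ∀ x y, ‖N x - N y‖ ≤ L * ‖x - y‖) (hNc : Continuous N) (hN0 : N 0 = 0) (x : X) :
    ∃ U : ℝ → X, U s = x ∧ ∀ t, IsMildOn P N s t U := by
  have hlip : ∀ t r y z, s ≤ r → r ≤ t →
      ‖P t r (N y) - P t r (N z)‖ ≤ Real.exp (t - r) * (2 * L) * ‖y - z‖ := by
    intro t r y z hr hrt
    rw [← map_sub]
    refine (hP.norm_le (hs.trans hr) hrt _).trans ?_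
    calc 2 * Real.exp (t - r) * ‖N y - N z‖ ≤ 2 * Real.exp (t - r) * (L * ‖y - z‖) :=
          mul_le_mul_of_nonneg_left (hN y z) (by positivity)
      _ = Real.exp (t - r) * (2 * L) * ‖y - z‖ := by ring
  have hx : ∀ t, s ≤ t → ‖P t s x‖ ≤ 2 * ‖x‖ * Real.exp t := by
    intro t ht
    refine (hP.norm_le hs ht x).trans ?_
    have : Real.exp (t - s) ≤ Real.exp t := Real.exp_le_exp.2 (by linarith)
    nlinarith [norm_nonneg x]
  obtain ⟨U, hUc, hU⟩ := exists_volterra_solution (F := fun t r y => P t r (N y))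
    (hP.continuous.comp (continuous_fst.prodMk ((continuous_fst.comp continuous_snd).prodMk
      (hNc.comp (continuous_snd.comp continuous_snd))))) continuous_const (fun _ => by positivity)
    hlip (fun t r => by rw [hN0, map_zero])
    (hP.continuous.comp (continuous_id.prodMk (continuous_const.prodMk continuous_const))) hx
  have h0 : U s = x := by
    rw [hU s le_rfl, intervalIntegral.integral_same, add_zero]
    exact hP.self hs x
  exact ⟨U, h0, fun t => ⟨hUc.continuousOn, fun q hq => by rw [h0]; exact hU q hq.1⟩⟩

theorem IsMildOn.norm_le (hP : IsEvolution P) (hs : 0 ≤ s) {B : ℝ} (hB : ∀ x, ‖N x‖ ≤ B)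
    (hU : IsMildOn P N s t U) {q : ℝ} (hq : q ∈ Icc s t) :
    ‖U q‖ ≤ 2 * Real.exp (q - s) * (‖U s‖ + B * (q - s)) := by
  have hB0 : 0 ≤ B := (norm_nonneg _).trans (hB 0)
  rw [hU.2 q hq, mul_add]
  refine (norm_add_le _ _).trans (add_le_add (hP.norm_le hs hq.1 _) ?_)
  rw [← mul_assoc]
  have h := intervalIntegral.norm_integral_le_of_norm_le_const (a := s) (b := q)
    (f := fun r => P q r (N (U r))) (C := 2 * Real.exp (q - s) * B) fun r hr => ?_
  · rwa [abs_of_nonneg (by linarith [hq.1])] at h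
  · rw [uIoc_of_le hq.1] at hr
    refine (hP.norm_le (hs.trans hr.1.le) hr.2 _).trans
      (mul_le_mul ?_ (hB _) (norm_nonneg _) (by positivity))
    have : Real.exp (q - r) ≤ Real.exp (q - s) := Real.exp_le_exp.2 (by linarith [hr.1])
    linarith

/-- Maximal mild solutions of semilinear evolution equations with locally Lipschitz
nonlinearity. -/
theorem exists_maximal_mild [CompleteSpace X] (hP : IsEvolution P) (hN0 : N 0 = 0)
    (hN : ∀ R : ℝ, ∃ L : ℝ, ∀ x y, ‖x‖ ≤ R → ‖y‖ ≤ R → ‖N x - N y‖ ≤ L * ‖x - y‖) (x₀ : X) :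
    ∃ (T : EReal) (U : ℝ → X), 0 < T ∧ U 0 = x₀ ∧
      (∀ t ∈ lifeInterval T, ∃ δ > 0, t + δ ∈ lifeInterval T ∧ IsMildOn P N 0 (t + δ) U) ∧
      ∀ S : ℝ, T = S → Tendsto (fun t => ‖U t‖) (𝓝[<] S) atTop := by
  -- `Nk k` agrees with `N` on the ball of radius `k` and is globally Lipschitz and bounded, so its
  -- mild solution `V k` is global.
  choose Nk L B hL0 hL hB hNk using fun k : ℕ =>
    exists_lipschitz_truncation hN0 hN (k : ℝ) k.cast_nonneg
  have hNk0 : ∀ k, Nk k 0 = 0 := fun k => by rw [hNk k 0 (by simp), hN0]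
  have hNc : ∀ k, Continuous (Nk k) := fun k =>
    (LipschitzWith.of_dist_le' (K := L k) fun x y => by
      rw [dist_eq_norm, dist_eq_norm]; exact hL k x y).continuous
  choose V hV0 hV using fun k => exists_isMildOn hP le_rfl (hL0 k) (hL k) (hNc k) (hNk0 k) x₀
  -- As long as `V k` stays in its ball, it solves the original equation and agrees with every `V m`
  -- for `m ≥ k`; `U` glues these pieces.
  let G : ℕ → ℝ → Prop := fun k t => ∀ r ∈ Icc 0 t, ‖V k r‖ ≤ k
  have hGmono : ∀ {k : ℕ} {r t : ℝ}, r ≤ t → G k t → G k r := fun hr h q hq =>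
    h q ⟨hq.1, hq.2.trans hr⟩
  have hagree : ∀ {k m : ℕ} {t : ℝ}, k ≤ m → G k t → EqOn (V k) (V m) (Icc 0 t) := by
    intro k m t hkm hG
    refine IsMildOn.eqOn hP le_rfl (hL m) (hNc m) ((hV k t).congr_nonlinearity fun r hr => ?_)
      (hV m t) (by rw [hV0, hV0])
    rw [hNk k _ (hG r hr), hNk m _ ((hG r hr).trans (by exact_mod_cast hkm))]
  have hagree' : ∀ {k m : ℕ} {t : ℝ}, 0 ≤ t → G k t → G m t → V k t = V m t := by
    intro k m t ht hk hm
    rcases le_total k m with h | h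
    · exact hagree h hk ⟨ht, le_rfl⟩
    · exact (hagree h hm ⟨ht, le_rfl⟩).symm
  classical
  let U : ℝ → X := fun t => if h : ∃ k, G k t then V h.choose t else 0
  have hU : ∀ {k : ℕ} {t : ℝ}, G k t → EqOn U (V k) (Icc 0 t) := by
    intro k t hG r hr
    have h : ∃ k, G k r := ⟨k, hGmono hr.2 hG⟩
    simp only [U, dif_pos h]
    exact hagree' hr.1 h.choose_spec (hGmono hr.2 hG)
  have hmild : ∀ {k : ℕ} {t : ℝ}, 0 ≤ t → G k t → IsMildOn P N 0 t U := by
    intro k t ht hG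
    have h0 : U 0 = V k 0 := hU hG ⟨le_rfl, ht⟩
    have h1 := (hV k t).congr_nonlinearity fun r hr => hNk k _ (hG r hr)
    refine ⟨h1.1.congr (hU hG), fun q hq => ?_⟩
    rw [hU hG hq, h1.2 q hq, h0]
    congr 1
    refine intervalIntegral.integral_congr fun r hr => ?_
    rw [uIcc_of_le hq.1] at hr
    simp only [hU hG ⟨hr.1, hr.2.trans hq.2⟩]
  -- The continuation step. That `δ` depends only on `M` gives both that there is no last good time
  -- and that the norm blows up.
  have hext : ∀ M : ℝ, ∃ δ > 0, ∀ t, 0 ≤ t → (∃ k, G k t) → ‖U t‖ ≤ M → ∃ k, G k (t + δ) := by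
    intro M
    -- This is the bound of `IsMildOn.norm_le` over a step of length `δ ≤ 1` with `B j * δ ≤ 1`, so
    -- the solution restarted at `t` stays in the ball of radius `j`.
    obtain ⟨j, hj⟩ := exists_nat_ge (2 * Real.exp 1 * (M + 1))
    have hBj : 0 ≤ B j := (norm_nonneg _).trans (hB j 0)
    refine ⟨1 / (B j + 1), by positivity, fun t ht ⟨k, hk⟩ hM => ?_⟩
    set δ := 1 / (B j + 1)
    have hδ1 : δ ≤ 1 := by
      rw [div_le_one (by positivity)]
      linarith
    have hδB : B j * δ ≤ 1 := by
      rw [mul_one_div, div_le_one (by positivity)]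
      linarith
    have hM0 : 0 ≤ M := (norm_nonneg _).trans hM
    obtain ⟨W, hW0, hW⟩ := exists_isMildOn hP ht (hL0 j) (hL j) (hNc j) (hNk0 j) (U t)
    have hWj : ∀ q ∈ Icc t (t + δ), ‖W q‖ ≤ j := fun q hq => by
      refine ((hW (t + δ)).norm_le hP ht (hB j) hq).trans (le_trans ?_ hj)
      have h1 : Real.exp (q - t) ≤ Real.exp 1 := Real.exp_le_exp.2 (by linarith [hq.2])
      have h2 : ‖W t‖ + B j * (q - t) ≤ M + 1 := by
        rw [hW0]
        have : B j * (q - t) ≤ B j * δ := mul_le_mul_of_nonneg_left (by linarith [hq.2]) hBj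
        linarith
      exact mul_le_mul (by linarith) h2 (add_nonneg (norm_nonneg _)
        (mul_nonneg hBj (by linarith [hq.1]))) (by positivity)
    refine ⟨max k j, fun r hr => ?_⟩
    have hkV : EqOn (V k) (V (max k j)) (Icc 0 t) := hagree (le_max_left _ _) hk
    have hkm : (k : ℝ) ≤ ((max k j : ℕ) : ℝ) := by exact_mod_cast le_max_left k j
    have hjm : (j : ℝ) ≤ ((max k j : ℕ) : ℝ) := by exact_mod_cast le_max_right k j
    rcases le_total r t with h | h
    · rw [← hkV ⟨hr.1, h⟩]
      exact (hk r ⟨hr.1, h⟩).trans hkm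
    · have h1 : IsMildOn P (Nk (max k j)) t (t + δ) W :=
        (hW (t + δ)).congr_nonlinearity fun q hq => by
          rw [hNk j _ (hWj q hq), hNk _ _ ((hWj q hq).trans hjm)]
      have h2 := (hV (max k j) (t + δ)).restart hP le_rfl (hNc _) ht
      have h3 := h2.eqOn hP ht (hL _) (hNc _) h1 (by
        rw [hW0, hU hk ⟨ht, le_rfl⟩, hkV ⟨ht, le_rfl⟩])
      rw [h3 ⟨h, hr.2⟩]
      exact (hWj r ⟨h, hr.2⟩).trans hjm
  have hG0 : ∃ k, G k 0 := by
    obtain ⟨k, hk⟩ := exists_nat_ge ‖x₀‖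
    refine ⟨k, fun r hr => ?_⟩
    rw [le_antisymm hr.2 hr.1, hV0]
    exact hk
  -- By `hext` the supremum is not attained, so the good times are exactly the half-open interval
  -- `[0, T)`.
  let T : EReal := sSup ((fun t : ℝ => (t : EReal)) '' {t | 0 ≤ t ∧ ∃ k, G k t})
  have hlife : ∀ t, t ∈ lifeInterval T ↔ 0 ≤ t ∧ ∃ k, G k t := by
    intro t
    constructor
    · rintro ⟨ht, htT⟩
      obtain ⟨_, ⟨t', ⟨-, k, hk⟩, rfl⟩, h⟩ := lt_sSup_iff.1 htT
      exact ⟨ht, k, hGmono (EReal.coe_lt_coe_iff.1 h).le hk⟩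
    · rintro ⟨ht, hk⟩
      obtain ⟨δ, hδ, h⟩ := hext ‖U t‖
      refine ⟨ht, lt_of_lt_of_le (EReal.coe_lt_coe_iff.2 (lt_add_of_pos_right t hδ))
        (le_sSup ⟨t + δ, ⟨by linarith, h t ht hk le_rfl⟩, rfl⟩)⟩
  refine ⟨T, U, ((hlife 0).2 ⟨le_rfl, hG0⟩).2, ?_, fun t ht => ?_, fun S hS => ?_⟩
  · obtain ⟨k, hk⟩ := hG0
    rw [hU hk ⟨le_rfl, le_rfl⟩, hV0]
  · obtain ⟨ht0, hk⟩ := (hlife t).1 ht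
    obtain ⟨δ, hδ, h⟩ := hext ‖U t‖
    obtain ⟨k, hk'⟩ := h t ht0 hk le_rfl
    exact ⟨δ, hδ, (hlife _).2 ⟨by linarith, k, hk'⟩, hmild (by linarith) hk'⟩
  · refine tendsto_atTop.2 fun M => ?_
    obtain ⟨δ, hδ, h⟩ := hext M
    have hS0 : 0 < S := by
      have := ((hlife 0).2 ⟨le_rfl, hG0⟩).2
      rw [hS] at this
      exact_mod_cast this
    -- If the norm were below `M` at a time within `δ` of `S`, the solution would continue past `S`.
    -- This holds at every such time, hence a genuine limit.
    have hmem : Ioo (max 0 (S - δ)) S ∈ 𝓝[<] S :=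
      Ioo_mem_nhdsLT (max_lt hS0 (by linarith))
    filter_upwards [hmem] with t ht
    have ht0 : 0 ≤ t := (le_max_left _ _).trans ht.1.le
    by_contra! hlt
    have h1 := ((hlife t).1 ⟨ht0, by rw [hS]; exact EReal.coe_lt_coe_iff.2 ht.2⟩).2
    have h2 := ((hlife (t + δ)).2 ⟨by linarith, h t ht0 h1 hlt.le⟩).2
    rw [hS, EReal.coe_lt_coe_iff] at h2
    linarith [(le_max_right 0 (S - δ)).trans_lt ht.1]

end Semilinear

end DampedWave

end

/-! ### The second component as time derivative, and calculus on the lifespan. -/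

noncomputable section

namespace DampedWave

namespace HeatTriple

variable {V₀ V₁ V₂ : Type*} [NormedAddCommGroup V₀] [InnerProductSpace ℝ V₀]
    [NormedAddCommGroup V₁] [InnerProductSpace ℝ V₁] [NormedAddCommGroup V₂] [NormedSpace ℝ V₂]
    [CompleteSpace V₀] [CompleteSpace V₁] [CompleteSpace V₂] {E : HeatTriple V₀ V₁ V₂}
    {a α' : ℝ → ℝ} (ha : IsDamping a α')

theorem isEvolution_propagator : IsEvolution (E.propagator ha) where
  continuous := continuous_propagator ha
  norm_le hs ht x := norm_propagator_le ha hs ht x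
  self hs x := propagator_self ha hs x
  comp hr hs ht x := propagator_comp ha hr hs ht x

/-- Along mild solutions the second component is the derivative of the first one. -/
theorem fst_eq_of_isMildOn {g : V₁ → V₀} (hg : Continuous g) {U : ℝ → V₁ × V₀} {t : ℝ}
    (ht : 0 ≤ t) (hU : IsMildOn (E.propagator ha) (fun x => (0, g x.1)) 0 t U) :
    E.i₁ (U t).1 = E.i₁ (U 0).1 + ∫ q in (0 : ℝ)..t, (U q).2 := by
  have hP := isEvolution_propagator (E := E) ha
  have hgc : Continuous fun x : V₁ × V₀ => ((0, g x.1) : V₁ × V₀) :=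
    continuous_const.prodMk (hg.comp continuous_fst)
  -- Freezing `U` outside `[0,t]` makes the Duhamel integrand continuous on the whole plane, as the
  -- exchange of integrals requires.
  set Ũ : ℝ → V₁ × V₀ := IccExtend ht ((Icc 0 t).domRestrict U)
  have hŨc : Continuous Ũ := (continuousOn_iff_continuous_domRestrict.1 hU.1).Icc_extend'
  have hŨ : EqOn Ũ U (Icc 0 t) := fun r hr => IccExtend_of_mem ht _ hr
  set k : ℝ → ℝ → V₁ × V₀ := fun q r => E.propagator ha q r (0, g (Ũ r).1)
  have hk : Continuous fun q : ℝ × ℝ => k q.1 q.2 := by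
    have h1 : Continuous fun q : ℝ × ℝ => ((0, g (Ũ q.2).1) : V₁ × V₀) :=
      hgc.comp (hŨc.comp continuous_snd)
    have h2 := hP.continuous.comp (continuous_fst.prodMk (continuous_snd.prodMk h1))
    exact h2
  have hUk : ∀ q ∈ Icc 0 t, U q = E.propagator ha q 0 (U 0) + ∫ r in (0 : ℝ)..q, k q r := by
    intro q hq
    rw [hU.2 q hq]
    congr 1
    refine intervalIntegral.integral_congr fun r hr => ?_
    rw [uIcc_of_le hq.1] at hr
    simp only [k, hŨ ⟨hr.1, hr.2.trans hq.2⟩]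
  have hki : ∀ q a b, IntervalIntegrable (fun r => k q r) volume a b := fun q a b =>
    (hk.comp (continuous_const.prodMk continuous_id)).intervalIntegrable a b
  have hU2 : ∀ q ∈ Icc 0 t, (U q).2 =
      (E.propagator ha q 0 (U 0)).2 + ∫ r in (0 : ℝ)..q, (k q r).2 := by
    intro q hq
    have := congrArg (ContinuousLinearMap.snd ℝ V₁ V₀) (hUk q hq)
    rw [map_add, ← ContinuousLinearMap.intervalIntegral_comp_comm _ (hki q 0 q)] at this
    exact this
  have hU1 : E.i₁ (U t).1 =
      E.i₁ (E.propagator ha t 0 (U 0)).1 + ∫ r in (0 : ℝ)..t, E.i₁ (k t r).1 := by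
    have := congrArg (E.i₁.comp (ContinuousLinearMap.fst ℝ V₁ V₀)) (hUk t ⟨ht, le_rfl⟩)
    rw [map_add, ← ContinuousLinearMap.intervalIntegral_comp_comm _ (hki t 0 t)] at this
    exact this
  have hk2 : Continuous fun q : ℝ × ℝ => (k q.1 q.2).2 := continuous_snd.comp hk
  -- Each `k · r` starts at time `r` with vanishing first component, so its first component is the
  -- integral over `[r,t]` of its second one; the order of integration is then exchanged.
  have h3 : ∫ r in (0 : ℝ)..t, E.i₁ (k t r).1 =
      ∫ q in (0 : ℝ)..t, ∫ r in (0 : ℝ)..q, (k q r).2 := by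
    rw [← integral_triangle_swap hk2 ht]
    refine intervalIntegral.integral_congr fun r hr => ?_
    rw [uIcc_of_le ht] at hr
    have := propagator_fst_eq (E := E) ha hr.1 hr.2 (0, g (Ũ r).1)
    rw [map_zero, zero_add] at this
    exact this
  have c1 : Continuous fun q => (E.propagator ha q 0 (U 0)).2 := by
    have := hP.continuous.comp (continuous_id.prodMk
      (continuous_const.prodMk (continuous_const (y := U 0))) : Continuous fun q : ℝ =>
        ((q, 0, U 0) : ℝ × ℝ × (V₁ × V₀)))
    exact continuous_snd.comp this
  have c2 : Continuous fun q => ∫ r in (0 : ℝ)..q, (k q r).2 :=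
    intervalIntegral.continuous_parametric_intervalIntegral_of_continuous hk2 continuous_id
  rw [hU1, h3, propagator_fst_eq ha le_rfl ht, add_assoc, ← intervalIntegral.integral_add
    (c1.intervalIntegrable _ _) (c2.intervalIntegrable _ _)]
  congr 1
  refine intervalIntegral.integral_congr fun q hq => ?_
  rw [uIcc_of_le ht] at hq
  exact (hU2 q hq).symm

end HeatTriple

/-- The margin `δ` ensures that, near `t` and to the right of `0`, the integral formula holds;
freezing `g` outside `[0, t+δ]` then reduces the claim to a two-sided derivative. -/
theorem hasDerivWithinAt_of_integral {F : Type*} [NormedAddCommGroup F] [NormedSpace ℝ F]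
    [CompleteSpace F] {T : EReal} {f g : ℝ → F} {t δ : ℝ} (ht : 0 ≤ t) (hδ : 0 < δ)
    (hg : ContinuousOn g (Icc 0 (t + δ)))
    (hf : ∀ q ∈ Icc 0 (t + δ), f q = f 0 + ∫ r in (0 : ℝ)..q, g r) :
    HasDerivWithinAt f (g t) (lifeInterval T) t := by
  have h0 : 0 ≤ t + δ := by linarith
  set G : ℝ → F := IccExtend h0 ((Icc 0 (t + δ)).domRestrict g)
  have hGc : Continuous G := (continuousOn_iff_continuous_domRestrict.1 hg).Icc_extend'
  have hG : EqOn G g (Icc 0 (t + δ)) := fun r hr => IccExtend_of_mem h0 _ hr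
  have htm : t ∈ Icc 0 (t + δ) := ⟨ht, by linarith⟩
  have h1 : HasDerivAt (fun q => f 0 + ∫ r in (0 : ℝ)..q, G r) (G t) t :=
    (intervalIntegral.integral_hasDerivAt_right (hGc.intervalIntegrable _ _)
      (hGc.stronglyMeasurableAtFilter _ _) hGc.continuousAt).const_add _
  have h2 : ∀ q ∈ Icc 0 (t + δ), f q = f 0 + ∫ r in (0 : ℝ)..q, G r := fun q hq => by
    rw [hf q hq]
    congr 1
    refine intervalIntegral.integral_congr fun r hr => ?_
    rw [uIcc_of_le hq.1] at hr
    exact (hG ⟨hr.1, hr.2.trans hq.2⟩).symm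
  rw [← hG htm]
  refine h1.hasDerivWithinAt.congr_of_eventuallyEq ?_ (h2 t htm)
  have h3 : Iio (t + δ) ∈ 𝓝[lifeInterval T] t :=
    mem_nhdsWithin_of_mem_nhds (Iio_mem_nhds (by linarith))
  filter_upwards [h3, self_mem_nhdsWithin] with q hq hqT
  exact h2 q ⟨hqT.1, le_of_lt hq⟩

theorem ordConnected_lifeInterval (T : EReal) : (lifeInterval T).OrdConnected :=
  ⟨fun _ hx _ hy _ hz => ⟨hx.1.trans hz.1, (EReal.coe_le_coe_iff.2 hz.2).trans_lt hy.2⟩⟩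

theorem uniqueDiffOn_of_ordConnected {J : Set ℝ} (hJ : J.OrdConnected) (hn : J.Nontrivial) :
    UniqueDiffOn ℝ J := by
  obtain ⟨x, hx, y, hy, hxy⟩ := hn.exists_lt
  exact uniqueDiffOn_convex hJ.convex
    ⟨(x + y) / 2, mem_interior.2 ⟨Ioo x y, Ioo_subset_Icc_self.trans (hJ.out hx hy), isOpen_Ioo,
      ⟨by linarith, by linarith⟩⟩⟩

theorem zero_mem_lifeInterval {T : EReal} (hT : 0 < T) : (0 : ℝ) ∈ lifeInterval T :=
  ⟨le_rfl, by exact_mod_cast hT⟩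

theorem nontrivial_lifeInterval {T : EReal} (hT : 0 < T) : (lifeInterval T).Nontrivial := by
  obtain ⟨t, ht0, htT⟩ := EReal.lt_iff_exists_real_btwn.1 hT
  have h : 0 < t := by exact_mod_cast ht0
  exact ⟨0, zero_mem_lifeInterval hT, t, ⟨h.le, htT⟩, h.ne⟩

end DampedWave

end

/-! ### Mild solutions of the damped wave equation: uniqueness, existence and blow-up. -/

noncomputable section

namespace DampedWave

theorem continuous_of_lipschitz_on_balls {X Y : Type*} [NormedAddCommGroup X]
    [NormedAddCommGroup Y] {N : X → Y}
    (hN : ∀ R : ℝ, ∃ L : ℝ, ∀ x y, ‖x‖ ≤ R → ‖y‖ ≤ R → ‖N x - N y‖ ≤ L * ‖x - y‖) :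
    Continuous N := by
  refine continuous_iff_continuousAt.2 fun x => ?_
  obtain ⟨L, hL⟩ := hN (‖x‖ + 1)
  rw [ContinuousAt, tendsto_iff_norm_sub_tendsto_zero]
  have h1 : Tendsto (fun y => L * ‖y - x‖) (𝓝 x) (𝓝 0) := by
    have : Continuous fun y => L * ‖y - x‖ := by fun_prop
    simpa using this.tendsto x
  refine squeeze_zero' (Eventually.of_forall fun _ => norm_nonneg _) ?_ h1
  have h2 : ∀ᶠ y in 𝓝 x, ‖y‖ < ‖x‖ + 1 :=
    continuous_norm.continuousAt.eventually_lt continuousAt_const (lt_add_one _)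
  filter_upwards [h2] with y hy
  exact hL y x hy.le (by linarith)

attribute [local instance] H1.normedAddCommGroup H1.normedSpace H1.module H2.normedAddCommGroup
  H2.normedSpace H2.module

variable {n : ℕ} {b₀ β p : ℝ} {u₀ : H1 n} {u₁ : L2 n}

theorem S_eq_waveProp (hb₀ : 0 < b₀) {s t : ℝ} (hs : 0 ≤ s) (ht : s ≤ t) (g : L2 n) :
    S b₀ β t s g = (waveProp n hb₀ β t s (0, g)).1 :=
  R_eq_waveProp hb₀ β hs ht (0, g)

theorem isEvolution_waveProp (n : ℕ) (hb₀ : 0 < b₀) (β : ℝ) : IsEvolution (waveProp n hb₀ β) :=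
  HeatTriple.isEvolution_propagator (isDamping_dampingCoeff hb₀ β)

theorem norm_S_sub_le (hb₀ : 0 < b₀) {s t T : ℝ} (hs : 0 ≤ s) (ht : s ≤ t) (hT : t ≤ T)
    (g h : L2 n) : ‖S b₀ β t s g - S b₀ β t s h‖ ≤ 2 * Real.exp T * ‖g - h‖ := by
  have e : S b₀ β t s g - S b₀ β t s h = (waveProp n hb₀ β t s (0, g - h)).1 := by
    rw [S_eq_waveProp hb₀ hs ht, S_eq_waveProp hb₀ hs ht, ← Prod.fst_sub, ← map_sub,
      Prod.mk_sub_mk, sub_zero]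
  rw [e]
  refine (norm_fst_le _).trans (((isEvolution_waveProp n hb₀ β).norm_le hs ht _).trans ?_)
  rw [Prod.norm_mk, norm_zero, max_eq_right (norm_nonneg _)]
  have : Real.exp (t - s) ≤ Real.exp T := Real.exp_le_exp.2 (by linarith)
  exact mul_le_mul_of_nonneg_right (by linarith) (norm_nonneg _)

section

variable (hb₀ : 0 < b₀)
  (hN : ∀ R : ℝ, ∃ L : ℝ, ∀ u v : H1 n, ‖u‖ ≤ R → ‖v‖ ≤ R →
    ‖absPow p u.toL2 - absPow p v.toL2‖ ≤ L * ‖u - v‖)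
include hb₀ hN

/-- The nonlinearity involves only `u`, so Gronwall's inequality closes in `H¹` without the time
derivative. The Lipschitz constant is taken on a ball containing both solutions over the compact
interval. -/
theorem IsMildSolution.eqOn_Icc {J J' : Set ℝ} {v w : ℝ → H1 n}
    (hv : IsMildSolution b₀ β p u₀ u₁ J v) (hw : IsMildSolution b₀ β p u₀ u₁ J' w) {T : ℝ}
    (hJ : Icc 0 T ⊆ J) (hJ' : Icc 0 T ⊆ J') : EqOn v w (Icc 0 T) := by
  obtain ⟨M, hM⟩ := isCompact_Icc.exists_bound_of_continuousOn (hv.continuousOn.mono hJ)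
  obtain ⟨M', hM'⟩ := isCompact_Icc.exists_bound_of_continuousOn (hw.continuousOn.mono hJ')
  obtain ⟨L, hL⟩ := hN (max M M')
  refine eqOn_of_volterra (F := fun t r y => S b₀ β t r (absPow p (H1.toL2 y)))
    (x₀ := fun t => R b₀ β t 0 (u₀, u₁)) (C := 2 * Real.exp T * L)
    (hv.continuousOn.mono hJ) (hw.continuousOn.mono hJ') (fun t ht => hv.integrable t (hJ ht))
    (fun t ht => hw.integrable t (hJ' ht)) (fun t ht r hr => ?_)
    (fun t ht => hv.equation t (hJ ht)) (fun t ht => hw.equation t (hJ' ht))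
  have hrT : r ∈ Icc 0 T := ⟨hr.1, hr.2.trans ht.2⟩
  refine (norm_S_sub_le hb₀ hr.1 hr.2 ht.2 _ _).trans ?_
  rw [mul_assoc _ L]
  exact mul_le_mul_of_nonneg_left (hL _ _ ((hM r hrT).trans (le_max_left _ _))
    ((hM' r hrT).trans (le_max_right _ _))) (by positivity)

variable {T : EReal} {U : ℝ → H1 n × L2 n} (hT : 0 < T) (hU0 : U 0 = (u₀, u₁))
  (hU : ∀ t ∈ lifeInterval T, ∃ δ > 0, t + δ ∈ lifeInterval T ∧
    IsMildOn (waveProp n hb₀ β) (fun x => (0, absPow p x.1.toL2)) 0 (t + δ) U)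
include hU hT

/-- This identifies the `L²` component of the abstract state with `u_t`, so the abstract blow-up
concerns `‖u‖` and `‖u_t‖`. -/
theorem timeDeriv_fst_eq {t : ℝ} (ht : t ∈ lifeInterval T) :
    HasDerivWithinAt (fun q => (U q).1.toL2) (U t).2 (lifeInterval T) t ∧
      timeDeriv (lifeInterval T) (fun q => (U q).1) t = (U t).2 := by
  obtain ⟨δ, hδ, -, hm⟩ := hU t ht
  have h := hasDerivWithinAt_of_integral (T := T) (f := fun q => (U q).1.toL2)
    (g := fun q => (U q).2) ht.1 hδ (continuous_snd.comp_continuousOn hm.1) fun q hq =>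
      HeatTriple.fst_eq_of_isMildOn (isDamping_dampingCoeff hb₀ β) (E := heatTriple n)
        (continuous_of_lipschitz_on_balls hN) hq.1 (hm.mono hq.2)
  exact ⟨h, h.derivWithin (uniqueDiffOn_of_ordConnected (ordConnected_lifeInterval T)
    (nontrivial_lifeInterval hT) t ht)⟩

include hU0

theorem isMildSolution_fst
    (hmem : ∀ u : H1 n, MemLp (fun x => |u.toL2 x| ^ p) 2 (volume : Measure (Space n))) :
    IsMildSolution b₀ β p u₀ u₁ (lifeInterval T) fun t => (U t).1 := by
  have hgc : Continuous fun x : H1 n × L2 n => ((0, absPow p x.1.toL2) : H1 n × L2 n) :=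
    continuous_const.prodMk ((continuous_of_lipschitz_on_balls hN).comp continuous_fst)
  have hP := isEvolution_waveProp n hb₀ β
  have hUc : ContinuousOn U (lifeInterval T) := by
    intro t ht
    obtain ⟨δ, hδ, -, hm⟩ := hU t ht
    refine ContinuousWithinAt.mono_of_mem_nhdsWithin
      (hm.1 t ⟨ht.1, by linarith⟩) ?_
    filter_upwards [mem_nhdsWithin_of_mem_nhds (Iio_mem_nhds (lt_add_of_pos_right t hδ)),
      self_mem_nhdsWithin] with q hq hqT
    exact ⟨hqT.1, le_of_lt hq⟩
  have hJ := uniqueDiffOn_of_ordConnected (ordConnected_lifeInterval T) (nontrivial_lifeInterval hT)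
  have hSe : ∀ t, 0 ≤ t → EqOn (fun s => S b₀ β t s (absPow p (U s).1.toL2))
      (fun s => (waveProp n hb₀ β t s (0, absPow p (U s).1.toL2)).1) (uIcc 0 t) := by
    intro t ht s hs
    rw [uIcc_of_le ht] at hs
    exact S_eq_waveProp hb₀ hs.1 hs.2 _
  have hint : ∀ t ∈ lifeInterval T, IntervalIntegrable
      (fun s => waveProp n hb₀ β t s (0, absPow p (U s).1.toL2)) volume 0 t := fun t ht =>
    hP.intervalIntegrable (s := 0) (t := t) hgc
      (hUc.mono ((ordConnected_lifeInterval T).out (zero_mem_lifeInterval hT) ht))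
      ⟨le_rfl, ht.1⟩ ⟨ht.1, le_rfl⟩ t
  refine ⟨continuous_fst.comp_continuousOn hUc, ?_, by rw [hU0], ?_, fun t _ => hmem _,
    fun t ht => ?_, fun t ht => ?_⟩
  · rw [contDiffOn_one_iff_derivWithin hJ]
    refine ⟨fun t ht => (timeDeriv_fst_eq hb₀ hN hT hU ht).1.differentiableWithinAt, ?_⟩
    exact (continuous_snd.comp_continuousOn hUc).congr fun t ht =>
      (timeDeriv_fst_eq hb₀ hN hT hU ht).2
  · rw [(timeDeriv_fst_eq hb₀ hN hT hU (zero_mem_lifeInterval hT)).2, hU0]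
  · have h1 : IntervalIntegrable (fun s => (waveProp n hb₀ β t s
        (0, absPow p (U s).1.toL2)).1) volume 0 t :=
      ⟨(ContinuousLinearMap.fst ℝ (H1 n) (L2 n)).integrable_comp (hint t ht).1,
        (ContinuousLinearMap.fst ℝ (H1 n) (L2 n)).integrable_comp (hint t ht).2⟩
    exact h1.congr ((hSe t ht.1).symm.mono uIoc_subset_uIcc)
  · obtain ⟨δ, hδ, -, hm⟩ := hU t ht
    have h1 := hm.2 t ⟨ht.1, by linarith⟩
    have h2 := congrArg (ContinuousLinearMap.fst ℝ (H1 n) (L2 n)) h1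
    rw [map_add, ← ContinuousLinearMap.intervalIntegral_comp_comm _ (hint t ht), hU0] at h2
    rw [R_eq_waveProp hb₀ β le_rfl ht.1, intervalIntegral.integral_congr (hSe t ht.1)]
    exact h2

end

/-- A mild solution cannot be continued to a closed interval beyond a blow-up time. -/
theorem IsMildSolution.subset_lifeInterval {T : EReal} (hT : 0 < T) {u v : ℝ → H1 n} {J : Set ℝ}
    (hJ : IsTimeInterval J) (hv : IsMildSolution b₀ β p u₀ u₁ J v)
    (huv : ∀ t ∈ J, t ∈ lifeInterval T → v t = u t)
    (hblow : ∀ S : ℝ, T = S →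
      Tendsto (fun t => ‖u t‖ + ‖timeDeriv (lifeInterval T) u t‖) (𝓝[<] S) atTop) :
    J ⊆ lifeInterval T := by
  by_contra hsub
  obtain ⟨t, htJ, ht⟩ := not_subset.1 hsub
  have ht0 : 0 ≤ t := hJ.nonneg htJ
  have hTt : T ≤ t := by
    by_contra! h
    exact ht ⟨ht0, h⟩
  obtain ⟨S, rfl⟩ : ∃ S : ℝ, T = S :=
    ⟨T.toReal, (EReal.coe_toReal (ne_top_of_le_ne_top (EReal.coe_ne_top t) hTt)
      (ne_bot_of_gt hT)).symm⟩
  have hS : 0 < S := by exact_mod_cast hT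
  -- If `J` left the lifespan it would contain the compact interval `[0,S]`, on which `v` and its
  -- time derivative are bounded; but `u = v` on `(0,S)`.
  have hIcc : Icc 0 S ⊆ J := (Icc_subset_Icc_right (by exact_mod_cast hTt)).trans
    (hJ.ordConnected.out hJ.zero_mem htJ)
  have hder : ContinuousOn (timeDeriv J v) J :=
    ((contDiffOn_one_iff_derivWithin
      (uniqueDiffOn_of_ordConnected hJ.ordConnected hJ.nontrivial)).1 hv.contDiffOn).2
  obtain ⟨M, hM⟩ := isCompact_Icc.exists_bound_of_continuousOn (hv.continuousOn.mono hIcc)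
  obtain ⟨M', hM'⟩ := isCompact_Icc.exists_bound_of_continuousOn (hder.mono hIcc)
  have h1 := (tendsto_atTop.1 (hblow S rfl) (M + M' + 1)).and (Ioo_mem_nhdsLT hS)
  obtain ⟨q, hq, hq0⟩ := h1.exists
  have hlife : ∀ r ∈ Ioo 0 S, r ∈ lifeInterval (S : EReal) := fun r hr =>
    ⟨hr.1.le, EReal.coe_lt_coe_iff.2 hr.2⟩
  have hnhds : Ioo 0 S ∈ 𝓝 q := Ioo_mem_nhds hq0.1 hq0.2
  have hqI : q ∈ Icc 0 S := Ioo_subset_Icc_self hq0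
  have e1 : v q = u q := huv q (hIcc hqI) (hlife q hq0)
  -- At an interior point both one-set derivatives are the ordinary derivative, so the choice of
  -- interval is immaterial.
  have e2 : timeDeriv (lifeInterval (S : EReal)) u q = timeDeriv J v q := by
    unfold timeDeriv
    rw [derivWithin_of_mem_nhds (mem_of_superset hnhds hlife),
      derivWithin_of_mem_nhds (mem_of_superset hnhds (Ioo_subset_Icc_self.trans hIcc))]
    refine EventuallyEq.deriv_eq ?_
    filter_upwards [hnhds] with r hr
    rw [huv r (hIcc (Ioo_subset_Icc_self hr)) (hlife r hr)]
  rw [e2, ← e1] at hq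
  linarith [hM q hqI, hM' q hqI]

theorem exists_maximal_isMildSolution (hn : 1 ≤ n) (hb₀ : 0 < b₀) (hp : 1 < p)
    (hpn : 3 ≤ n → p ≤ (n : ℝ) / ((n : ℝ) - 2)) (β : ℝ) (u₀ : H1 n) (u₁ : L2 n) :
    ∃ (Tmax : EReal) (u : ℝ → H1 n), 0 < Tmax ∧
      IsMildSolution b₀ β p u₀ u₁ (lifeInterval Tmax) u ∧
      (∀ (J : Set ℝ) (v : ℝ → H1 n), IsTimeInterval J →
        IsMildSolution b₀ β p u₀ u₁ J v → J ⊆ lifeInterval Tmax ∧ EqOn v u J) ∧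
      (∀ T : ℝ, Tmax = T →
        Tendsto (fun t => ‖u t‖ + ‖timeDeriv (lifeInterval Tmax) u t‖) (𝓝[<] T) atTop) := by
  have hN := H1.exists_norm_absPow_sub_le hp hn hpn
  have hNX : ∀ R : ℝ, ∃ L : ℝ, ∀ x y : H1 n × L2 n, ‖x‖ ≤ R → ‖y‖ ≤ R →
      ‖((0, absPow p x.1.toL2) : H1 n × L2 n) - (0, absPow p y.1.toL2)‖ ≤ L * ‖x - y‖ := by
    intro R
    obtain ⟨L, hL⟩ := hN R
    refine ⟨|L|, fun x y hx hy => ?_⟩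
    rw [Prod.mk_sub_mk, sub_zero, Prod.norm_mk, norm_zero, max_eq_right (norm_nonneg _)]
    refine (hL x.1 y.1 ((norm_fst_le x).trans hx) ((norm_fst_le y).trans hy)).trans ?_
    exact mul_le_mul (le_abs_self L) (norm_fst_le (x - y)) (norm_nonneg _) (abs_nonneg _)
  have hN0 : ((0, absPow p (0 : H1 n × L2 n).1.toL2) : H1 n × L2 n) = 0 := by
    have : absPow p (0 : H1 n × L2 n).1.toL2 = 0 := absPow_zero (by linarith)
    rw [this]
    rfl
  obtain ⟨T, U, hT, hU0, hU, hblow⟩ := exists_maximal_mild (isEvolution_waveProp n hb₀ β) hN0 hNX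
    (u₀, u₁)
  have hsol := isMildSolution_fst hb₀ hN hT hU0 hU (H1.memLp_abs_rpow hp hn hpn)
  have hblow' : ∀ S : ℝ, T = S → Tendsto (fun t => ‖(U t).1‖ +
      ‖timeDeriv (lifeInterval T) (fun t => (U t).1) t‖) (𝓝[<] S) atTop := by
    intro S hS
    -- The product `H1 n × L2 n` carries the maximum norm, which is at most the sum of the two
    -- norms.
    refine tendsto_atTop_mono' _ ?_ (hblow S hS)
    have hS0 : 0 < S := by
      rw [hS] at hT
      exact_mod_cast hT
    filter_upwards [Ioo_mem_nhdsLT hS0] with t ht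
    have htl : t ∈ lifeInterval T := ⟨ht.1.le, by rw [hS]; exact EReal.coe_lt_coe_iff.2 ht.2⟩
    rw [(timeDeriv_fst_eq hb₀ hN hT hU htl).2]
    exact max_le (le_add_of_nonneg_right (norm_nonneg _)) (le_add_of_nonneg_left (norm_nonneg _))
  refine ⟨T, fun t => (U t).1, hT, hsol, fun J v hJ hv => ?_, hblow'⟩
  have huv : ∀ t ∈ J, t ∈ lifeInterval T → v t = (U t).1 := fun t htJ ht =>
    hv.eqOn_Icc hb₀ hN hsol (hJ.ordConnected.out hJ.zero_mem htJ)
      ((ordConnected_lifeInterval T).out (zero_mem_lifeInterval hT) ht) ⟨ht.1, le_rfl⟩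
  have hsub := hv.subset_lifeInterval hT hJ huv hblow'
  exact ⟨hsub, fun t ht => huv t ht (hsub ht)⟩

end DampedWave

end

open DampedWave
theorem proposition3p3 (n : ℕ) (hn : 1 ≤ n) (b₀ β p : ℝ) (hb₀ : 0 < b₀) (hp : 1 < p)
    (hpn : 3 ≤ n → p ≤ (n : ℝ) / ((n : ℝ) - 2)) (u₀ : H1 n) (u₁ : L2 n) :
    ∃ (Tmax : EReal) (u : ℝ → H1 n), 0 < Tmax ∧
      IsMildSolution b₀ β p u₀ u₁ (lifeInterval Tmax) u ∧
      (∀ (J : Set ℝ) (v : ℝ → H1 n), IsTimeInterval J →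
        IsMildSolution b₀ β p u₀ u₁ J v → J ⊆ lifeInterval Tmax ∧ EqOn v u J) ∧
      (∀ T : ℝ, Tmax = T →
        Tendsto (fun t => ‖u t‖ + ‖timeDeriv (lifeInterval Tmax) u t‖) (𝓝[<] T) atTop) :=
  exists_maximal_isMildSolution hn hb₀ hp hpn β u₀ u₁
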